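/- Let $n\ge 1$ and let $A,F,Q\in\mathbb R^{n\times n}$. Write $\mathbb C^-=\{z\in\mathbb C:\operatorname{Re}z<0\}$ and let $\mathcal W(M)=\{x^HMx:\ x\in\mathbb C^m,\ \|x\|_2=1\}$ denote the numerical range of an $m\times m$ matrix $M$. For $M\in\mathbb R^{n\times n}$ let $$\mathrm{Off}(M)=\{M(s+1:n,\,1:s):\ 1\le s\le n-1\}\cup\{M(1:s,\,s+1:n):\ 1\le s\le n-1\},$$ and call $M$ quasiseparable of order $r$ if $r$ is the maximal rank of the matrices in $\mathrm{Off}(M)$ ($r=0$ if $n=1$). Assume that $\mathcal W(A)\subset\mathbb C^-$, that $F$ and $Q$ are symmetric positive semidefinite, and that $A,F,Q$ are quasiseparable of orders $r_a,r_f,r_q$, respectively. Let $X\in\mathbb R^{n\times n}$ be the stabilizing solution of $$A^\top X+XA-XFX+Q=0,$$ that is, its symmetric positive semidefinite solution, for which the closed-loop matrix $A-FX$ has eigenvalues with non-positive real parts. For $j=1,\dots,n$ let $A^{(j)},F^{(j)},Q^{(j)}$ (resp. $A_{(j)},F_{(j)},Q_{(j)}$) be the principal submatrices of $A,F,Q$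 on the first (resp. last) $j$ indices, and let $X^{(j)}$ (resp. $X_{(j)}$) be the symmetric positive semidefinite stabilizing solution of the Riccati equation with these coefficients. Let $E\subset\mathbb C^-$ be a set with $$\mathrm{conv}\Big(\bigcup_{j=1}^n\mathcal W\big(A^{(j)}-F^{(j)}X^{(j)}\big)\ \cup\ \bigcup_{j=1}^n\mathcal W\big(A_{(j)}-F_{(j)}X_{(j)}\big)\Big)\subset E .$$ Then, if $X\neq 0$, the singular values $\sigma_1(M)\ge\sigma_2(M)\ge\dots$ (with $\sigma_i(M)=0$ when $i$ exceeds the number of rows or columns of $M$) of every $M\in\mathrm{Off}(X)$ satisfy $$\frac{\sigma_{ht+1}(M)}{\|X\|_2}\le(1+\sqrt2)^2\,Z_h(E,-E),\qquad h=1,2,\dots,\qquad t=4r_a+2r_f+2r_q,$$ where $$Z_h(E,-E)=\inf_{g}\frac{\sup_{z\in E}|g(z)|}{\inf_{z\in -E}|g(z)|}$$ is the $h$-th Zolotarev number: $g$ ranges over the rational functions with numerator and denominator of degree at most $h$, $|g|=\infty$ at poles, with $\sup_E|g|<\infty$ and $\inf_{-E}|g|>0$. -/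

import Mathlib

open scoped Pointwise ENNReal Matrix

noncomputable section

namespace Care

/-- The open left half-plane `ℂ⁻`. -/
def leftHalfPlane : Set ℂ := {z | z.re < 0}

/-- The numerical range `{xᴴ M x : x ∈ ℂⁿ, ‖x‖₂ = 1}` of a complex square matrix. -/
def numericalRange {ι : Type*} [Fintype ι] (M : Matrix ι ι ℂ) : Set ℂ :=
  {z | ∃ x : EuclideanSpace ℂ ι, ‖x‖ = 1 ∧ z = star x.ofLp ⬝ᵥ (M *ᵥ x.ofLp)}

/-- A real matrix viewed as a complex one. -/
def toComplex {ι κ : Type*} (M : Matrix ι κ ℝ) : Matrix ι κ ℂ :=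
  M.map (fun a : ℝ => (a : ℂ))

/-- The spectral norm of a real square matrix: the operator norm for the Euclidean norm. -/
def spectralNorm {ι : Type*} [Fintype ι] [DecidableEq ι] (M : Matrix ι ι ℝ) : ℝ :=
  ‖Matrix.toEuclideanCLM (n := ι) (𝕜 := ℝ) M‖

/-- The `k`-th singular value of a real matrix, numbered from `k = 1` in decreasing order
(it is zero once `k` exceeds the number of rows or of columns). Mathlib's numbering starts
from `0`. -/
def singularValue {ι κ : Type*} [Fintype ι] [Fintype κ] [DecidableEq κ]
    (M : Matrix ι κ ℝ) (k : ℕ) : ℝ :=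
  (Matrix.toEuclideanLin M).singularValues (k - 1)

/-- The lower off-diagonal block `M(s+1:n, 1:s)`. -/
def lowerBlock {n : ℕ} (M : Matrix (Fin n) (Fin n) ℝ) (s : ℕ) :
    Matrix {i : Fin n // s ≤ (i : ℕ)} {i : Fin n // (i : ℕ) < s} ℝ :=
  M.submatrix Subtype.val Subtype.val

/-- The upper off-diagonal block `M(1:s, s+1:n)`. -/
def upperBlock {n : ℕ} (M : Matrix (Fin n) (Fin n) ℝ) (s : ℕ) :
    Matrix {i : Fin n // (i : ℕ) < s} {i : Fin n // s ≤ (i : ℕ)} ℝ :=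
  M.submatrix Subtype.val Subtype.val

/-- The quasiseparable order: the maximal rank of the off-diagonal blocks, `s = 1, …, n - 1`. -/
def qsrank {n : ℕ} (M : Matrix (Fin n) (Fin n) ℝ) : ℕ :=
  (Finset.Ico 1 n).sup fun s => max (lowerBlock M s).rank (upperBlock M s).rank

/-- The indices of the first `j` rows and columns. -/
abbrev FirstIdx (n j : ℕ) : Type := {i : Fin n // (i : ℕ) < j}

/-- The indices of the last `j` rows and columns. -/
abbrev LastIdx (n j : ℕ) : Type := {i : Fin n // n ≤ (i : ℕ) + j}

/-- The leading principal submatrix on the first `j` indices. -/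
def leading {n : ℕ} (M : Matrix (Fin n) (Fin n) ℝ) (j : ℕ) :
    Matrix (FirstIdx n j) (FirstIdx n j) ℝ :=
  M.submatrix Subtype.val Subtype.val

/-- The trailing principal submatrix on the last `j` indices. -/
def trailing {n : ℕ} (M : Matrix (Fin n) (Fin n) ℝ) (j : ℕ) :
    Matrix (LastIdx n j) (LastIdx n j) ℝ :=
  M.submatrix Subtype.val Subtype.val

/-- The closed-loop matrix `A - F X`. -/
def closedLoop {ι : Type*} [Fintype ι] (A F X : Matrix ι ι ℝ) : Matrix ι ι ℝ :=
  A - F * X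

/-- `X` is the symmetric positive semidefinite stabilizing solution of
`Aᵀ X + X A - X F X + Q = 0`, the Riccati equation associated with the Hamiltonian matrix
`[A, -F; -Q, -Aᵀ]`: the eigenvalues of the closed-loop matrix have non-positive real parts. -/
structure IsStabilizingSolution {ι : Type*} [Fintype ι] [DecidableEq ι]
    (A F Q X : Matrix ι ι ℝ) : Prop where
  posSemidef : X.PosSemidef
  riccati : Aᵀ * X + X * A - X * F * X + Q = 0
  stable : ∀ μ ∈ spectrum ℂ (toComplex (closedLoop A F X)), μ.re ≤ 0

/-- The modulus `|g(z)|` of a rational function, equal to `∞` at the poles. The numerator and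
the denominator of a `RatFunc` are coprime. -/
def ratAbs (g : RatFunc ℂ) (z : ℂ) : ℝ≥0∞ :=
  if g.denom.eval z = 0 then ⊤ else ENNReal.ofReal ‖g.num.eval z / g.denom.eval z‖

/-- The rational functions admitted at level `h` for the pair `(E, G)`: numerator and denominator
have degree at most `h`, and the quotient `sup_E |g| / inf_G |g|` is not of the form `∞ / _` or
`_ / 0`. -/
def zolotarevAdmissible (h : ℕ) (E G : Set ℂ) : Set (RatFunc ℂ) :=
  {g | g.num.natDegree ≤ h ∧ g.denom.natDegree ≤ h ∧
    (⨆ z ∈ E, ratAbs g z) ≠ ⊤ ∧ (⨅ z ∈ G, ratAbs g z) ≠ 0}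

/-- The `h`-th Zolotarev number of `(E, G)`, the infimum of `sup_E |g| / inf_G |g|` over rational
functions of type `(h, h)`. The infimum is at most `1` (take `g = 1`), hence finite. -/
def zolotarev (h : ℕ) (E G : Set ℂ) : ℝ :=
  (⨅ g ∈ zolotarevAdmissible h E G,
    (⨆ z ∈ E, ratAbs g z) / (⨅ z ∈ G, ratAbs g z)).toReal

end Care

end

noncomputable section

open Complex MeasureTheory Filter Topology intervalIntegral

/-! Put C = A - FX and split the indices into two complementary blocks f and g. In the (f,g) block
of the Riccati equation, C_ffᵀ X_fg + X_fg C_gg collects everything except terms that contain an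
off-diagonal block of A, F or Q as a factor. So X_fg solves a Sylvester equation BY - YD with B =
C_ffᵀ, D = -C_gg and a right-hand side of rank at most t (`rank_sylvester_block_le`).

For a rational function r = p/q of type (h,h), the matrix Y - r(B) Y r(D)⁻¹ has rank at most ht
(`rank_aeval_sub_le`), so σ_{ht+1}(Y) is at most ‖r(B)‖ ‖r(D)⁻¹‖ ‖Y‖. The Crouzeix–Palencia theorem
bounds each of the two matrix functions by 1 + √2 times a supremum over a numerical range. Principal
submatrices and transposes do not enlarge numerical ranges, so W(B) lies in E and W(D) in -E once
W(C) does; the infimum over r is the Zolotarev number (`singularValue_block_le`,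
`le_mul_zolotarev`). The inclusion of W(C) in E is the assumption on the leading solution of size n:
that solution equals X, because the difference of the two solves a homogeneous Sylvester equation
whose coefficients have separated spectra (`eq_of_isStabilizingSolution`).

The Crouzeix–Palencia theorem is proved in `norm_eval_le` for diagonalizable T and smooth strictly
convex domains containing W(T). Let g be the Cauchy transform of the conjugate of f. Then |g| ≤ 1
when |f| ≤ 1 (`norm_cauchy_conj_le`), and f(T) + g(T)* is an integral of f against a positive
operator measure of mass 2, hence of norm at most 2. An extremal argument of Ransford–Schwenninger
type converts the two bounds into 1 + √2. General matrices and numerical ranges follow by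
approximating both the matrix and the domain. -/

/-- A closed curve whose tangent at the parameter `θ` is a positive multiple of `i e^{iθ}`. Such a
curve bounds a smooth strictly convex domain, with outer normal `e^{iθ}` at the parameter `θ`. -/
structure ConvexCurve where
  /-- the curve -/
  pt : ℝ → ℂ
  /-- the speed of the curve -/
  speed : ℝ → ℝ
  /-- a lower bound of the speed -/
  minSpeed : ℝ
  minSpeed_pos : 0 < minSpeed
  minSpeed_le : ∀ θ, minSpeed ≤ speed θ
  speed_continuous : Continuous speed
  speed_periodic : Function.Periodic speed (2 * Real.pi)
  pt_periodic : Function.Periodic pt (2 * Real.pi)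
  hasDerivAt_pt : ∀ θ : ℝ, HasDerivAt pt (I * cexp (θ * I) * speed θ) θ

/-! ### Geometry of strictly convex curves through their supporting lines. -/

namespace ConvexCurve

variable (γ : ConvexCurve) {z : ℂ} {f : ℂ → ℂ} {U : Set ℂ}

/-- The vector from `z` to the point of the curve, in the frame of the outer normal. -/
def rel (z : ℂ) (θ : ℝ) : ℂ := cexp (-(θ * I)) * (γ.pt θ - z)

/-- The domain enclosed by the curve, as an intersection of half-planes. -/
def inner : Set ℂ := {z | ∀ θ, 0 < (γ.rel z θ).re}

/-- The distance of `z` to the nearest supporting line. -/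
def depth (z : ℂ) : ℝ := ⨅ θ, (γ.rel z θ).re

lemma speed_pos (θ : ℝ) : 0 < γ.speed θ := γ.minSpeed_pos.trans_le (γ.minSpeed_le θ)

lemma continuous_pt : Continuous γ.pt :=
  continuous_iff_continuousAt.2 fun θ => (γ.hasDerivAt_pt θ).continuousAt

lemma exp_neg_mul_I_periodic :
    Function.Periodic (fun θ : ℝ => cexp (-(θ * I))) (2 * Real.pi) := by
  intro θ
  have : -(((θ + 2 * Real.pi : ℝ) : ℂ) * I) = -(θ * I) - 2 * Real.pi * I := by push_cast; ring
  simp only [this]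
  exact Complex.exp_periodic.sub_eq _

lemma rel_periodic (z : ℂ) : Function.Periodic (γ.rel z) (2 * Real.pi) := by
  intro θ
  have h1 := exp_neg_mul_I_periodic θ
  simp only at h1
  simp only [rel, γ.pt_periodic θ, h1]

lemma continuous_rel (z : ℂ) : Continuous (γ.rel z) := by
  have := γ.continuous_pt
  unfold rel
  fun_prop

lemma hasDerivAt_rel (z : ℂ) (θ : ℝ) :
    HasDerivAt (γ.rel z) (-I * γ.rel z θ + I * γ.speed θ) θ := by
  have h1 : HasDerivAt (fun θ : ℝ => cexp (-(θ * I))) (cexp (-(θ * I)) * (-(1 * I))) θ :=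
    (((Complex.ofRealCLM.hasDerivAt (x := θ)).mul_const I).neg).cexp
  have h2 := h1.mul ((γ.hasDerivAt_pt θ).sub_const z)
  refine h2.congr_deriv ?_
  have : cexp (-(θ * I)) * cexp (θ * I) = 1 := by rw [← Complex.exp_add]; simp
  simp only [rel]
  linear_combination I * γ.speed θ * this

lemma norm_exp_neg_mul_I (θ : ℝ) : ‖cexp (-(θ * I))‖ = 1 := by
  rw [← neg_mul, ← ofReal_neg, Complex.norm_exp_ofReal_mul_I]

lemma rel_sub_rel (z z' : ℂ) (θ : ℝ) :
    γ.rel z θ - γ.rel z' θ = cexp (-(θ * I)) * (z' - z) := by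
  simp only [rel]; ring

lemma re_rel_sub_le (z z' : ℂ) (θ : ℝ) : (γ.rel z θ).re ≤ (γ.rel z' θ).re + ‖z - z'‖ := by
  have h := (Complex.re_le_norm (γ.rel z θ - γ.rel z' θ))
  rw [rel_sub_rel, norm_mul, norm_exp_neg_mul_I, one_mul, norm_sub_rev] at h
  rw [← rel_sub_rel, sub_re] at h
  linarith

lemma exists_forall_re_rel_le (z : ℂ) : ∃ θ₀, ∀ θ, (γ.rel z θ₀).re ≤ (γ.rel z θ).re := by
  have hc : Continuous fun θ => (γ.rel z θ).re := continuous_re.comp (γ.continuous_rel z)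
  obtain ⟨θ₀, -, h⟩ := (isCompact_Icc (a := (0 : ℝ)) (b := 2 * Real.pi)).exists_isMinOn
    ⟨0, by simp [Real.pi_pos.le]⟩ hc.continuousOn
  refine ⟨θ₀, fun θ => ?_⟩
  obtain ⟨y, hy, hy'⟩ := (γ.rel_periodic z).exists_mem_Ico₀ Real.two_pi_pos θ
  rw [hy']
  exact h (Set.Ico_subset_Icc_self hy)

lemma exists_re_rel_eq_depth (z : ℂ) :
    ∃ θ₀, (γ.rel z θ₀).re = γ.depth z ∧ ∀ θ, γ.depth z ≤ (γ.rel z θ).re := by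
  obtain ⟨θ₀, h⟩ := γ.exists_forall_re_rel_le z
  have : (γ.rel z θ₀).re = γ.depth z :=
    le_antisymm (le_ciInf h) (ciInf_le ⟨(γ.rel z θ₀).re, by rintro _ ⟨θ, rfl⟩; exact h θ⟩ θ₀)
  exact ⟨θ₀, this, this ▸ h⟩

lemma depth_le (z : ℂ) (θ : ℝ) : γ.depth z ≤ (γ.rel z θ).re := by
  obtain ⟨_, -, h⟩ := γ.exists_re_rel_eq_depth z
  exact h θ

lemma mem_inner_iff : z ∈ γ.inner ↔ 0 < γ.depth z := by
  obtain ⟨θ₀, h1, h2⟩ := γ.exists_re_rel_eq_depth z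
  exact ⟨fun h => h1 ▸ h θ₀, fun h θ => h.trans_le (h2 θ)⟩

lemma depth_sub_le (z z' : ℂ) : γ.depth z ≤ γ.depth z' + ‖z - z'‖ := by
  obtain ⟨θ₀, h1, -⟩ := γ.exists_re_rel_eq_depth z'
  rw [← h1]
  exact (γ.depth_le z θ₀).trans (γ.re_rel_sub_le z z' θ₀)

lemma continuous_depth : Continuous γ.depth := by
  refine LipschitzWith.continuous (K := 1) (LipschitzWith.of_le_add fun x y => ?_)
  rw [dist_eq_norm]
  exact γ.depth_sub_le x y

lemma isOpen_lt_depth (δ : ℝ) : IsOpen {z | δ < γ.depth z} :=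
  isOpen_lt continuous_const γ.continuous_depth

lemma inner_eq : γ.inner = {z | 0 < γ.depth z} := Set.ext fun _ => γ.mem_inner_iff

lemma isOpen_inner : IsOpen γ.inner := γ.inner_eq ▸ γ.isOpen_lt_depth 0

lemma rel_convex_comb (z z' : ℂ) (a b : ℝ) (hab : a + b = 1) (θ : ℝ) :
    γ.rel (a • z + b • z') θ = a * γ.rel z θ + b * γ.rel z' θ := by
  have : (a : ℂ) + b = 1 := by exact_mod_cast hab
  simp only [rel, real_smul]
  linear_combination -(cexp (-(θ * I)) * γ.pt θ) * this

lemma convex_inner : Convex ℝ γ.inner := by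
  intro x hx y hy a b ha hb hab θ
  rw [rel_convex_comb _ _ _ _ _ hab]
  simp only [add_re, re_ofReal_mul]
  rcases ha.eq_or_lt with rfl | ha
  · have : b = 1 := by linarith
    simpa [this] using hy θ
  · have := mul_pos ha (hx θ)
    have := mul_nonneg hb (hy θ).le
    linarith

/-- At the angle minimizing Re rel, the derivative Im rel vanishes, so z lies on the normal through
that point of the curve. This yields the boundary point close to z needed in the maximum principle.
-/
lemma eq_of_depth (z : ℂ) : ∃ θ₀ : ℝ, z = γ.pt θ₀ - γ.depth z * cexp (θ₀ * I) := by
  obtain ⟨θ₀, h1, h2⟩ := γ.exists_re_rel_eq_depth z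
  have hd : HasDerivAt (fun θ => (γ.rel z θ).re) ((γ.rel z θ₀).im) θ₀ := by
    have := (Complex.reCLM.hasFDerivAt.comp_hasDerivAt θ₀ (γ.hasDerivAt_rel z θ₀))
    refine this.congr_deriv ?_
    simp
  have hmin : IsLocalMin (fun θ => (γ.rel z θ).re) θ₀ :=
    Filter.Eventually.of_forall fun θ => by simpa [h1] using h2 θ
  have him := hmin.hasDerivAt_eq_zero hd
  refine ⟨θ₀, ?_⟩
  have hrel : γ.rel z θ₀ = γ.depth z := Complex.ext (by simp [h1]) (by simp [him])
  have : cexp (θ₀ * I) * cexp (-(θ₀ * I)) = 1 := by rw [← Complex.exp_add]; simp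
  rw [← hrel, rel]
  linear_combination (γ.pt θ₀ - z) * this

lemma exists_norm_pt_le : ∃ R, 0 < R ∧ ∀ θ, ‖γ.pt θ‖ ≤ R := by
  have hc : Continuous fun θ => ‖γ.pt θ‖ := γ.continuous_pt.norm
  obtain ⟨R, hR⟩ := (isCompact_Icc (a := (0 : ℝ)) (b := 2 * Real.pi)).bddAbove_image hc.continuousOn
  refine ⟨max R 1, by positivity, fun θ => ?_⟩
  obtain ⟨y, hy, hy'⟩ := γ.pt_periodic.exists_mem_Ico₀ Real.two_pi_pos θ
  rw [hy']
  exact (hR ⟨y, Set.Ico_subset_Icc_self hy, rfl⟩).trans (le_max_left _ _)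

lemma exists_speed_le : ∃ R, 0 < R ∧ ∀ θ, γ.speed θ ≤ R := by
  obtain ⟨R, hR⟩ := (isCompact_Icc (a := (0 : ℝ)) (b := 2 * Real.pi)).bddAbove_image
    γ.speed_continuous.continuousOn
  refine ⟨max R 1, by positivity, fun θ => ?_⟩
  obtain ⟨y, hy, hy'⟩ := γ.speed_periodic.exists_mem_Ico₀ Real.two_pi_pos θ
  rw [hy']
  exact (hR ⟨y, Set.Ico_subset_Icc_self hy, rfl⟩).trans (le_max_left _ _)

lemma isBounded_inner : Bornology.IsBounded γ.inner := by
  obtain ⟨R, hR, h⟩ := γ.exists_norm_pt_le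
  refine (Metric.isBounded_closedBall (x := (0 : ℂ)) (r := R)).subset fun z hz => ?_
  have h1 := hz z.arg
  have h2 : cexp (-(z.arg * I)) * z = ‖z‖ := by
    have h3 : cexp (-(z.arg * I)) * cexp (z.arg * I) = 1 := by rw [← Complex.exp_add]; simp
    have h4 := Complex.norm_mul_exp_arg_mul_I z
    linear_combination -cexp (-(z.arg * I)) * h4 + ‖z‖ * h3
  have h3 := (Complex.re_le_norm (cexp (-(z.arg * I)) * γ.pt z.arg))
  rw [norm_mul, norm_exp_neg_mul_I, one_mul] at h3
  rw [rel, mul_sub, h2, sub_re, ofReal_re] at h1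
  simp only [Metric.mem_closedBall, dist_zero_right]
  linarith [h z.arg]

/-- A quantitative form of strict convexity. -/
lemma le_re_rel_pt (θ₀ : ℝ) {t : ℝ} (ht : t ∈ Set.Icc 0 (2 * Real.pi)) :
    γ.minSpeed * (1 - Real.cos t) ≤ (γ.rel (γ.pt (θ₀ + t)) θ₀).re := by
  -- D has derivative sin t · (speed - minSpeed) and vanishes at 0 and 2π: it increases up to π and
  -- decreases afterwards, hence is nonnegative.
  set D : ℝ → ℝ := fun t => (γ.rel (γ.pt (θ₀ + t)) θ₀).re - γ.minSpeed * (1 - Real.cos t) with hD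
  have hderiv : ∀ t, HasDerivAt D (Real.sin t * (γ.speed (θ₀ + t) - γ.minSpeed)) t := by
    intro t
    have h1 : HasDerivAt (fun t => γ.rel (γ.pt (θ₀ + t)) θ₀)
        (cexp (-(θ₀ * I)) * -(I * cexp ((θ₀ + t : ℝ) * I) * γ.speed (θ₀ + t))) t :=
      (((γ.hasDerivAt_pt (θ₀ + t)).comp_const_add θ₀ t).const_sub _).const_mul _
    have h2 := (Complex.reCLM.hasFDerivAt.comp_hasDerivAt t h1)
    have h3 := h2.sub ((((Real.hasDerivAt_cos t).const_sub 1)).const_mul γ.minSpeed)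
    refine h3.congr_deriv ?_
    have : cexp (-(θ₀ * I)) * -(I * cexp ((θ₀ + t : ℝ) * I) * γ.speed (θ₀ + t))
        = -(I * cexp (t * I)) * γ.speed (θ₀ + t) := by
      have : cexp (-(θ₀ * I)) * cexp ((θ₀ + t : ℝ) * I) = cexp (t * I) := by
        rw [← Complex.exp_add]; congr 1; push_cast; ring
      linear_combination -(I * γ.speed (θ₀ + t)) * this
    rw [this]
    simp [Complex.exp_ofReal_mul_I_im]
    ring
  have hcont : Continuous D := continuous_iff_continuousAt.2 fun t => (hderiv t).continuousAt
  have h0 : D 0 = 0 := by simp [hD, rel]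
  have h2pi : D (2 * Real.pi) = 0 := by simp [hD, rel, γ.pt_periodic θ₀]
  suffices 0 ≤ D t by simp only [hD] at this; linarith
  rcases le_total t Real.pi with h | h
  · have hm : MonotoneOn D (Set.Icc 0 Real.pi) :=
      monotoneOn_of_hasDerivWithinAt_nonneg (convex_Icc _ _) hcont.continuousOn
        (fun x _ => (hderiv x).hasDerivWithinAt) fun x hx => by
          rw [interior_Icc] at hx
          exact mul_nonneg (Real.sin_nonneg_of_nonneg_of_le_pi hx.1.le hx.2.le)
            (sub_nonneg.2 (γ.minSpeed_le _))
    exact h0 ▸ hm ⟨le_rfl, Real.pi_pos.le⟩ ⟨ht.1, h⟩ ht.1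
  · have hm : AntitoneOn D (Set.Icc Real.pi (2 * Real.pi)) :=
      antitoneOn_of_hasDerivWithinAt_nonpos (convex_Icc _ _) hcont.continuousOn
        (fun x _ => (hderiv x).hasDerivWithinAt) fun x hx => by
          rw [interior_Icc] at hx
          refine mul_nonpos_of_nonpos_of_nonneg ?_ (sub_nonneg.2 (γ.minSpeed_le _))
          have := Real.sin_nonneg_of_nonneg_of_le_pi (x := x - Real.pi) (by linarith [hx.1])
            (by linarith [hx.2])
          rw [Real.sin_sub_pi] at this
          linarith
    exact h2pi ▸ hm ⟨h, ht.2⟩ ⟨by linarith [Real.pi_pos], le_rfl⟩ ht.2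

end ConvexCurve

/-! ### Cauchy integrals and the angle density. -/

namespace ConvexCurve

variable (γ : ConvexCurve) {z : ℂ} {f : ℂ → ℂ} {U : Set ℂ}

/-- The Cauchy integral of a function on the curve. -/
def cauchy (φ : ℝ → ℂ) (z : ℂ) : ℂ :=
  -- With dσ = i e^{iθ} speed dθ and σ - z = e^{iθ} rel, the form dσ / (2πi(σ - z)) becomes speed /
  -- (2π rel) dθ.
  (2 * Real.pi : ℂ)⁻¹ * ∫ θ in (0 : ℝ)..(2 * Real.pi), φ θ * (γ.speed θ / γ.rel z θ)

variable {γ}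

lemma rel_ne_zero (hz : z ∈ γ.inner) (θ : ℝ) : γ.rel z θ ≠ 0 := fun h => by
  have := hz θ
  simp [h] at this

variable (γ)

lemma pt_sub_eq (z : ℂ) (θ : ℝ) : γ.pt θ - z = cexp (θ * I) * γ.rel z θ := by
  have : cexp (θ * I) * cexp (-(θ * I)) = 1 := by rw [← Complex.exp_add]; simp
  rw [rel]
  linear_combination -(γ.pt θ - z) * this

variable {γ}

lemma continuous_kernel (hz : z ∈ γ.inner) : Continuous fun θ => (γ.speed θ / γ.rel z θ : ℂ) :=
  (continuous_ofReal.comp γ.speed_continuous).div (γ.continuous_rel z) (rel_ne_zero hz)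

/-- For z inside, rel stays in the right half-plane, so its logarithm is smooth and periodic, and
the derivative -i + i · speed / rel has integral zero. -/
lemma integral_kernel (hz : z ∈ γ.inner) :
    ∫ θ in (0 : ℝ)..(2 * Real.pi), (γ.speed θ / γ.rel z θ : ℂ) = 2 * Real.pi := by
  have hd : ∀ θ : ℝ, HasDerivAt (fun θ => Complex.log (γ.rel z θ))
      (-I + I * (γ.speed θ / γ.rel z θ)) θ := fun θ => by
    have h := (γ.hasDerivAt_rel z θ).clog_real (Or.inl (hz θ))
    refine h.congr_deriv ?_
    have := rel_ne_zero hz θ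
    field_simp
  have hk := continuous_kernel hz
  have h := integral_eq_sub_of_hasDerivAt (a := (0 : ℝ)) (b := 2 * Real.pi) (fun θ _ => hd θ)
    (Continuous.intervalIntegrable (by fun_prop) _ _)
  have hp := γ.rel_periodic z 0
  rw [zero_add] at hp
  rw [hp, sub_self, intervalIntegral.integral_add (by simp)
    (Continuous.intervalIntegrable (by fun_prop) _ _), intervalIntegral.integral_const,
    intervalIntegral.integral_const_mul] at h
  simp only [sub_zero, real_smul] at h
  push_cast at h
  refine mul_left_cancel₀ I_ne_zero ?_
  linear_combination h

/-- The divided difference of f at z is holomorphic on the convex set U, so it has a primitive and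
integrates to zero along the closed curve. Only the constant f(z) remains, weighted by
`integral_kernel`. -/
lemma cauchy_eq (hU : Convex ℝ U) (hUo : IsOpen U) (hf : DifferentiableOn ℂ f U)
    (hin : γ.inner ⊆ U) (hpt : ∀ θ, γ.pt θ ∈ U) (hz : z ∈ γ.inner) :
    γ.cauchy (fun θ => f (γ.pt θ)) z = f z := by
  have hds : DifferentiableOn ℂ (dslope f z) U :=
    (Complex.differentiableOn_dslope (hUo.mem_nhds (hin hz))).2 hf
  obtain ⟨G, hG⟩ := hU.exists_forall_hasDerivWithinAt hds
  have hGd : ∀ θ, HasDerivAt (fun θ => G (γ.pt θ))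
      (dslope f z (γ.pt θ) * (I * cexp (θ * I) * γ.speed θ)) θ := fun θ =>
    ((hG _ (hpt θ)).hasDerivAt (hUo.mem_nhds (hpt θ))).comp θ (γ.hasDerivAt_pt θ)
  have hcont : Continuous fun θ => dslope f z (γ.pt θ) :=
    hds.continuousOn.comp_continuous γ.continuous_pt hpt
  have hs := γ.speed_continuous
  have h0 := integral_eq_sub_of_hasDerivAt (a := (0 : ℝ)) (b := 2 * Real.pi) (fun θ _ => hGd θ)
    (Continuous.intervalIntegrable (by fun_prop) _ _)
  have hp := γ.pt_periodic 0
  rw [zero_add] at hp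
  rw [hp, sub_self] at h0
  have hk := continuous_kernel hz
  have hfc : Continuous fun θ => f (γ.pt θ) :=
    hf.continuousOn.comp_continuous γ.continuous_pt hpt
  have key : ∀ θ : ℝ, f (γ.pt θ) * (γ.speed θ / γ.rel z θ) =
      f z * (γ.speed θ / γ.rel z θ) +
        -I * (dslope f z (γ.pt θ) * (I * cexp (θ * I) * γ.speed θ)) := by
    intro θ
    have hr := rel_ne_zero hz θ
    have h1 : f (γ.pt θ) = f z + dslope f z (γ.pt θ) * (γ.pt θ - z) := by
      have := sub_smul_dslope f z (γ.pt θ)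
      rw [smul_eq_mul] at this
      linear_combination -this
    rw [h1, pt_sub_eq]
    field_simp
    linear_combination ((dslope f z (γ.pt θ)) * cexp (θ * I) * γ.rel z θ * γ.speed θ) * I_sq
  rw [cauchy, intervalIntegral.integral_congr (fun θ _ => key θ),
    intervalIntegral.integral_add (Continuous.intervalIntegrable (by fun_prop) _ _)
      (Continuous.intervalIntegrable (by fun_prop) _ _),
    intervalIntegral.integral_const_mul, intervalIntegral.integral_const_mul, h0,
    integral_kernel hz]
  have : (Real.pi : ℂ) ≠ 0 := by exact_mod_cast Real.pi_ne_zero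
  field_simp
  ring

lemma hasDerivAt_kernel {φ : ℝ → ℂ} (hz : z ∈ γ.inner) (θ : ℝ) :
    HasDerivAt (fun z => φ θ * (γ.speed θ / γ.rel z θ))
      (φ θ * (γ.speed θ * cexp (-(θ * I)) / (γ.rel z θ) ^ 2)) z := by
  have h1 : HasDerivAt (fun z => γ.rel z θ) (-cexp (-(θ * I))) z := by
    have := ((hasDerivAt_id z).const_sub (γ.pt θ)).const_mul (cexp (-(θ * I)))
    exact this.congr_deriv (by ring)
  have h2 := ((hasDerivAt_const z (γ.speed θ : ℂ)).div h1 (rel_ne_zero hz θ)).const_mul (φ θ)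
  exact h2.congr_deriv (by ring)

lemma depth_le_norm_rel (γ : ConvexCurve) (z : ℂ) (θ : ℝ) : γ.depth z ≤ ‖γ.rel z θ‖ :=
  (γ.depth_le z θ).trans (Complex.re_le_norm _)

lemma differentiableOn_cauchy {φ : ℝ → ℂ} (hφ : Continuous φ) :
    DifferentiableOn ℂ (γ.cauchy φ) γ.inner := by
  intro z₀ hz₀
  refine DifferentiableAt.differentiableWithinAt ?_
  refine DifferentiableAt.const_mul ?_ _
  obtain ⟨W, hW0, hW⟩ := γ.exists_speed_le
  have hd : 0 < γ.depth z₀ := γ.mem_inner_iff.1 hz₀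
  set d := γ.depth z₀ / 2 with hdd
  have hball : ∀ z ∈ Metric.ball z₀ d, d ≤ γ.depth z := by
    intro z hz
    have h1 := γ.depth_sub_le z₀ z
    rw [← dist_eq_norm, dist_comm] at h1
    have := Metric.mem_ball.1 hz
    linarith
  have hinn : ∀ z ∈ Metric.ball z₀ d, z ∈ γ.inner := fun z hz =>
    γ.mem_inner_iff.2 (by linarith [hball z hz])
  have hsp := γ.speed_continuous
  refine (intervalIntegral.hasDerivAt_integral_of_dominated_loc_of_deriv_le
    (F' := fun z θ => φ θ * (γ.speed θ * cexp (-(θ * I)) / (γ.rel z θ) ^ 2))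
    (s := Metric.ball z₀ d) (bound := fun θ => ‖φ θ‖ * (W / d ^ 2))
    (Metric.ball_mem_nhds _ (by linarith)) ?_ ?_ ?_ ?_ ?_ ?_).2.differentiableAt
  · filter_upwards [Metric.ball_mem_nhds z₀ (by linarith : 0 < d)] with z hz
    have hk := continuous_kernel (hinn z hz)
    exact Continuous.aestronglyMeasurable (by fun_prop)
  · have hk := continuous_kernel hz₀
    exact Continuous.intervalIntegrable (by fun_prop) _ _
  · have hk : Continuous fun θ : ℝ => (γ.speed θ * cexp (-(θ * I)) / (γ.rel z₀ θ) ^ 2) :=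
      Continuous.div (by fun_prop) ((γ.continuous_rel z₀).pow 2)
        fun θ => pow_ne_zero _ (rel_ne_zero hz₀ θ)
    exact Continuous.aestronglyMeasurable (by fun_prop)
  · refine Eventually.of_forall fun θ _ z hz => ?_
    rw [norm_mul]
    gcongr
    rw [norm_div, norm_mul, norm_exp_neg_mul_I, mul_one, norm_pow, norm_real,
      Real.norm_of_nonneg (γ.speed_pos θ).le]
    have h1 := (hball z hz).trans (γ.depth_le_norm_rel z θ)
    gcongr
    exact hW θ
  · exact Continuous.intervalIntegrable (by fun_prop) _ _
  · exact Eventually.of_forall fun θ _ z hz => hasDerivAt_kernel (hinn z hz) θ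

/-- The real part of the kernel, the density of the angle under which the curve is seen. -/
def angle (γ : ConvexCurve) (z : ℂ) (θ : ℝ) : ℝ := (γ.speed θ / γ.rel z θ : ℂ).re

lemma angle_nonneg (hz : z ∈ γ.inner) (θ : ℝ) : 0 ≤ γ.angle z θ := by
  rw [angle, Complex.div_re]
  simp only [ofReal_re, ofReal_im, zero_mul, zero_div, add_zero]
  exact div_nonneg (mul_nonneg (γ.speed_pos θ).le (hz θ).le) (normSq_nonneg _)

lemma continuous_angle (hz : z ∈ γ.inner) : Continuous (γ.angle z) :=
  continuous_re.comp (continuous_kernel hz)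

lemma angle_periodic (z : ℂ) : Function.Periodic (γ.angle z) (2 * Real.pi) := fun θ => by
  simp only [angle, γ.speed_periodic θ, γ.rel_periodic z θ]

lemma integral_angle (hz : z ∈ γ.inner) : ∫ θ in (0 : ℝ)..(2 * Real.pi), γ.angle z θ = 2 * Real.pi := by
  have h := congrArg Complex.re (integral_kernel hz)
  have h2 := (Complex.reCLM.intervalIntegral_comp_comm
    ((continuous_kernel hz).intervalIntegrable (μ := volume) 0 (2 * Real.pi)))
  simp only [reCLM_apply] at h2
  simp only [angle]
  rw [h2, h]
  simp

/-- The kernel plus its conjugate is twice its real part, so the sum is a double-layer potential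
with a positive density. -/
lemma cauchy_add_conj {φ : ℝ → ℂ} (hφ : Continuous φ) (hz : z ∈ γ.inner) :
    γ.cauchy φ z + (starRingEnd ℂ) (γ.cauchy (fun θ => (starRingEnd ℂ) (φ θ)) z) =
      (Real.pi : ℂ)⁻¹ * ∫ θ in (0 : ℝ)..(2 * Real.pi), φ θ * γ.angle z θ := by
  have hk := continuous_kernel hz
  have hk' : Continuous fun θ => (starRingEnd ℂ) (γ.speed θ / γ.rel z θ : ℂ) :=
    Complex.continuous_conj.comp hk
  have key : ∀ θ : ℝ, φ θ * (γ.angle z θ : ℂ) = 2⁻¹ * (φ θ * (γ.speed θ / γ.rel z θ) +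
      φ θ * (starRingEnd ℂ) (γ.speed θ / γ.rel z θ : ℂ)) := fun θ => by
    rw [← mul_add, Complex.add_conj]
    simp only [angle]
    push_cast
    ring
  simp only [key]
  rw [intervalIntegral.integral_const_mul,
    intervalIntegral.integral_add (Continuous.intervalIntegrable (by fun_prop) _ _)
      (Continuous.intervalIntegrable (by fun_prop) _ _), cauchy, cauchy, map_mul,
      ← intervalIntegral_conj]
  simp only [map_mul, map_inv₀, map_ofNat, conj_ofReal, conj_conj]
  ring


lemma norm_pt_sub_le {W : ℝ} (hW : ∀ θ, γ.speed θ ≤ W) (a b : ℝ) :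
    ‖γ.pt a - γ.pt b‖ ≤ W * |a - b| := by
  refine Convex.norm_image_sub_le_of_norm_hasDerivWithin_le (s := Set.univ)
    (fun θ _ => (γ.hasDerivAt_pt θ).hasDerivWithinAt) (fun θ _ => ?_) convex_univ
    (Set.mem_univ _) (Set.mem_univ _)
  rw [norm_mul, norm_mul, norm_I, norm_exp_ofReal_mul_I, norm_real, one_mul, one_mul,
    Real.norm_of_nonneg (γ.speed_pos θ).le]
  exact hW θ

lemma re_rel_pt_pos (γ : ConvexCurve) {r : ℝ} (hr : 0 < r) (θ₀ : ℝ) {t : ℝ}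
    (ht : t ∈ Set.Icc r (2 * Real.pi - r)) :
    γ.minSpeed * (1 - Real.cos r) ≤ (γ.rel (γ.pt (θ₀ + t)) θ₀).re := by
  refine le_trans ?_ (γ.le_re_rel_pt θ₀ ⟨hr.le.trans ht.1, by linarith [ht.2]⟩)
  have := γ.minSpeed_pos
  gcongr
  rcases le_total t Real.pi with h | h
  · exact Real.cos_le_cos_of_nonneg_of_le_pi hr.le h ht.1
  · rw [← Real.cos_two_pi_sub t]
    exact Real.cos_le_cos_of_nonneg_of_le_pi hr.le (by linarith) (by linarith [ht.2])

/-- Away from a point of the curve, the curve is seen from this point under an angle at most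
`π`. -/
lemma integral_angle_pt_le (γ : ConvexCurve) {r : ℝ} (hr : 0 < r) (hrpi : r < Real.pi) (θ₀ : ℝ) :
    IntervalIntegrable (fun t => γ.angle (γ.pt θ₀) (θ₀ + t)) volume r (2 * Real.pi - r) ∧
    ∫ t in r..(2 * Real.pi - r), γ.angle (γ.pt θ₀) (θ₀ + t) ≤ Real.pi := by
  have hle : r ≤ 2 * Real.pi - r := by linarith
  have hcos : Real.cos r < 1 := by
    have := Real.cos_lt_cos_of_nonneg_of_le_pi le_rfl hrpi.le hr
    rwa [Real.cos_zero] at this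
  have hc : 0 < γ.minSpeed * (1 - Real.cos r) := mul_pos γ.minSpeed_pos (by linarith)
  have hpos : ∀ t ∈ Set.uIcc r (2 * Real.pi - r), 0 < (γ.rel (γ.pt (θ₀ + t)) θ₀).re := by
    intro t ht
    rw [Set.uIcc_of_le hle] at ht
    exact hc.trans_le (γ.re_rel_pt_pos hr θ₀ ht)
  have hne : ∀ t ∈ Set.uIcc r (2 * Real.pi - r), γ.rel (γ.pt θ₀) (θ₀ + t) ≠ 0 := by
    intro t ht h
    have h1 := γ.pt_sub_eq (γ.pt θ₀) (θ₀ + t)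
    rw [h, mul_zero, sub_eq_zero] at h1
    have := hpos t ht
    simp [rel, h1] at this
  -- Up to a constant rotation the argument of the logarithm is γ(θ₀) - γ(θ₀ + t), so its imaginary
  -- part follows the direction of the moving point seen from γ(θ₀).
  have hd : ∀ t ∈ Set.uIcc r (2 * Real.pi - r),
      HasDerivAt (fun t => Complex.log (γ.rel (γ.pt (θ₀ + t)) θ₀))
        (I * (γ.speed (θ₀ + t) / γ.rel (γ.pt θ₀) (θ₀ + t))) t := by
    intro t ht
    have h1 : HasDerivAt (fun t => γ.rel (γ.pt (θ₀ + t)) θ₀)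
        (cexp (-(θ₀ * I)) * -(I * cexp ((θ₀ + t : ℝ) * I) * γ.speed (θ₀ + t))) t :=
      (((γ.hasDerivAt_pt (θ₀ + t)).comp_const_add θ₀ t).const_sub _).const_mul _
    refine (h1.clog_real (Or.inl (hpos t ht))).congr_deriv ?_
    have h2 : γ.rel (γ.pt (θ₀ + t)) θ₀ =
        -(cexp (-(θ₀ * I)) * (cexp ((θ₀ + t : ℝ) * I) * γ.rel (γ.pt θ₀) (θ₀ + t))) := by
      rw [← pt_sub_eq, rel]; ring
    have h3 := hne t ht
    rw [h2]
    have e1 := Complex.exp_ne_zero (-(θ₀ * I))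
    have e2 := Complex.exp_ne_zero ((θ₀ + t : ℝ) * I)
    field_simp
  have hcon : ContinuousOn (fun t => (γ.speed (θ₀ + t) / γ.rel (γ.pt θ₀) (θ₀ + t) : ℂ))
      (Set.uIcc r (2 * Real.pi - r)) := by
    have h1 := γ.speed_continuous
    have h2 := γ.continuous_rel (γ.pt θ₀)
    exact ContinuousOn.div (by fun_prop) (by fun_prop) hne
  have hii := hcon.intervalIntegrable (μ := volume)
  have h := integral_eq_sub_of_hasDerivAt hd (hii.const_mul I)
  refine ⟨(continuous_re.comp_continuousOn hcon).intervalIntegrable, ?_⟩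
  have h2 := Complex.reCLM.intervalIntegral_comp_comm hii
  simp only [reCLM_apply] at h2
  simp only [angle]
  rw [h2]
  rw [intervalIntegral.integral_const_mul] at h
  have him := congrArg Complex.im h
  simp only [mul_im, I_re, I_im, zero_mul, one_mul, zero_add, sub_im, log_im] at him
  rw [him]
  -- Both endpoint arguments lie in (-π/2, π/2), since the curve stays on one side of its tangent at
  -- θ₀; their difference is at most π.
  have a1 := (abs_lt.1 (Complex.abs_arg_lt_pi_div_two_iff.2
    (Or.inl (hpos _ Set.left_mem_uIcc))))
  have a2 := (abs_lt.1 (Complex.abs_arg_lt_pi_div_two_iff.2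
    (Or.inl (hpos _ Set.right_mem_uIcc))))
  linarith [a1.1, a2.2]

end ConvexCurve

/-! ### The Cauchy transform of conjugate boundary values. -/

namespace ConvexCurve

variable {γ : ConvexCurve} {z : ℂ} {f : ℂ → ℂ} {U : Set ℂ}

lemma norm_rel (z : ℂ) (θ : ℝ) : ‖γ.rel z θ‖ = ‖γ.pt θ - z‖ := by
  rw [rel, norm_mul, norm_exp_neg_mul_I, one_mul]

/-- Outside the window of half-width r, the curve is at distance at least c from γ(θ₀), hence at
least c/2 from z. There the kernels of z and γ(θ₀) differ by at most Wδ / (c²/2), and from γ(θ₀) the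
angle is at most π. -/
lemma integral_angle_far_le {r c W δ : ℝ} (hr : 0 < r) (hrpi : r < Real.pi)
    (hc : c = γ.minSpeed * (1 - Real.cos r)) (hc0 : 0 < c) (hW : ∀ θ, γ.speed θ ≤ W)
    (hδ : δ ≤ c / 2) (θ₀ : ℝ) (hz : z ∈ γ.inner) (hzθ : ‖γ.pt θ₀ - z‖ ≤ δ) :
    ∫ t in r..(2 * Real.pi - r), γ.angle z (θ₀ + t) ≤
      Real.pi + 2 * Real.pi * (W * δ / (c / 2 * c)) := by
  have hle : r ≤ 2 * Real.pi - r := by linarith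
  have hδ0 : 0 ≤ δ := (norm_nonneg _).trans hzθ
  have hW0 : 0 ≤ W := (γ.speed_pos 0).le.trans (hW 0)
  obtain ⟨hi, hle2⟩ := γ.integral_angle_pt_le hr hrpi θ₀
  have hcon := continuous_angle hz
  have hpt : ∀ t ∈ Set.Icc r (2 * Real.pi - r), γ.angle z (θ₀ + t) ≤
      γ.angle (γ.pt θ₀) (θ₀ + t) + W * δ / (c / 2 * c) := by
    intro t ht
    have h1 : c ≤ ‖γ.rel (γ.pt θ₀) (θ₀ + t)‖ := by
      rw [norm_rel, norm_sub_rev, ← norm_rel, hc]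
      exact (γ.re_rel_pt_pos hr θ₀ ht).trans (Complex.re_le_norm _)
    have hsub : ‖γ.rel (γ.pt θ₀) (θ₀ + t) - γ.rel z (θ₀ + t)‖ ≤ δ := by
      rw [rel_sub_rel, norm_mul, norm_exp_neg_mul_I, one_mul, norm_sub_rev]
      exact hzθ
    have h2 : c / 2 ≤ ‖γ.rel z (θ₀ + t)‖ := by
      have := norm_sub_norm_le (γ.rel (γ.pt θ₀) (θ₀ + t)) (γ.rel z (θ₀ + t))
      linarith
    have n1 : γ.rel (γ.pt θ₀) (θ₀ + t) ≠ 0 := norm_pos_iff.1 (hc0.trans_le h1)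
    have n2 : γ.rel z (θ₀ + t) ≠ 0 := rel_ne_zero hz _
    have h3 : (γ.speed (θ₀ + t) / γ.rel z (θ₀ + t) -
        γ.speed (θ₀ + t) / γ.rel (γ.pt θ₀) (θ₀ + t) : ℂ) =
        γ.speed (θ₀ + t) * (γ.rel (γ.pt θ₀) (θ₀ + t) - γ.rel z (θ₀ + t)) /
          (γ.rel z (θ₀ + t) * γ.rel (γ.pt θ₀) (θ₀ + t)) := by
      field_simp
    have h4 := Complex.re_le_norm (γ.speed (θ₀ + t) / γ.rel z (θ₀ + t) -
        γ.speed (θ₀ + t) / γ.rel (γ.pt θ₀) (θ₀ + t) : ℂ)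
    have h5 : ‖(γ.speed (θ₀ + t) / γ.rel z (θ₀ + t) -
        γ.speed (θ₀ + t) / γ.rel (γ.pt θ₀) (θ₀ + t) : ℂ)‖ ≤ W * δ / (c / 2 * c) := by
      rw [h3, norm_div, norm_mul, norm_mul, norm_real, Real.norm_of_nonneg (γ.speed_pos _).le]
      gcongr
      exact hW _
    rw [sub_re] at h4
    simp only [angle]
    linarith
  have hmono := intervalIntegral.integral_mono_on (μ := volume) hle
    (Continuous.intervalIntegrable (by fun_prop) _ _) (hi.add intervalIntegrable_const) hpt
  refine hmono.trans ?_
  rw [intervalIntegral.integral_add hi intervalIntegrable_const, intervalIntegral.integral_const,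
    smul_eq_mul]
  have : (2 * Real.pi - r - r) * (W * δ / (c / 2 * c)) ≤
      2 * Real.pi * (W * δ / (c / 2 * c)) := by
    gcongr
    linarith
  linarith

/-- The conjugate of the transform at z is π⁻¹ ∫ f · angle - f(z). Near γ(θ₀) the total angle 2π
splits into a mass b on a short arc, where f is nearly f(z), and a mass a ≤ π + o(1) elsewhere. So π
times the transform has modulus at most |b - π| + a up to a small error, and this is close to π or
below. -/
lemma exists_norm_cauchy_conj_le (hU : Convex ℝ U) (hUo : IsOpen U) (hf : DifferentiableOn ℂ f U)
    (hin : γ.inner ⊆ U) (hpt : ∀ θ, γ.pt θ ∈ U) (hfb : ∀ z ∈ U, ‖f z‖ ≤ 1) {η : ℝ} (hη : 0 < η) :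
    ∃ δ₀ > 0, ∀ θ₀, ∀ z ∈ γ.inner, ‖γ.pt θ₀ - z‖ ≤ δ₀ →
      ‖γ.cauchy (fun θ => (starRingEnd ℂ) (f (γ.pt θ))) z‖ ≤ 1 + η := by
  obtain ⟨W, hW0, hW⟩ := γ.exists_speed_le
  have hcomp : IsCompact (γ.pt '' Set.Icc 0 (2 * Real.pi)) :=
    isCompact_Icc.image γ.continuous_pt
  have hptK : ∀ θ, γ.pt θ ∈ γ.pt '' Set.Icc 0 (2 * Real.pi) := fun θ => by
    obtain ⟨y, hy, hy'⟩ := γ.pt_periodic.exists_mem_Ico₀ Real.two_pi_pos θ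
    exact ⟨y, Set.Ico_subset_Icc_self hy, hy'.symm⟩
  have hunif := hcomp.uniformContinuousAt_of_continuousAt f (fun a ha => by
    obtain ⟨θ, -, rfl⟩ := ha
    exact (hf.differentiableAt (hUo.mem_nhds (hpt θ))).continuousAt)
    (Metric.dist_mem_uniformity (by positivity : 0 < η / 4))
  obtain ⟨d, hd0, hd⟩ := Metric.mem_uniformity_dist.1 hunif
  -- Points of the near arc are within d/4 of γ(θ₀), and δ₀ ≤ d/4, so they are closer than d to z
  -- and f varies there by less than η/4. The bound 1 ensures r < π.
  set r := min 1 (d / (4 * W)) with hrdef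
  have hr0 : 0 < r := by positivity
  have hrpi : r < Real.pi := by
    have := min_le_left (1 : ℝ) (d / (4 * W)); linarith [Real.pi_gt_three]
  have hWr : W * r ≤ d / 4 := by
    have h1 : r ≤ d / (4 * W) := min_le_right _ _
    calc W * r ≤ W * (d / (4 * W)) := by gcongr
      _ = d / 4 := by field_simp
  have hcos : Real.cos r < 1 := by
    have := Real.cos_lt_cos_of_nonneg_of_le_pi le_rfl hrpi.le hr0
    rwa [Real.cos_zero] at this
  set c := γ.minSpeed * (1 - Real.cos r) with hc
  have hc0 : 0 < c := mul_pos γ.minSpeed_pos (by linarith)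
  -- The last entry keeps the excess of the far mass over π below πη/4; counted twice, and added to
  -- the near oscillation 2π · η/4, it uses up exactly πη.
  set δ₀ := min (min (c / 2) (d / 4)) (η * (c / 2 * c) / (8 * W)) with hδ
  have hδ0 : 0 < δ₀ := by positivity
  refine ⟨δ₀, hδ0, fun θ₀ z hz hzθ => ?_⟩
  have hδc : δ₀ ≤ c / 2 := (min_le_left _ _).trans (min_le_left _ _)
  have hδd : δ₀ ≤ d / 4 := (min_le_left _ _).trans (min_le_right _ _)
  have hδη : W * δ₀ / (c / 2 * c) ≤ η / 8 := by
    have h1 : δ₀ ≤ η * (c / 2 * c) / (8 * W) := min_le_right _ _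
    calc W * δ₀ / (c / 2 * c) ≤ W * (η * (c / 2 * c) / (8 * W)) / (c / 2 * c) := by gcongr
      _ = η / 8 := by field_simp
  have hfar := integral_angle_far_le hr0 hrpi hc hc0 hW hδc θ₀ hz hzθ
  have hfc : Continuous fun θ => f (γ.pt θ) :=
    hf.continuousOn.comp_continuous γ.continuous_pt hpt
  have hac := continuous_angle hz
  have hfar' : ∫ t in r..(2 * Real.pi - r), γ.angle z (θ₀ + t) ≤ Real.pi + Real.pi * η / 4 := by
    have : 2 * Real.pi * (W * δ₀ / (c / 2 * c)) ≤ 2 * Real.pi * (η / 8) := by gcongr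
    linarith
  -- Starting the period at θ₀ - r makes the near arc a single interval.
  have hshift : ∀ (g : ℝ → ℂ), Function.Periodic g (2 * Real.pi) →
      ∫ θ in (0 : ℝ)..(2 * Real.pi), g θ = ∫ t in (-r)..(2 * Real.pi - r), g (θ₀ + t) := by
    intro g hg
    rw [intervalIntegral.integral_comp_add_left]
    have := hg.intervalIntegral_add_eq 0 (θ₀ + -r)
    rw [zero_add] at this
    rw [this]
    congr 1
    ring
  have hshiftR : ∀ (g : ℝ → ℝ), Function.Periodic g (2 * Real.pi) →
      ∫ θ in (0 : ℝ)..(2 * Real.pi), g θ = ∫ t in (-r)..(2 * Real.pi - r), g (θ₀ + t) := by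
    intro g hg
    rw [intervalIntegral.integral_comp_add_left]
    have := hg.intervalIntegral_add_eq 0 (θ₀ + -r)
    rw [zero_add] at this
    rw [this]
    congr 1
    ring
  have htot := integral_angle hz
  rw [hshiftR _ (angle_periodic z)] at htot
  have hiR : ∀ a b, IntervalIntegrable (fun t => γ.angle z (θ₀ + t)) volume a b := fun a b =>
    Continuous.intervalIntegrable (by fun_prop) _ _
  rw [← intervalIntegral.integral_add_adjacent_intervals (hiR (-r) r) (hiR r _)] at htot
  set a := ∫ t in r..(2 * Real.pi - r), γ.angle z (θ₀ + t) with ha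
  set b := ∫ t in (-r)..r, γ.angle z (θ₀ + t) with hb
  have ha0 : 0 ≤ a := intervalIntegral.integral_nonneg (by linarith) fun t _ => angle_nonneg hz _
  have hb0 : 0 ≤ b := intervalIntegral.integral_nonneg (by linarith) fun t _ => angle_nonneg hz _
  have hsum := cauchy_add_conj hfc hz
  rw [cauchy_eq hU hUo hf hin hpt hz, hshift _ (fun θ => by
    simp only [γ.pt_periodic θ, angle_periodic z θ])] at hsum
  have hiC : ∀ a b, IntervalIntegrable (fun t => f (γ.pt (θ₀ + t)) * (γ.angle z (θ₀ + t) : ℂ))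
      volume a b := fun a b => by
    refine Continuous.intervalIntegrable ?_ _ _
    exact (hfc.comp (continuous_const.add continuous_id)).mul
      (continuous_ofReal.comp (hac.comp (continuous_const.add continuous_id)))
  have hiR' : ∀ a b, IntervalIntegrable (fun t => f z * (γ.angle z (θ₀ + t) : ℂ)) volume a b :=
    fun a b => Continuous.intervalIntegrable (by fun_prop) _ _
  rw [← intervalIntegral.integral_add_adjacent_intervals (hiC (-r) r) (hiC r _)] at hsum
  have hfarn : ‖∫ t in r..(2 * Real.pi - r), f (γ.pt (θ₀ + t)) * (γ.angle z (θ₀ + t) : ℂ)‖ ≤ a := by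
    refine intervalIntegral.norm_integral_le_of_norm_le (by linarith)
      (Eventually.of_forall fun t _ => ?_) (hiR _ _)
    rw [norm_mul, norm_real, Real.norm_of_nonneg (angle_nonneg hz _)]
    exact mul_le_of_le_one_left (angle_nonneg hz _) (hfb _ (hpt _))
  have hnear : ‖(∫ t in (-r)..r, f (γ.pt (θ₀ + t)) * (γ.angle z (θ₀ + t) : ℂ)) - f z * b‖ ≤
      η / 4 * b := by
    rw [hb, ← intervalIntegral.integral_ofReal, ← intervalIntegral.integral_const_mul,
      ← intervalIntegral.integral_sub (hiC _ _) (hiR' _ _),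
      ← intervalIntegral.integral_const_mul]
    refine intervalIntegral.norm_integral_le_of_norm_le (by linarith)
      (Eventually.of_forall fun t ht => ?_) ((hiR _ _).const_mul _)
    rw [← sub_mul, norm_mul, norm_real, Real.norm_of_nonneg (angle_nonneg hz _)]
    have hdist : dist (γ.pt (θ₀ + t)) z < d := by
      rw [dist_eq_norm]
      have h1 := norm_pt_sub_le hW (θ₀ + t) θ₀
      have h2 : |θ₀ + t - θ₀| ≤ r := by
        rw [add_sub_cancel_left, abs_le]; exact ⟨ht.1.le, ht.2⟩
      have h3 : W * |θ₀ + t - θ₀| ≤ W * r := by gcongr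
      have h4 := norm_add_le (γ.pt (θ₀ + t) - γ.pt θ₀) (γ.pt θ₀ - z)
      rw [sub_add_sub_cancel] at h4
      linarith
    have := hd hdist (hptK _)
    simp only [Set.mem_ofPred_eq, dist_eq_norm] at this
    exact mul_le_mul_of_nonneg_right this.le (angle_nonneg hz _)
  set IJ := ∫ t in (-r)..r, f (γ.pt (θ₀ + t)) * (γ.angle z (θ₀ + t) : ℂ)
  set IF := ∫ t in r..(2 * Real.pi - r), f (γ.pt (θ₀ + t)) * (γ.angle z (θ₀ + t) : ℂ)
  set g := γ.cauchy (fun θ => (starRingEnd ℂ) (f (γ.pt θ))) z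
  have hpi : (Real.pi : ℂ) ≠ 0 := by exact_mod_cast Real.pi_ne_zero
  have hg : (Real.pi : ℂ) * (starRingEnd ℂ) g =
      (IJ - f z * b) + f z * ((b - Real.pi : ℝ) : ℂ) + IF := by
    have : (starRingEnd ℂ) g = (Real.pi : ℂ)⁻¹ * (IJ + IF) - f z := by linear_combination hsum
    rw [this]
    push_cast
    field_simp
    ring
  have hnorm : Real.pi * ‖g‖ ≤ η / 4 * b + |b - Real.pi| + a := by
    have h1 : ‖(Real.pi : ℂ) * (starRingEnd ℂ) g‖ = Real.pi * ‖g‖ := by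
      rw [norm_mul, norm_real, Real.norm_of_nonneg Real.pi_pos.le, RCLike.norm_conj]
    rw [← h1, hg]
    refine (norm_add₃_le).trans ?_
    have h2 : ‖f z * ((b - Real.pi : ℝ) : ℂ)‖ ≤ |b - Real.pi| := by
      rw [norm_mul, norm_real, Real.norm_eq_abs]
      exact mul_le_of_le_one_left (abs_nonneg _) (hfb _ (hin hz))
    linarith
  have hbb : η / 4 * b ≤ η / 4 * (2 * Real.pi) := by
    gcongr; linarith
  -- Since b - π = π - a, the sum is π when a ≤ π and 2a - π otherwise: this is where the excess
  -- doubles.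
  have habs : |b - Real.pi| + a ≤ Real.pi + Real.pi * η / 2 := by
    have : b - Real.pi = Real.pi - a := by linarith
    rw [this]
    rcases abs_cases (Real.pi - a) with ⟨h, -⟩ | ⟨h, -⟩ <;> rw [h]
    · have : 0 ≤ Real.pi * η / 2 := by positivity
      linarith
    · linarith
  have : Real.pi * ‖g‖ ≤ Real.pi * (1 + η) := by linarith
  exact le_of_mul_le_mul_left this Real.pi_pos

/-- The Cauchy integral of the conjugate of a holomorphic function is bounded by the bound of this
function. -/
theorem norm_cauchy_conj_le (hU : Convex ℝ U) (hUo : IsOpen U) (hf : DifferentiableOn ℂ f U)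
    (hin : γ.inner ⊆ U) (hpt : ∀ θ, γ.pt θ ∈ U) (hfb : ∀ z ∈ U, ‖f z‖ ≤ 1) (hz : z ∈ γ.inner) :
    ‖γ.cauchy (fun θ => (starRingEnd ℂ) (f (γ.pt θ))) z‖ ≤ 1 := by
  refine le_of_forall_pos_le_add fun η hη => ?_
  obtain ⟨δ₀, hδ₀, h⟩ := exists_norm_cauchy_conj_le hU hUo hf hin hpt hfb hη
  have hd := γ.mem_inner_iff.1 hz
  set δ := min δ₀ (γ.depth z / 2) with hδ
  have hδ0 : 0 < δ := by positivity
  have hsub : closure {z | δ < γ.depth z} ⊆ {z | δ ≤ γ.depth z} :=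
    closure_minimal (fun x hx => show δ ≤ γ.depth x from le_of_lt hx) (isClosed_le continuous_const γ.continuous_depth)
  have hinn : {z | δ ≤ γ.depth z} ⊆ γ.inner := fun x hx => γ.mem_inner_iff.2 (hδ0.trans_le hx)
  have hfc : Continuous fun θ => (starRingEnd ℂ) (f (γ.pt θ)) :=
    Complex.continuous_conj.comp (hf.continuousOn.comp_continuous γ.continuous_pt hpt)
  have hdiff := differentiableOn_cauchy (γ := γ) hfc
  -- A frontier point of this domain has depth δ, so along a normal it is at distance δ ≤ δ₀ from
  -- the curve, where the bound 1 + η is known.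
  refine Complex.norm_le_of_forall_mem_frontier_norm_le (U := {z | δ < γ.depth z})
    (γ.isBounded_inner.subset fun x hx => hinn (show δ ≤ γ.depth x from le_of_lt hx))
    (hdiff.mono (hsub.trans hinn)).diffContOnCl ?_ (subset_closure ?_)
  · intro x hx
    have hx' : γ.depth x = δ := by
      have h1 : x ∈ {z | δ ≤ γ.depth z} := hsub hx.1
      have h2 : x ∉ {z | δ < γ.depth z} := by
        have := hx.2
        rwa [(γ.isOpen_lt_depth δ).interior_eq] at this
      exact le_antisymm (not_lt.1 h2) h1
    obtain ⟨θ₀, hθ₀⟩ := γ.eq_of_depth x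
    refine h θ₀ x (hinn hx'.ge) ?_
    have : γ.pt θ₀ - x = γ.depth x * cexp (θ₀ * I) := by linear_combination -hθ₀
    rw [this, norm_mul, norm_exp_ofReal_mul_I, mul_one, hx', norm_real,
      Real.norm_of_nonneg hδ0.le]
    exact min_le_left _ _
  · have : δ ≤ γ.depth z / 2 := min_le_right _ _
    simp only [Set.mem_ofPred_eq]
    linarith

end ConvexCurve

/-! ### The Crouzeix–Palencia bound for diagonalizable operators. -/

variable {V : Type*} [NormedAddCommGroup V] [InnerProductSpace ℂ V]

/-- A diagonalization of a bounded operator with finitely many eigenvalues by (oblique)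
projections. -/
structure SpectralResolution (T : V →L[ℂ] V) where
  /-- the eigenvalues -/
  eigs : Finset ℂ
  /-- the projections -/
  proj : ℂ → V →L[ℂ] V
  sum_proj : ∑ μ ∈ eigs, proj μ = 1
  proj_mul_self : ∀ μ ∈ eigs, proj μ * proj μ = proj μ
  proj_mul_of_ne : ∀ μ ∈ eigs, ∀ ν ∈ eigs, μ ≠ ν → proj μ * proj ν = 0
  mul_proj : ∀ μ ∈ eigs, T * proj μ = μ • proj μ

namespace SpectralResolution

variable {T : V →L[ℂ] V} (R : SpectralResolution T)

/-- The functional calculus of a diagonalized operator. -/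
def eval (f : ℂ → ℂ) : V →L[ℂ] V := ∑ μ ∈ R.eigs, f μ • R.proj μ

lemma eval_mul (f g : ℂ → ℂ) : R.eval f * R.eval g = R.eval (fun z => f z * g z) := by
  simp only [eval, Finset.sum_mul_sum]
  refine Finset.sum_congr rfl fun μ hμ => ?_
  rw [Finset.sum_eq_single_of_mem μ hμ]
  · rw [smul_mul_smul_comm, R.proj_mul_self μ hμ]
  · intro ν hν hne
    rw [smul_mul_smul_comm, R.proj_mul_of_ne μ hμ ν hν hne.symm, smul_zero]

lemma eval_one : R.eval (fun _ => 1) = 1 := by simp [eval, R.sum_proj]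

lemma eval_id : R.eval (fun z => z) = T := by
  have : T * ∑ μ ∈ R.eigs, R.proj μ = T := by rw [R.sum_proj, mul_one]
  refine Eq.trans ?_ this
  rw [Finset.mul_sum, eval]
  exact Finset.sum_congr rfl fun μ hμ => (R.mul_proj μ hμ).symm

lemma eval_add (f g : ℂ → ℂ) : R.eval (fun z => f z + g z) = R.eval f + R.eval g := by
  simp only [eval, add_smul, Finset.sum_add_distrib]

lemma eval_const_mul (c : ℂ) (f : ℂ → ℂ) : R.eval (fun z => c * f z) = c • R.eval f := by
  simp only [eval, mul_smul, Finset.smul_sum]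

lemma eval_congr {f g : ℂ → ℂ} (h : ∀ μ ∈ R.eigs, f μ = g μ) : R.eval f = R.eval g :=
  Finset.sum_congr rfl fun μ hμ => by rw [h μ hμ]

lemma eval_polynomial (p : Polynomial ℂ) : R.eval (fun z => p.eval z) = Polynomial.aeval T p := by
  induction p using Polynomial.induction_on' with
  | add p q hp hq => simp only [Polynomial.eval_add, eval_add, hp, hq, map_add]
  | monomial n a =>
    have hpow : R.eval (fun z => z ^ n) = T ^ n := by
      induction n with
      | zero => simp [eval_one]
      | succ n ih => simp only [pow_succ, ← eval_mul, ih, eval_id]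
    simp only [Polynomial.eval_monomial, eval_const_mul, hpow, Polynomial.aeval_monomial,
      Algebra.smul_def]

lemma inner_eval (f : ℂ → ℂ) (x y : V) :
    inner ℂ y (R.eval f x) = ∑ μ ∈ R.eigs, f μ * inner ℂ y (R.proj μ x) := by
  simp only [eval, _root_.sum_apply, inner_sum, _root_.smul_apply,
    inner_smul_right]

lemma norm_eval_le_sum {f : ℂ → ℂ} (hf : ∀ μ ∈ R.eigs, ‖f μ‖ ≤ 1) :
    ‖R.eval f‖ ≤ ∑ μ ∈ R.eigs, ‖R.proj μ‖ := by
  refine (norm_sum_le _ _).trans (Finset.sum_le_sum fun μ hμ => ?_)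
  rw [norm_smul]
  exact mul_le_of_le_one_left (norm_nonneg _) (hf μ hμ)

variable (γ : ConvexCurve)

/-- The resolvent of the operator at a point of the curve, in the frame of the outer normal. -/
def resolventAt (θ : ℝ) : V →L[ℂ] V := R.eval fun z => (γ.rel z θ)⁻¹

variable {γ} (hR : ∀ μ ∈ R.eigs, μ ∈ γ.inner)
  (hT : ∀ (θ : ℝ) (x : V), 0 ≤ (inner ℂ x (cexp (-(θ * I)) • (γ.pt θ • x - T x))).re)

include hR in
lemma rel_resolventAt (θ : ℝ) (x : V) :
    cexp (-(θ * I)) • (γ.pt θ • R.resolventAt γ θ x - T (R.resolventAt γ θ x)) = x := by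
  have h1 : R.eval (fun z => γ.rel z θ) * R.resolventAt γ θ = 1 := by
    rw [resolventAt, eval_mul, ← R.eval_one]
    exact R.eval_congr fun μ hμ => mul_inv_cancel₀ (ConvexCurve.rel_ne_zero (hR μ hμ) θ)
  have h2 : R.eval (fun z => γ.rel z θ) = cexp (-(θ * I)) • (γ.pt θ • 1 - T) := by
    have : (fun z => γ.rel z θ) =
        fun z => cexp (-(θ * I)) * γ.pt θ * 1 + -cexp (-(θ * I)) * z := by
      ext z; simp only [ConvexCurve.rel]; ring
    rw [this, eval_add, eval_const_mul, eval_const_mul, eval_one, eval_id, smul_sub, smul_smul,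
      neg_smul, sub_eq_add_neg]
  have h3 := congrArg (fun L : V →L[ℂ] V => L x) h1
  rw [h2] at h3
  simpa using h3

include hR hT in
lemma re_inner_resolventAt_nonneg (θ : ℝ) (x : V) :
    0 ≤ (inner ℂ x (R.resolventAt γ θ x)).re := by
  have := hT θ (R.resolventAt γ θ x)
  rw [R.rel_resolventAt hR, ← inner_conj_symm, conj_re] at this
  exact this

-- This is the Cauchy–Schwarz inequality, in additive form, for the positive form N + N* with N the
-- rotated resolvent: expand it at x - cy, with c unimodular chosen to align the cross terms.
include hR hT in
lemma norm_inner_resolventAt_le (θ : ℝ) (x y : V) :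
    ‖inner ℂ y (R.resolventAt γ θ x) + inner ℂ (R.resolventAt γ θ y) x‖ ≤
      (inner ℂ x (R.resolventAt γ θ x)).re + (inner ℂ y (R.resolventAt γ θ y)).re := by
  set N := R.resolventAt γ θ
  set b := inner ℂ y (N x) + inner ℂ (N y) x with hb
  obtain ⟨c, hc1, hc⟩ : ∃ c : ℂ, ‖c‖ = 1 ∧ (starRingEnd ℂ) c * b = ‖b‖ := by
    refine ⟨cexp (b.arg * I), norm_exp_ofReal_mul_I _, ?_⟩
    have h1 := Complex.norm_mul_exp_arg_mul_I b
    have h2 : (starRingEnd ℂ) (cexp (b.arg * I)) * cexp (b.arg * I) = 1 := by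
      rw [mul_comm, Complex.mul_conj, normSq_eq_norm_sq, norm_exp_ofReal_mul_I]; simp
    linear_combination -(starRingEnd ℂ) (cexp (b.arg * I)) * h1 + ‖b‖ * h2
  have hpos := R.re_inner_resolventAt_nonneg hR hT θ (x - c • y)
  have hcc : (starRingEnd ℂ) c * c = 1 := by
    rw [mul_comm, Complex.mul_conj, normSq_eq_norm_sq, hc1]; simp
  have hexp : inner ℂ (x - c • y) (N (x - c • y)) = inner ℂ x (N x) - c * inner ℂ x (N y)
      - (starRingEnd ℂ) c * inner ℂ y (N x) + inner ℂ y (N y) := by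
    rw [map_sub, map_smul, inner_sub_left, inner_sub_right, inner_sub_right, inner_smul_right,
      inner_smul_left, inner_smul_left, inner_smul_right]
    linear_combination (inner ℂ y (N y)) * hcc
  have hre : (c * inner ℂ x (N y)).re = ((starRingEnd ℂ) c * inner ℂ (N y) x).re := by
    rw [← conj_re, map_mul, inner_conj_symm]
  have hsum : ((starRingEnd ℂ) c * inner ℂ (N y) x).re + ((starRingEnd ℂ) c * inner ℂ y (N x)).re
      = ‖b‖ := by
    rw [← add_re, ← mul_add, add_comm (inner ℂ (N y) x), ← hb, hc, ofReal_re]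
  change 0 ≤ (inner ℂ (x - c • y) (N (x - c • y))).re at hpos
  rw [hexp, add_re, sub_re, sub_re, hre] at hpos
  linarith

include hR in
lemma continuous_inner_resolventAt (x y : V) :
    Continuous fun θ => inner ℂ y (R.resolventAt γ θ x) := by
  simp only [resolventAt, inner_eval]
  refine continuous_finsetSum _ fun μ hμ => ?_
  exact ((γ.continuous_rel μ).inv₀ (ConvexCurve.rel_ne_zero (hR μ hμ))).mul continuous_const

include hR in
lemma inner_eval_cauchy {φ : ℝ → ℂ} (hφ : Continuous φ) (x y : V) :
    inner ℂ y (R.eval (γ.cauchy φ) x) = (2 * Real.pi : ℂ)⁻¹ *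
      ∫ θ in (0 : ℝ)..(2 * Real.pi), φ θ * (γ.speed θ * inner ℂ y (R.resolventAt γ θ x)) := by
  rw [inner_eval]
  simp only [resolventAt, inner_eval, Finset.mul_sum]
  rw [intervalIntegral.integral_finsetSum, Finset.mul_sum]
  · refine Finset.sum_congr rfl fun μ hμ => ?_
    rw [ConvexCurve.cauchy, mul_assoc, ← intervalIntegral.integral_mul_const]
    congr 2
    ext θ
    ring
  · intro μ hμ
    have := γ.speed_continuous
    have h2 := (γ.continuous_rel μ).inv₀ (ConvexCurve.rel_ne_zero (hR μ hμ))
    exact (hφ.mul ((continuous_ofReal.comp this).mul (h2.mul continuous_const))).intervalIntegrable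
      _ _

-- The Cauchy integral of the constant 1 is 1. This computes the total mass of the positive operator
-- density used below.
include hR in
lemma integral_re_inner_resolventAt (x : V) :
    ∫ θ in (0 : ℝ)..(2 * Real.pi), γ.speed θ * (inner ℂ x (R.resolventAt γ θ x)).re =
      2 * Real.pi * ‖x‖ ^ 2 := by
  have h := R.inner_eval_cauchy hR (φ := fun _ => 1) continuous_const x x
  have h1 : R.eval (γ.cauchy fun _ => 1) = 1 := by
    rw [← R.eval_one]
    exact R.eval_congr fun μ hμ => ConvexCurve.cauchy_eq (f := fun _ => 1) convex_univ isOpen_univ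
      (by fun_prop) (Set.subset_univ _) (fun _ => Set.mem_univ _) (hR μ hμ)
  rw [h1] at h
  simp only [one_apply_eq_self, one_mul, inner_self_eq_norm_sq_to_K] at h
  have hpi : (2 * Real.pi : ℂ) ≠ 0 := by simp [Real.pi_ne_zero]
  rw [eq_inv_mul_iff_mul_eq₀ hpi] at h
  have hs := γ.speed_continuous
  have hc := R.continuous_inner_resolventAt hR x x
  have h2 := (Complex.reCLM.intervalIntegral_comp_comm
    (Continuous.intervalIntegrable (μ := volume) (by fun_prop :
      Continuous fun θ => (γ.speed θ : ℂ) * inner ℂ x (R.resolventAt γ θ x)) 0 (2 * Real.pi)))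
  simp only [reCLM_apply, re_ofReal_mul] at h2
  rw [h2, ← h]
  have h3 : (2 * Real.pi : ℂ) * (‖x‖ : ℂ) ^ 2 = ((2 * Real.pi * ‖x‖ ^ 2 : ℝ) : ℂ) := by push_cast; ring
  exact (congrArg re h3).trans (ofReal_re _)

/-- Test with y the multiple of Lx that has norm ‖x‖. -/
lemma _root_.ContinuousLinearMap.opNorm_le_two_of_inner_le (L : V →L[ℂ] V)
    (h : ∀ x y, ‖inner ℂ y (L x)‖ ≤ ‖x‖ ^ 2 + ‖y‖ ^ 2) : ‖L‖ ≤ 2 := by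
  refine L.opNorm_le_bound zero_le_two fun x => ?_
  rcases eq_or_ne (L x) 0 with h0 | h0
  · rw [h0, norm_zero]; positivity
  have hL : 0 < ‖L x‖ := norm_pos_iff.2 h0
  have hx : 0 < ‖x‖ := norm_pos_iff.2 fun hx => h0 (by rw [hx, map_zero])
  have h1 := h x (((‖x‖ / ‖L x‖ : ℝ) : ℂ) • L x)
  rw [inner_smul_left, inner_self_eq_norm_sq_to_K, norm_smul, conj_ofReal, norm_mul, norm_real,
    norm_pow, Real.norm_of_nonneg (by positivity)] at h1
  simp only [coe_algebraMap, norm_real, norm_norm] at h1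
  rw [div_mul_cancel₀ _ hL.ne', pow_two ‖L x‖, ← mul_assoc, div_mul_cancel₀ _ hL.ne'] at h1
  have : ‖x‖ * ‖L x‖ ≤ ‖x‖ * (2 * ‖x‖) := by linarith [h1]
  exact le_of_mul_le_mul_left this hx

variable [CompleteSpace V]

-- With N the rotated resolvent, the operator is (2π)⁻¹ ∫ f · speed · (N + N*) dθ: a function
-- bounded by 1 against a positive operator density of total mass 2.
include hR hT in
lemma norm_eval_add_adjoint_le {U : Set ℂ} {f : ℂ → ℂ} (hU : Convex ℝ U) (hUo : IsOpen U)
    (hf : DifferentiableOn ℂ f U) (hin : γ.inner ⊆ U) (hpt : ∀ θ, γ.pt θ ∈ U)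
    (hfb : ∀ z ∈ U, ‖f z‖ ≤ 1) :
    ‖R.eval f + star (R.eval (γ.cauchy fun θ => (starRingEnd ℂ) (f (γ.pt θ))))‖ ≤ 2 := by
  refine ContinuousLinearMap.opNorm_le_two_of_inner_le _ fun x y => ?_
  have hfc : Continuous fun θ => f (γ.pt θ) :=
    hf.continuousOn.comp_continuous γ.continuous_pt hpt
  have hfc' : Continuous fun θ => (starRingEnd ℂ) (f (γ.pt θ)) :=
    Complex.continuous_conj.comp hfc
  have h1 : R.eval f = R.eval (γ.cauchy fun θ => f (γ.pt θ)) :=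
    R.eval_congr fun μ hμ => (ConvexCurve.cauchy_eq hU hUo hf hin hpt (hR μ hμ)).symm
  have hs := γ.speed_continuous
  have hs' : Continuous fun θ => (γ.speed θ : ℂ) := continuous_ofReal.comp hs
  have hc1 := R.continuous_inner_resolventAt hR x y
  have hc2 : Continuous fun θ => inner ℂ (R.resolventAt γ θ y) x := by
    have := Complex.continuous_conj.comp (R.continuous_inner_resolventAt hR y x)
    simpa only [Function.comp_def, inner_conj_symm] using this
  have h2 : inner ℂ y ((R.eval f +
      star (R.eval (γ.cauchy fun θ => (starRingEnd ℂ) (f (γ.pt θ))))) x) =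
      (2 * Real.pi : ℂ)⁻¹ * ∫ θ in (0 : ℝ)..(2 * Real.pi), f (γ.pt θ) * (γ.speed θ *
        (inner ℂ y (R.resolventAt γ θ x) + inner ℂ (R.resolventAt γ θ y) x)) := by
    rw [_root_.add_apply, inner_add_right, ContinuousLinearMap.star_eq_adjoint,
      ContinuousLinearMap.adjoint_inner_right, ← inner_conj_symm _ x, h1,
      R.inner_eval_cauchy hR hfc, R.inner_eval_cauchy hR hfc', map_mul, ← intervalIntegral_conj]
    simp only [map_mul, map_inv₀, map_ofNat, conj_ofReal, conj_conj, inner_conj_symm]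
    rw [← mul_add, ← intervalIntegral.integral_add
      ((hfc.fun_mul (hs'.fun_mul hc1)).intervalIntegrable _ _)
      ((hfc.fun_mul (hs'.fun_mul hc2)).intervalIntegrable _ _)]
    congr 2
    ext θ
    ring
  rw [h2, norm_mul, norm_inv]
  have h3 : ‖∫ θ in (0 : ℝ)..(2 * Real.pi), f (γ.pt θ) * (γ.speed θ *
        (inner ℂ y (R.resolventAt γ θ x) + inner ℂ (R.resolventAt γ θ y) x))‖ ≤
      ∫ θ in (0 : ℝ)..(2 * Real.pi), (γ.speed θ * (inner ℂ x (R.resolventAt γ θ x)).re +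
        γ.speed θ * (inner ℂ y (R.resolventAt γ θ y)).re) := by
    have hcx := R.continuous_inner_resolventAt hR x x
    have hcy := R.continuous_inner_resolventAt hR y y
    refine intervalIntegral.norm_integral_le_of_norm_le Real.two_pi_pos.le
      (Eventually.of_forall fun θ _ => ?_) (Continuous.intervalIntegrable (by fun_prop) _ _)
    rw [norm_mul, norm_mul, norm_real, Real.norm_of_nonneg (γ.speed_pos θ).le, ← mul_add]
    refine (mul_le_of_le_one_left (by have := (γ.speed_pos θ).le; positivity)
      (hfb _ (hpt θ))).trans ?_
    exact mul_le_mul_of_nonneg_left (R.norm_inner_resolventAt_le hR hT θ x y) (γ.speed_pos θ).le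
  have hcx := R.continuous_inner_resolventAt hR x x
  have hcy := R.continuous_inner_resolventAt hR y y
  rw [intervalIntegral.integral_add (Continuous.intervalIntegrable (by fun_prop) _ _)
      (Continuous.intervalIntegrable (by fun_prop) _ _), R.integral_re_inner_resolventAt hR,
      R.integral_re_inner_resolventAt hR] at h3
  have hn : ‖(2 * Real.pi : ℂ)‖ = 2 * Real.pi := by
    rw [norm_mul, norm_real, Real.norm_of_nonneg Real.pi_pos.le]; simp
  rw [hn, inv_mul_le_iff₀ Real.two_pi_pos]
  linarith

lemma _root_.CStarRing.norm_pow_four {A : Type*} [NonUnitalNormedRing A] [StarRing A] [CStarRing A]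
    (a : A) : ‖a * star a * (a * star a)‖ = ‖a‖ ^ 4 := by
  have h1 : star (a * star a) = a * star a := by simp
  have h2 := CStarRing.norm_self_mul_star (x := a * star a)
  rw [h1, CStarRing.norm_self_mul_star] at h2
  rw [h2]; ring

-- Put a = f(T), G = g(T), s = a + G*. Then aa*aa* = a s* aa* - (aGa)a*. Here ‖s‖ ≤ 2, and aGa =
-- (fgf)(T) has norm at most K because fgf is again bounded by 1.
include hR hT in
lemma norm_eval_pow_le {U : Set ℂ} {f : ℂ → ℂ} (hU : Convex ℝ U) (hUo : IsOpen U)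
    (hf : DifferentiableOn ℂ f U) (hin : γ.inner ⊆ U) (hpt : ∀ θ, γ.pt θ ∈ U)
    (hfb : ∀ z ∈ U, ‖f z‖ ≤ 1) {K : ℝ}
    (hK : ∀ g : ℂ → ℂ, DifferentiableOn ℂ g γ.inner → (∀ z ∈ γ.inner, ‖g z‖ ≤ 1) →
      ‖R.eval g‖ ≤ K) :
    ‖R.eval f‖ ^ 4 ≤ 2 * ‖R.eval f‖ ^ 3 + K * ‖R.eval f‖ := by
  set g := γ.cauchy fun θ => (starRingEnd ℂ) (f (γ.pt θ)) with hg
  have hfc : Continuous fun θ => (starRingEnd ℂ) (f (γ.pt θ)) :=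
    Complex.continuous_conj.comp (hf.continuousOn.comp_continuous γ.continuous_pt hpt)
  have hgd : DifferentiableOn ℂ g γ.inner := ConvexCurve.differentiableOn_cauchy hfc
  have hgb : ∀ z ∈ γ.inner, ‖g z‖ ≤ 1 := fun z hz =>
    ConvexCurve.norm_cauchy_conj_le hU hUo hf hin hpt hfb hz
  have hS := R.norm_eval_add_adjoint_le hR hT hU hUo hf hin hpt hfb
  rw [← hg] at hS
  have hfgf : ‖R.eval f * R.eval g * R.eval f‖ ≤ K := by
    rw [eval_mul, eval_mul]
    refine hK _ (((hf.mono hin).mul hgd).mul (hf.mono hin)) fun z hz => ?_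
    have h1 := hfb z (hin hz)
    have h2 := hgb z hz
    rw [norm_mul, norm_mul]
    exact mul_le_one₀ (mul_le_one₀ h1 (norm_nonneg _) h2) (norm_nonneg _) h1
  set a := R.eval f
  set G := R.eval g
  set s := a + star G with hs
  have hid : a * star a * (a * star a) = a * star s * (a * star a) - a * G * a * star a := by
    rw [hs, star_add, star_star]
    noncomm_ring
  rw [← CStarRing.norm_pow_four, hid]
  refine (norm_sub_le _ _).trans (add_le_add ?_ ?_)
  · calc ‖a * star s * (a * star a)‖ ≤ ‖a‖ * ‖star s‖ * (‖a‖ * ‖star a‖) :=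
          (norm_mul_le _ _).trans (mul_le_mul (norm_mul_le _ _) (norm_mul_le _ _)
            (norm_nonneg _) (by positivity))
      _ = ‖s‖ * ‖a‖ ^ 3 := by rw [norm_star, norm_star]; ring
      _ ≤ 2 * ‖a‖ ^ 3 := by gcongr
  · calc ‖a * G * a * star a‖ ≤ ‖a * G * a‖ * ‖star a‖ := norm_mul_le _ _
      _ ≤ K * ‖a‖ := by rw [norm_star]; gcongr

end SpectralResolution

lemma ConvexCurve.re_rel_pt_nonneg (γ : ConvexCurve) (θ φ : ℝ) :
    0 ≤ (γ.rel (γ.pt θ) φ).re := by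
  obtain ⟨y, hy, hy'⟩ := (γ.pt_periodic.const_add φ).exists_mem_Ico₀ Real.two_pi_pos (θ - φ)
  rw [add_sub_cancel] at hy'
  rw [hy']
  refine le_trans ?_ (γ.le_re_rel_pt φ (Set.Ico_subset_Icc_self hy))
  exact mul_nonneg γ.minSpeed_pos.le (sub_nonneg.2 (Real.cos_le_one y))

namespace SpectralResolution

variable {V : Type*} [NormedAddCommGroup V] [InnerProductSpace ℂ V] {T : V →L[ℂ] V}

section

variable (R : SpectralResolution T) [CompleteSpace V] {γ : ConvexCurve}

/-- Replacing f by its dilation z ↦ f(c + t(z - c)) with t < 1 gives a function holomorphic on a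
neighbourhood of the curve; then t tends to 1. -/
lemma norm_eval_pow_le_of_inner (hR : ∀ μ ∈ R.eigs, μ ∈ γ.inner)
    (hT : ∀ (θ : ℝ) (x : V), 0 ≤ (inner ℂ x (cexp (-(θ * I)) • (γ.pt θ • x - T x))).re)
    {f : ℂ → ℂ} (hf : DifferentiableOn ℂ f γ.inner) (hfb : ∀ z ∈ γ.inner, ‖f z‖ ≤ 1)
    {c : ℂ} (hc : c ∈ γ.inner) {K : ℝ}
    (hK : ∀ g : ℂ → ℂ, DifferentiableOn ℂ g γ.inner → (∀ z ∈ γ.inner, ‖g z‖ ≤ 1) →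
      ‖R.eval g‖ ≤ K) :
    ‖R.eval f‖ ^ 4 ≤ 2 * ‖R.eval f‖ ^ 3 + K * ‖R.eval f‖ := by
  have hdil : ∀ t ∈ Set.Ioo (0 : ℝ) 1, ‖R.eval fun z => f (c + t * (z - c))‖ ^ 4 ≤
      2 * ‖R.eval fun z => f (c + t * (z - c))‖ ^ 3 + K * ‖R.eval fun z => f (c + t * (z - c))‖ := by
    intro t ht
    have hm : ∀ z : ℂ, c + t * (z - c) = t • z + (1 - t) • c := fun z => by
      simp only [real_smul]; push_cast; ring
    refine R.norm_eval_pow_le hR hT (U := {z | c + t * (z - c) ∈ γ.inner}) ?_ ?_ ?_ ?_ ?_ ?_ hK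
    · intro x hx y hy a b ha hb hab
      have := γ.convex_inner hx hy ha hb hab
      have hab' : (a : ℂ) + b = 1 := by exact_mod_cast hab
      have he : c + t * ((a • x + b • y) - c) =
          a • (c + t * (x - c)) + b • (c + t * (y - c)) := by
        simp only [real_smul]
        linear_combination (c * t - c) * hab'
      change c + t * ((a • x + b • y) - c) ∈ γ.inner
      rw [he]
      exact this
    · exact γ.isOpen_inner.preimage (by fun_prop)
    · exact hf.comp (by fun_prop) fun z hz => hz
    · intro z hz
      have := γ.convex_inner hz hc ht.1.le (sub_nonneg.2 ht.2.le) (by ring)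
      rwa [← hm] at this
    · intro θ φ
      rw [hm, γ.rel_convex_comb _ _ _ _ (by ring), add_re, re_ofReal_mul, re_ofReal_mul]
      have h1 := mul_nonneg ht.1.le (γ.re_rel_pt_nonneg θ φ)
      have h2 := mul_pos (sub_pos.2 ht.2) (hc φ)
      linarith
    · exact fun z hz => hfb _ hz
  have hlim : Tendsto (fun t : ℝ => R.eval fun z => f (c + t * (z - c))) (𝓝[<] 1)
      (𝓝 (R.eval f)) := by
    refine Tendsto.mono_left ?_ nhdsWithin_le_nhds
    refine tendsto_finsetSum _ fun μ hμ => Tendsto.smul_const ?_ _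
    have h1 : ContinuousAt f (c + ((1 : ℝ) : ℂ) * (μ - c)) := by
      rw [ofReal_one, one_mul, add_sub_cancel]
      exact (hf.differentiableAt (γ.isOpen_inner.mem_nhds (hR μ hμ))).continuousAt
    have h2 : ContinuousAt (fun t : ℝ => f (c + t * (μ - c))) 1 :=
      ContinuousAt.comp (f := fun t : ℝ => c + t * (μ - c)) h1 (by fun_prop)
    have h3 := h2.tendsto
    simpa using h3
  have hn := hlim.norm
  refine le_of_tendsto_of_tendsto (hn.pow 4) (((hn.pow 3).const_mul 2).add (hn.const_mul K)) ?_
  filter_upwards [Ioo_mem_nhdsLT (zero_lt_one (α := ℝ))] with t ht using hdil t ht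

/-- **Crouzeix–Palencia theorem**, for a diagonalized operator and a smooth convex domain. -/
theorem norm_eval_le (hR : ∀ μ ∈ R.eigs, μ ∈ γ.inner)
    (hT : ∀ (θ : ℝ) (x : V), 0 ≤ (inner ℂ x (cexp (-(θ * I)) • (γ.pt θ • x - T x))).re)
    {f : ℂ → ℂ} (hf : DifferentiableOn ℂ f γ.inner) (hfb : ∀ z ∈ γ.inner, ‖f z‖ ≤ 1) :
    ‖R.eval f‖ ≤ 1 + √2 := by
  rcases R.eigs.eq_empty_or_nonempty with he | ⟨c, hc⟩
  · simp only [eval, he, Finset.sum_empty, norm_zero]; positivity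
  replace hc := hR c hc
  -- K is the best constant for T on this domain. It is finite because there are finitely many
  -- projections, so the inequality for each g passes to K itself.
  set s : Set ℝ := {x | ∃ g : ℂ → ℂ, DifferentiableOn ℂ g γ.inner ∧ (∀ z ∈ γ.inner, ‖g z‖ ≤ 1) ∧
    x = ‖R.eval g‖} with hs
  have hsb : BddAbove s := ⟨∑ μ ∈ R.eigs, ‖R.proj μ‖, by
    rintro _ ⟨g, -, hg, rfl⟩
    exact R.norm_eval_le_sum fun μ hμ => hg μ (hR μ hμ)⟩
  have hmem : ‖R.eval f‖ ∈ s := ⟨f, hf, hfb, rfl⟩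
  set K := sSup s with hKdef
  have hK : ∀ g : ℂ → ℂ, DifferentiableOn ℂ g γ.inner → (∀ z ∈ γ.inner, ‖g z‖ ≤ 1) →
      ‖R.eval g‖ ≤ K := fun g h1 h2 => le_csSup hsb ⟨g, h1, h2, rfl⟩
  have hK0 : 0 ≤ K := (norm_nonneg _).trans (hK f hf hfb)
  have hx : ∀ x ∈ s, x ^ 3 ≤ 2 * x ^ 2 + K := by
    rintro _ ⟨g, h1, h2, rfl⟩
    have h := R.norm_eval_pow_le_of_inner hR hT h1 h2 hc hK
    rcases (norm_nonneg (R.eval g)).eq_or_lt with h0 | h0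
    · rw [← h0]; simpa using hK0
    · refine le_of_mul_le_mul_right ?_ h0
      linarith [h]
  obtain ⟨u, -, hu, hus⟩ := exists_seq_tendsto_sSup ⟨_, hmem⟩ hsb
  have hlim : K ^ 3 ≤ 2 * K ^ 2 + K :=
    le_of_tendsto_of_tendsto (hu.pow 3) (((hu.pow 2).const_mul 2).add_const K)
      (Eventually.of_forall fun n => hx _ (hus n))
  refine (hK f hf hfb).trans ?_
  by_contra! hlt
  have h2 : (√2) ^ 2 = 2 := Real.sq_sqrt zero_le_two
  have h3 : 0 ≤ √2 := Real.sqrt_nonneg 2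
  have h4 : 0 < K := by linarith
  -- The positive root of K² = 2K + 1 is 1 + √2.
  have h5 : K ^ 2 ≤ 2 * K + 1 := le_of_mul_le_mul_right (by linarith) h4
  nlinarith

end

/-- The spectral resolution of an operator annihilated by a polynomial with simple roots. -/
def ofNodal (S : Finset ℂ) (hS : S.Nonempty)
    (h : Polynomial.aeval T (Lagrange.nodal S id) = 0) : SpectralResolution T where
  eigs := S
  proj μ := Polynomial.aeval T (Lagrange.basis S id μ)
  sum_proj := by
    rw [← map_sum, Lagrange.sum_basis (v := id) (fun _ _ _ _ h => h) hS, map_one]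
  -- Each identity between polynomials in T is a congruence modulo the nodal polynomial, whose roots
  -- are simple, so it suffices to check it at every point of S.
  proj_mul_self μ hμ := by
    rw [← map_mul, ← sub_eq_zero, ← map_sub]
    refine Polynomial.aeval_eq_zero_of_dvd_aeval_eq_zero ?_ h
    refine (Finset.prod_dvd_of_coprime ?_ fun ν hν => ?_)
    · exact fun x _ y _ hxy => Polynomial.isCoprime_X_sub_C_of_isUnit_sub (sub_ne_zero.2 hxy).isUnit
    · rw [Polynomial.dvd_iff_isRoot, Polynomial.IsRoot]
      simp only [Polynomial.eval_sub, Polynomial.eval_mul, id]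
      rcases eq_or_ne μ ν with rfl | hne
      · have := Lagrange.eval_basis_self (v := id) (s := S) (fun _ _ _ _ h => h) hμ
        simp only [id] at this
        simp [this]
      · have := Lagrange.eval_basis_of_ne (v := id) hne hν
        simp only [id] at this
        simp [this]
  proj_mul_of_ne μ hμ ν hν hne := by
    rw [← map_mul]
    refine Polynomial.aeval_eq_zero_of_dvd_aeval_eq_zero ?_ h
    refine (Finset.prod_dvd_of_coprime ?_ fun κ hκ => ?_)
    · exact fun x _ y _ hxy => Polynomial.isCoprime_X_sub_C_of_isUnit_sub (sub_ne_zero.2 hxy).isUnit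
    · rw [Polynomial.dvd_iff_isRoot, Polynomial.IsRoot]
      simp only [Polynomial.eval_mul, id]
      rcases eq_or_ne μ κ with rfl | hne'
      · have := Lagrange.eval_basis_of_ne (v := id) hne.symm hκ
        simp only [id] at this
        simp [this]
      · have := Lagrange.eval_basis_of_ne (v := id) hne' hκ
        simp only [id] at this
        simp [this]
  mul_proj μ hμ := by
    have h1 : T * Polynomial.aeval T (Lagrange.basis S id μ) =
        Polynomial.aeval T (Polynomial.X * Lagrange.basis S id μ) := by
      rw [map_mul, Polynomial.aeval_X]
    rw [h1, ← map_smul, ← sub_eq_zero, ← map_sub]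
    refine Polynomial.aeval_eq_zero_of_dvd_aeval_eq_zero ?_ h
    refine (Finset.prod_dvd_of_coprime ?_ fun ν hν => ?_)
    · exact fun x _ y _ hxy => Polynomial.isCoprime_X_sub_C_of_isUnit_sub (sub_ne_zero.2 hxy).isUnit
    · rw [Polynomial.dvd_iff_isRoot, Polynomial.IsRoot]
      simp only [Polynomial.eval_sub, Polynomial.eval_mul, Polynomial.eval_X,
        Polynomial.eval_smul, id, smul_eq_mul]
      rcases eq_or_ne μ ν with rfl | hne
      · simp
      · have := Lagrange.eval_basis_of_ne (v := id) hne hν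
        simp only [id] at this
        simp [this]

end SpectralResolution

/-! ### Outer approximation of compact convex sets by smooth convex domains. -/

/-- The support function of a planar set, as a function of the angle of the normal. -/
def supportFun (K : Set ℂ) (θ : ℝ) : ℝ := sSup ((fun z => (cexp (-(θ * I)) * z).re) '' K)

section supportFun

variable {K : Set ℂ} (hK : IsCompact K) (hne : K.Nonempty)

include hK in
lemma re_le_supportFun {z : ℂ} (hz : z ∈ K) (θ : ℝ) :
    (cexp (-(θ * I)) * z).re ≤ supportFun K θ :=
  le_csSup (hK.bddAbove_image (by fun_prop)) ⟨z, hz, rfl⟩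

include hK hne in
lemma exists_re_eq_supportFun (θ : ℝ) :
    ∃ z ∈ K, (cexp (-(θ * I)) * z).re = supportFun K θ :=
  (hK.image (f := fun z : ℂ => (cexp (-(θ * I)) * z).re) (by fun_prop)).sSup_mem (hne.image _)

include hK in
lemma continuous_supportFun : Continuous (supportFun K) := by
  unfold supportFun
  exact hK.continuous_sSup (f := fun (θ : ℝ) (z : ℂ) => (cexp (-(θ * I)) * z).re) (by fun_prop)

lemma supportFun_periodic (K : Set ℂ) : Function.Periodic (supportFun K) (2 * Real.pi) := by
  intro θ
  have h := ConvexCurve.exp_neg_mul_I_periodic θ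
  simp only at h
  simp only [supportFun, h]

-- A discrete form of h + h'' ≥ 0, obtained by testing both neighbouring directions on a maximizer
-- for θ. It controls the speed of the smoothed curve from below.
include hK hne in
lemma two_cos_mul_supportFun_le (θ Δ : ℝ) :
    2 * Real.cos Δ * supportFun K θ ≤ supportFun K (θ - Δ) + supportFun K (θ + Δ) := by
  obtain ⟨z, hz, h⟩ := exists_re_eq_supportFun hK hne θ
  have h1 := re_le_supportFun hK hz (θ - Δ)
  have h2 := re_le_supportFun hK hz (θ + Δ)
  have h3 : cexp (-((θ - Δ : ℝ) * I)) * z + cexp (-((θ + Δ : ℝ) * I)) * z =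
      (2 * Real.cos Δ : ℝ) * (cexp (-(θ * I)) * z) := by
    have e1 : cexp (-((θ - Δ : ℝ) * I)) = cexp (-(θ * I)) * cexp (Δ * I) := by
      rw [← Complex.exp_add]; congr 1; push_cast; ring
    have e2 : cexp (-((θ + Δ : ℝ) * I)) = cexp (-(θ * I)) * cexp (-Δ * I) := by
      rw [← Complex.exp_add]; congr 1; push_cast; ring
    rw [e1, e2]
    push_cast
    rw [Complex.cos]
    ring
  have h4 := congrArg re h3
  rw [add_re, re_ofReal_mul, h] at h4
  linarith

-- In the direction from the nearest point k to z, the set K is supported at k, so z exceeds the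
-- support function by exactly its distance to K.
include hK in
lemma infDist_le_of_re_le_supportFun (hconv : Convex ℝ K) (hne : K.Nonempty) {z : ℂ} {ε : ℝ}
    (hε : 0 ≤ ε) (h : ∀ θ : ℝ, (cexp (-(θ * I)) * z).re ≤ supportFun K θ + ε) :
    Metric.infDist z K ≤ ε := by
  obtain ⟨k, hk, hd⟩ := hK.exists_infDist_eq_dist hne z
  rw [hd, dist_eq_norm]
  rcases eq_or_ne (z - k) 0 with h0 | h0
  · rwa [h0, norm_zero]
  obtain ⟨k', hk', hk'e⟩ := exists_re_eq_supportFun hK hne (z - k).arg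
  have hproj : inner ℝ (z - k) (k' - k) ≤ 0 := by
    refine (norm_eq_iInf_iff_real_inner_le_zero hconv hk).1 ?_ k' hk'
    rw [← dist_eq_norm, ← hd, Metric.infDist_eq_iInf]
    simp only [dist_eq_norm]
  set e := cexp (-((z - k).arg * I)) with he
  have h1 : e * (z - k) = ‖z - k‖ := by
    have h3 : e * cexp ((z - k).arg * I) = 1 := by rw [he, ← Complex.exp_add]; simp
    have h4 := Complex.norm_mul_exp_arg_mul_I (z - k)
    linear_combination -e * h4 + ‖z - k‖ * h3
  have h2 : (e * (k' - k)).re ≤ 0 := by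
    have hpos : 0 < ‖z - k‖ := norm_pos_iff.2 h0
    have h5 : (starRingEnd ℂ) (z - k) = ‖z - k‖ * e := by
      have h4 := Complex.norm_mul_exp_arg_mul_I (z - k)
      have h6 : (starRingEnd ℂ) (cexp ((z - k).arg * I)) = e := by
        rw [he, ← Complex.exp_conj]
        simp
      rw [← h6, ← conj_ofReal, ← map_mul, h4]
    rw [Complex.inner, h5, mul_comm, mul_assoc, re_ofReal_mul] at hproj
    exact nonpos_of_mul_nonpos_right hproj hpos
  have h3 := h (z - k).arg
  rw [← hk'e] at h3
  have h4 : (e * z).re - (e * k').re = ‖z - k‖ - (e * (k' - k)).re := by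
    rw [← sub_re, ← mul_sub, ← ofReal_re ‖z - k‖, ← h1, ← sub_re, ← mul_sub]
    congr 2
    ring
  linarith

include hK in
lemma exists_forall_abs_supportFun_sub_le {η : ℝ} (hη : 0 < η) :
    ∃ d > 0, ∀ θ θ', |θ - θ'| < d → |supportFun K θ - supportFun K θ'| ≤ η := by
  have hunif := (isCompact_Icc (a := (0 : ℝ)) (b := 2 * Real.pi)).uniformContinuousAt_of_continuousAt
    (supportFun K) (fun a _ => (continuous_supportFun hK).continuousAt)
    (Metric.dist_mem_uniformity hη)
  obtain ⟨d, hd0, hd⟩ := Metric.mem_uniformity_dist.1 hunif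
  refine ⟨d, hd0, fun θ θ' h => ?_⟩
  obtain ⟨n, hn, -⟩ := existsUnique_sub_zsmul_mem_Ico Real.two_pi_pos θ 0
  rw [zero_add] at hn
  have h1 := hd (a := θ - n • (2 * Real.pi)) (b := θ' - n • (2 * Real.pi))
    (by rw [dist_sub_right]; exact h) (Set.Ico_subset_Icc_self hn)
  simp only [Set.mem_ofPred_eq, (supportFun_periodic K).sub_zsmul_eq, Real.dist_eq] at h1
  exact h1.le

end supportFun

/-- The curve obtained by smoothing the boundary of a convex set with the support function `h`,
up to a factor. -/
def smoothedCurve (h : ℝ → ℝ) (Δ θ : ℝ) : ℂ :=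
  -I * cexp (Δ * I) * (∫ u in (θ - Δ)..θ, h u * cexp (u * I)) +
    I * cexp (-(Δ * I)) * ∫ u in θ..(θ + Δ), h u * cexp (u * I)

section smoothedCurve

variable {h : ℝ → ℝ} (hh : Continuous h)

-- The tangent has the direction required by `ConvexCurve`, and the speed is a finite-difference
-- substitute for Δ²(h + h''), so h need not be differentiable.
include hh in
lemma hasDerivAt_smoothedCurve (Δ θ : ℝ) :
    HasDerivAt (smoothedCurve h Δ)
      (I * cexp (θ * I) * ((h (θ - Δ) + h (θ + Δ) - 2 * Real.cos Δ * h θ : ℝ) : ℂ)) θ := by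
  have hF : Continuous fun u : ℝ => (h u * cexp (u * I) : ℂ) := by fun_prop
  have hG : ∀ θ : ℝ, HasDerivAt (fun θ => ∫ u in (0 : ℝ)..θ, (h u * cexp (u * I) : ℂ))
      (h θ * cexp (θ * I)) θ := fun θ => (hF.integral_hasStrictDerivAt 0 θ).hasDerivAt
  have he : smoothedCurve h Δ = fun θ => -I * cexp (Δ * I) *
      ((∫ u in (0 : ℝ)..θ, (h u * cexp (u * I) : ℂ)) -
        ∫ u in (0 : ℝ)..(θ - Δ), (h u * cexp (u * I) : ℂ)) +
      I * cexp (-(Δ * I)) * ((∫ u in (0 : ℝ)..(θ + Δ), (h u * cexp (u * I) : ℂ)) -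
        ∫ u in (0 : ℝ)..θ, (h u * cexp (u * I) : ℂ)) := by
    ext θ
    rw [smoothedCurve,
      intervalIntegral.integral_interval_sub_left (hF.intervalIntegrable _ _)
        (hF.intervalIntegrable _ _),
      intervalIntegral.integral_interval_sub_left (hF.intervalIntegrable _ _)
        (hF.intervalIntegrable _ _)]
  rw [he]
  have h1 := (((hG θ).sub ((hG (θ - Δ)).comp_sub_const θ Δ)).const_mul (-I * cexp (Δ * I))).add
    ((((hG (θ + Δ)).comp_add_const θ Δ).sub (hG θ)).const_mul (I * cexp (-(Δ * I))))
  refine h1.congr_deriv ?_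
  have e1 : cexp ((θ - Δ : ℝ) * I) = cexp (θ * I) * cexp (-(Δ * I)) := by
    rw [← Complex.exp_add]; congr 1; push_cast; ring
  have e2 : cexp ((θ + Δ : ℝ) * I) = cexp (θ * I) * cexp (Δ * I) := by
    rw [← Complex.exp_add]; congr 1; push_cast; ring
  have e3 : cexp (Δ * I) * cexp (-(Δ * I)) = 1 := by rw [← Complex.exp_add]; simp
  rw [e1, e2]
  push_cast
  rw [Complex.cos, neg_mul (Δ : ℂ) I]
  linear_combination I * cexp (θ * I) * (h (θ - Δ) + h (θ + Δ)) * e3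

lemma smoothedCurve_periodic (hp : Function.Periodic h (2 * Real.pi)) (Δ : ℝ) :
    Function.Periodic (smoothedCurve h Δ) (2 * Real.pi) := by
  have hF : Function.Periodic (fun u : ℝ => (h u * cexp (u * I) : ℂ)) (2 * Real.pi) := by
    intro u
    have : ((u + 2 * Real.pi : ℝ) : ℂ) * I = u * I + 2 * Real.pi * I := by push_cast; ring
    simp only [hp u, this, Complex.exp_periodic (u * I)]
  have hs : ∀ a b : ℝ, ∫ u in (a + 2 * Real.pi)..(b + 2 * Real.pi), (h u * cexp (u * I) : ℂ) =
      ∫ u in a..b, (h u * cexp (u * I) : ℂ) := by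
    intro a b
    rw [← intervalIntegral.integral_comp_add_right
      (fun u : ℝ => (h u * cexp (u * I) : ℂ)) (2 * Real.pi)]
    exact intervalIntegral.integral_congr fun u _ => hF u
  intro θ
  have e1 : θ + 2 * Real.pi - Δ = θ - Δ + 2 * Real.pi := by ring
  have e2 : θ + 2 * Real.pi + Δ = θ + Δ + 2 * Real.pi := by ring
  rw [smoothedCurve, smoothedCurve, e1, e2, hs, hs]

-- The support function of the smoothed curve is h convolved with sin(Δ - |u - θ|), a nonnegative
-- kernel of mass 2(1 - cos Δ) for Δ ≤ π; this mass is the normalizing factor used later.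
include hh in
lemma re_smoothedCurve (Δ θ : ℝ) :
    (cexp (-(θ * I)) * smoothedCurve h Δ θ).re =
      (∫ u in (θ - Δ)..θ, h u * Real.sin (u - θ + Δ)) +
        ∫ u in θ..(θ + Δ), h u * Real.sin (θ + Δ - u) := by
  rw [smoothedCurve, mul_add, add_re, ← mul_assoc (cexp (-(θ * I))) (-I * cexp (Δ * I)),
    ← mul_assoc (cexp (-(θ * I))) (I * cexp (-(Δ * I))),
    ← intervalIntegral.integral_const_mul, ← intervalIntegral.integral_const_mul]
  have h1 := Complex.reCLM.intervalIntegral_comp_comm (Continuous.intervalIntegrable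
    (by fun_prop : Continuous fun u : ℝ =>
      cexp (-(θ * I)) * (-I * cexp (Δ * I)) * (h u * cexp (u * I))) (θ - Δ) θ (μ := volume))
  have h2 := Complex.reCLM.intervalIntegral_comp_comm (Continuous.intervalIntegrable
    (by fun_prop : Continuous fun u : ℝ =>
      cexp (-(θ * I)) * (I * cexp (-(Δ * I))) * (h u * cexp (u * I))) θ (θ + Δ) (μ := volume))
  simp only [reCLM_apply] at h1 h2
  rw [← h1, ← h2]
  congr 1 <;> refine intervalIntegral.integral_congr fun u _ => ?_
  · have : cexp (-(θ * I)) * (-I * cexp (Δ * I)) * (h u * cexp (u * I)) =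
        h u * (-I * cexp ((u - θ + Δ : ℝ) * I)) := by
      have : cexp ((u - θ + Δ : ℝ) * I) = cexp (-(θ * I)) * cexp (Δ * I) * cexp (u * I) := by
        rw [← Complex.exp_add, ← Complex.exp_add]; congr 1; push_cast; ring
      rw [this]; ring
    simp only [this, re_ofReal_mul]
    congr 1
    simp [Complex.exp_ofReal_mul_I_im, -ofReal_add, -ofReal_sub]
  · have : cexp (-(θ * I)) * (I * cexp (-(Δ * I))) * (h u * cexp (u * I)) =
        h u * (I * cexp ((-(θ + Δ - u) : ℝ) * I)) := by
      have : cexp ((-(θ + Δ - u) : ℝ) * I) = cexp (-(θ * I)) * cexp (-(Δ * I)) * cexp (u * I) := by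
        rw [← Complex.exp_add, ← Complex.exp_add]; congr 1; push_cast; ring
      rw [this]; ring
    simp only [this, re_ofReal_mul]
    congr 1
    rw [I_mul_re, Complex.exp_ofReal_mul_I_im, Real.sin_neg, neg_neg]

include hh in
lemma re_smoothedCurve_mem {Δ θ η : ℝ} (hΔ : 0 < Δ) (hΔpi : Δ ≤ Real.pi)
    (hη : ∀ u, |u - θ| ≤ Δ → |h u - h θ| ≤ η) :
    |(cexp (-(θ * I)) * smoothedCurve h Δ θ).re - 2 * (1 - Real.cos Δ) * h θ| ≤
      2 * (1 - Real.cos Δ) * η := by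
  have i1 : ∫ u in (θ - Δ)..θ, Real.sin (u - θ + Δ) = 1 - Real.cos Δ := by
    rw [intervalIntegral.integral_eq_sub_of_hasDerivAt
      (f := fun u => -Real.cos (u - θ + Δ)) (fun u _ => ?_)
      (Continuous.intervalIntegrable (by fun_prop) _ _)]
    · simp; ring
    · have := (((hasDerivAt_id u).sub_const θ).add_const Δ).cos.fun_neg
      simpa using this
  have i2 : ∫ u in θ..(θ + Δ), Real.sin (θ + Δ - u) = 1 - Real.cos Δ := by
    rw [intervalIntegral.integral_eq_sub_of_hasDerivAt
      (f := fun u => Real.cos (θ + Δ - u)) (fun u _ => ?_)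
      (Continuous.intervalIntegrable (by fun_prop) _ _)]
    · simp
    · have := ((hasDerivAt_id u).const_sub (θ + Δ)).cos
      simpa using this
  rw [re_smoothedCurve hh]
  have b1 : |(∫ u in (θ - Δ)..θ, h u * Real.sin (u - θ + Δ)) - (1 - Real.cos Δ) * h θ| ≤
      (1 - Real.cos Δ) * η := by
    rw [← i1, ← intervalIntegral.integral_mul_const, ← intervalIntegral.integral_mul_const,
      ← intervalIntegral.integral_sub (Continuous.intervalIntegrable (by fun_prop) _ _)
        (Continuous.intervalIntegrable (by fun_prop) _ _), ← Real.norm_eq_abs]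
    refine intervalIntegral.norm_integral_le_of_norm_le (by linarith)
      (Eventually.of_forall fun u hu => ?_) (Continuous.intervalIntegrable (by fun_prop) _ _)
    have hs : 0 ≤ Real.sin (u - θ + Δ) :=
      Real.sin_nonneg_of_nonneg_of_le_pi (by linarith [hu.1]) (by linarith [hu.2])
    have hd := hη u (abs_le.2 ⟨by linarith [hu.1], by linarith [hu.2]⟩)
    rw [mul_comm (h u), ← mul_sub, norm_mul, Real.norm_of_nonneg hs, Real.norm_eq_abs]
    gcongr
  have b2 : |(∫ u in θ..(θ + Δ), h u * Real.sin (θ + Δ - u)) - (1 - Real.cos Δ) * h θ| ≤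
      (1 - Real.cos Δ) * η := by
    rw [← i2, ← intervalIntegral.integral_mul_const, ← intervalIntegral.integral_mul_const,
      ← intervalIntegral.integral_sub (Continuous.intervalIntegrable (by fun_prop) _ _)
        (Continuous.intervalIntegrable (by fun_prop) _ _), ← Real.norm_eq_abs]
    refine intervalIntegral.norm_integral_le_of_norm_le (by linarith)
      (Eventually.of_forall fun u hu => ?_) (Continuous.intervalIntegrable (by fun_prop) _ _)
    have hs : 0 ≤ Real.sin (θ + Δ - u) :=
      Real.sin_nonneg_of_nonneg_of_le_pi (by linarith [hu.2]) (by linarith [hu.1])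
    have hd := hη u (abs_le.2 ⟨by linarith [hu.1], by linarith [hu.2]⟩)
    rw [mul_comm (h u), ← mul_sub, norm_mul, Real.norm_of_nonneg hs, Real.norm_eq_abs]
    gcongr
  rw [abs_le] at b1 b2 ⊢
  constructor <;> linarith [b1.1, b1.2, b2.1, b2.2]

end smoothedCurve

/-- A compact convex set is approximated from outside by smooth strictly convex domains. -/
theorem exists_convexCurve {K : Set ℂ} (hK : IsCompact K) (hconv : Convex ℝ K) (hne : K.Nonempty)
    {ε : ℝ} (hε : 0 < ε) :
    ∃ γ : ConvexCurve,
      (∀ z : ℂ, (∀ θ : ℝ, (cexp (-(θ * I)) * z).re ≤ supportFun K θ + ε / 4) → z ∈ γ.inner) ∧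
      ∀ z ∈ γ.inner, Metric.infDist z K ≤ ε := by
  obtain ⟨d, hd0, hd⟩ := exists_forall_abs_supportFun_sub_le hK (by positivity : 0 < ε / 8)
  set Δ := min 1 (d / 2) with hΔ
  have hΔ0 : 0 < Δ := by positivity
  have hΔpi : Δ ≤ Real.pi := (min_le_left _ _).trans (by linarith [Real.pi_gt_three])
  have hΔd : Δ < d := (min_le_right _ _).trans_lt (by linarith)
  have hcos : 0 < 2 * (1 - Real.cos Δ) := by
    have := Real.cos_lt_cos_of_nonneg_of_le_pi le_rfl hΔpi hΔ0
    rw [Real.cos_zero] at this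
    linarith
  -- The added constant contributes ε/2 to the normalized speed. Smoothing costs at most ε/8, so the
  -- final support function lies between those of K enlarged by 3ε/8 and by 5ε/8.
  set h : ℝ → ℝ := fun θ => supportFun K θ + ε / 2 with hh
  have hhc : Continuous h := (continuous_supportFun hK).add continuous_const
  have hhp : Function.Periodic h (2 * Real.pi) := fun θ => by
    simp only [hh, supportFun_periodic K θ]
  set c := 2 * (1 - Real.cos Δ) with hc
  let γ : ConvexCurve :=
    { pt := fun θ => smoothedCurve h Δ θ / c
      speed := fun θ => (h (θ - Δ) + h (θ + Δ) - 2 * Real.cos Δ * h θ) / c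
      minSpeed := ε / 2
      minSpeed_pos := by positivity
      minSpeed_le := fun θ => by
        rw [le_div_iff₀ hcos]
        have := two_cos_mul_supportFun_le hK hne θ Δ
        simp only [hh, hc]
        linarith
      speed_continuous := by fun_prop
      speed_periodic := fun θ => by
        have e1 : θ + 2 * Real.pi - Δ = θ - Δ + 2 * Real.pi := by ring
        have e2 : θ + 2 * Real.pi + Δ = θ + Δ + 2 * Real.pi := by ring
        simp only [e1, e2, hhp _]
      pt_periodic := fun θ => by simp only [smoothedCurve_periodic hhp Δ θ]
      hasDerivAt_pt := fun θ => by
        refine ((hasDerivAt_smoothedCurve hhc Δ θ).div_const (c : ℂ)).congr_deriv ?_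
        push_cast
        ring }
  have hrel : ∀ (z : ℂ) (θ : ℝ), |(γ.rel z θ).re - (h θ - (cexp (-(θ * I)) * z).re)| ≤ ε / 8 := by
    intro z θ
    have h1 := re_smoothedCurve_mem hhc (θ := θ) hΔ0 hΔpi (η := ε / 8) fun u hu => by
      simp only [hh, add_sub_add_right_eq_sub]
      exact hd u θ (hu.trans_lt hΔd)
    have h2 : (γ.rel z θ).re = (cexp (-(θ * I)) * smoothedCurve h Δ θ).re / c -
        (cexp (-(θ * I)) * z).re := by
      simp only [ConvexCurve.rel, γ]
      rw [mul_sub, sub_re, mul_div_assoc', div_ofReal_re]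
    have h3 : (γ.rel z θ).re - (h θ - (cexp (-(θ * I)) * z).re) =
        ((cexp (-(θ * I)) * smoothedCurve h Δ θ).re - c * h θ) / c := by
      rw [h2]; field_simp; ring
    rw [h3, abs_div, abs_of_pos hcos, div_le_iff₀ hcos]
    linarith
  refine ⟨γ, fun z hz θ => ?_, fun z hz => ?_⟩
  · have h1 := (abs_le.1 (hrel z θ)).1
    have h2 := hz θ
    simp only [hh] at h1
    linarith
  · refine infDist_le_of_re_le_supportFun hK hconv hne hε.le fun θ => ?_
    have h1 := (abs_le.1 (hrel z θ)).2
    have h2 := hz θ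
    simp only [hh] at h1
    linarith

/-! ### The Crouzeix–Palencia theorem for arbitrary matrices. -/

section

variable {ι : Type*} [Fintype ι] [DecidableEq ι]

/-- On the line from `A` to a diagonal matrix with distinct entries, all matrices but finitely many
have simple eigenvalues. -/
lemma eventually_separable_charpoly (A : Matrix ι ι ℂ) :
    ∃ D : Matrix ι ι ℂ, ∀ᶠ t in 𝓝[≠] (0 : ℂ), (((1 - t) • A + t • D).charpoly).Separable := by
  set d : ι → ℂ := fun i => ((Fintype.equivFin ι i : ℕ) : ℂ) with hd
  have hdinj : Function.Injective d := fun i j h => by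
    simp only [hd] at h
    have : ((Fintype.equivFin ι i : ℕ)) = (Fintype.equivFin ι j : ℕ) := by exact_mod_cast h
    exact (Fintype.equivFin ι).injective (Fin.ext this)
  refine ⟨Matrix.diagonal d, ?_⟩
  set M : Matrix ι ι (Polynomial ℂ) := (1 - Polynomial.X : Polynomial ℂ) • A.map Polynomial.C +
    (Polynomial.X : Polynomial ℂ) • (Matrix.diagonal d).map Polynomial.C with hM
  have hMt : ∀ t : ℂ, M.map (Polynomial.evalRingHom t) = (1 - t) • A + t • Matrix.diagonal d := by
    intro t
    ext i j
    simp [hM, Matrix.map_apply, -Matrix.diagonal_map]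
    ring
  have hcp : ∀ t : ℂ, ((1 - t) • A + t • Matrix.diagonal d).charpoly =
      M.charpoly.map (Polynomial.evalRingHom t) := fun t => by
    rw [← hMt, Matrix.charpoly_map]
  -- The discriminant, up to sign, as a polynomial in t. It is nonzero at t = 1, where the matrix is
  -- diagonal with distinct entries, hence has finitely many zeros.
  set r := M.charpoly.resultant M.charpoly.derivative with hr
  have hsep : ∀ t : ℂ, ((1 - t) • A + t • Matrix.diagonal d).charpoly.Separable ↔ r.eval t ≠ 0 := by
    intro t
    have hmon := ((1 - t) • A + t • Matrix.diagonal d).charpoly_monic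
    rw [Polynomial.separable_def, ← Polynomial.isUnit_resultant_iff_isCoprime hmon,
      isUnit_iff_ne_zero]
    have h1 : ((1 - t) • A + t • Matrix.diagonal d).charpoly.natDegree = M.charpoly.natDegree := by
      rw [Matrix.charpoly_natDegree_eq_dim, Matrix.charpoly_natDegree_eq_dim]
    have h2 : ((1 - t) • A + t • Matrix.diagonal d).charpoly.derivative.natDegree =
        M.charpoly.derivative.natDegree := by
      rw [Polynomial.natDegree_derivative, Polynomial.natDegree_derivative, h1]
    rw [h1, h2, hcp, Polynomial.derivative_map, Polynomial.resultant_map_map,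
      Polynomial.coe_evalRingHom]
  have hr0 : r ≠ 0 := by
    intro h0
    have := (hsep 1).1 (by
      rw [sub_self, zero_smul, one_smul, zero_add, Matrix.charpoly_diagonal]
      exact Polynomial.separable_prod_X_sub_C_iff.2 hdinj)
    simp [h0] at this
  have hfin : {t : ℂ | r.eval t = 0}.Finite := by
    refine (r.roots.toFinset.finite_toSet).subset fun t ht => ?_
    simp only [Finset.mem_coe, Multiset.mem_toFinset, Polynomial.mem_roots hr0]
    exact ht
  have hev : ({t : ℂ | r.eval t = 0} \ {0})ᶜ ∈ 𝓝 (0 : ℂ) :=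
    (hfin.subset Set.sdiff_subset).isClosed.isOpen_compl.mem_nhds (by simp)
  filter_upwards [mem_nhdsWithin_of_mem_nhds hev, self_mem_nhdsWithin] with t ht ht0
  exact (hsep t).2 fun h => ht ⟨h, ht0⟩

lemma exists_spectralResolution (A : Matrix ι ι ℂ) [Nonempty ι] (hA : A.charpoly.Separable) :
    ∃ R : SpectralResolution (Matrix.toEuclideanCLM (n := ι) (𝕜 := ℂ) A),
      ∀ μ ∈ R.eigs, A.charpoly.IsRoot μ := by
  set S := A.charpoly.roots.toFinset with hS
  have hmon := A.charpoly_monic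
  have hdeg : 0 < A.charpoly.degree := by
    rw [Polynomial.degree_eq_natDegree hmon.ne_zero, Matrix.charpoly_natDegree_eq_dim]
    exact_mod_cast Fintype.card_pos
  have hmem : ∀ μ, μ ∈ S ↔ A.charpoly.IsRoot μ := fun μ => by
    rw [hS, Multiset.mem_toFinset, Polynomial.mem_roots hmon.ne_zero]
  have hne : S.Nonempty := by
    obtain ⟨μ, hμ⟩ := IsAlgClosed.exists_root A.charpoly hdeg.ne'
    exact ⟨μ, (hmem μ).2 hμ⟩
  have hnodal : Lagrange.nodal S id = A.charpoly := by
    conv_rhs => rw [(IsAlgClosed.splits A.charpoly).eq_prod_roots_of_monic hmon]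
    rw [Lagrange.nodal_eq, Finset.prod_eq_multiset_prod, hS, Multiset.toFinset_val,
      (Polynomial.nodup_roots hA).dedup]
    rfl
  refine ⟨SpectralResolution.ofNodal S hne ?_, fun μ hμ => (hmem μ).1 hμ⟩
  have h1 : Polynomial.aeval (Matrix.toEuclideanCLM (n := ι) (𝕜 := ℂ) A) A.charpoly =
      Matrix.toEuclideanCLM (n := ι) (𝕜 := ℂ) (Polynomial.aeval A A.charpoly) :=
    Polynomial.aeval_algHom_apply
      (Matrix.toEuclideanCLM (n := ι) (𝕜 := ℂ)).toStarAlgHom.toAlgHom A _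
  rw [hnodal, h1, Matrix.aeval_self_charpoly, map_zero]

lemma inner_toEuclideanCLM_eq (A : Matrix ι ι ℂ) (x : EuclideanSpace ℂ ι) :
    inner ℂ x (Matrix.toEuclideanCLM (n := ι) (𝕜 := ℂ) A x) =
      star x.ofLp ⬝ᵥ (A *ᵥ x.ofLp) := by
  rw [EuclideanSpace.inner_eq_star_dotProduct, Matrix.ofLp_toEuclideanCLM, dotProduct_comm]

lemma inner_mem_numericalRange (A : Matrix ι ι ℂ) {x : EuclideanSpace ℂ ι} (hx : ‖x‖ = 1) :
    inner ℂ x (Matrix.toEuclideanCLM (n := ι) (𝕜 := ℂ) A x) ∈ Care.numericalRange A :=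
  ⟨x, hx, inner_toEuclideanCLM_eq A x⟩

lemma exists_unit_eigenvector (A : Matrix ι ι ℂ) {μ : ℂ} (h : A.charpoly.IsRoot μ) :
    ∃ x : EuclideanSpace ℂ ι, ‖x‖ = 1 ∧
      Matrix.toEuclideanCLM (n := ι) (𝕜 := ℂ) A x = μ • x := by
  rw [Polynomial.IsRoot, Matrix.eval_charpoly] at h
  obtain ⟨v, hv, hv'⟩ := Matrix.exists_mulVec_eq_zero_iff.2 h
  set y : EuclideanSpace ℂ ι := WithLp.toLp 2 v with hy
  have hy0 : y ≠ 0 := fun h0 => hv (by simpa [hy] using h0)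
  have hAy : Matrix.toEuclideanCLM (n := ι) (𝕜 := ℂ) A y = μ • y := by
    rw [hy, Matrix.toEuclideanCLM_toLp]
    rw [Matrix.sub_mulVec, sub_eq_zero] at hv'
    rw [← hv', ← WithLp.toLp_smul]
    congr 1
    ext i
    simp [Matrix.scalar_apply]
  refine ⟨((‖y‖⁻¹ : ℝ) : ℂ) • y, ?_, ?_⟩
  · rw [norm_smul, norm_real, norm_inv, norm_norm, inv_mul_cancel₀ (norm_ne_zero_iff.2 hy0)]
  · rw [map_smul, hAy, smul_comm]

/-- `norm_eval_le` is applied to p / (S q). The vector form, without an inverse of q(A), is the one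
that passes to the limit in A. -/
lemma norm_aeval_le_of_separable (A : Matrix ι ι ℂ) [Nonempty ι] (hA : A.charpoly.Separable)
    {γ : ConvexCurve} (hW : Care.numericalRange A ⊆ γ.inner) {p q : Polynomial ℂ} {S : ℝ}
    (hS : 0 < S) (hpq : ∀ z ∈ γ.inner, ‖p.eval z‖ < S * ‖q.eval z‖) (x : EuclideanSpace ℂ ι) :
    ‖Polynomial.aeval (Matrix.toEuclideanCLM (n := ι) (𝕜 := ℂ) A) p x‖ ≤
      (1 + √2) * S * ‖Polynomial.aeval (Matrix.toEuclideanCLM (n := ι) (𝕜 := ℂ) A) q x‖ := by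
  set T := Matrix.toEuclideanCLM (n := ι) (𝕜 := ℂ) A with hT
  obtain ⟨R, hR⟩ := exists_spectralResolution A hA
  have hRin : ∀ μ ∈ R.eigs, μ ∈ γ.inner := fun μ hμ => by
    obtain ⟨y, hy, hAy⟩ := exists_unit_eigenvector A (hR μ hμ)
    have h := hW (inner_mem_numericalRange A hy)
    rw [hAy, inner_smul_right, inner_self_eq_norm_sq_to_K, hy] at h
    simpa using h
  have hTin : ∀ (θ : ℝ) (x : EuclideanSpace ℂ ι),
      0 ≤ (inner ℂ x (cexp (-(θ * I)) • (γ.pt θ • x - T x))).re := by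
    intro θ y
    rcases eq_or_ne y 0 with rfl | hy
    · simp
    have hny : (0 : ℝ) < ‖y‖ := norm_pos_iff.2 hy
    set u : EuclideanSpace ℂ ι := ((‖y‖⁻¹ : ℝ) : ℂ) • y with hu
    have hu1 : ‖u‖ = 1 := by
      rw [hu, norm_smul, norm_real, norm_inv, norm_norm, inv_mul_cancel₀ hny.ne']
    have hyu : y = (‖y‖ : ℂ) • u := by
      rw [hu, smul_smul, ← ofReal_mul, mul_inv_cancel₀ hny.ne', ofReal_one, one_smul]
    have h := hW (inner_mem_numericalRange A hu1) θ
    have he : inner ℂ y (cexp (-(θ * I)) • (γ.pt θ • y - T y)) =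
        ((‖y‖ ^ 2 : ℝ) : ℂ) * γ.rel (inner ℂ u (T u)) θ := by
      have huu : inner ℂ u u = 1 := by rw [inner_self_eq_norm_sq_to_K, hu1]; simp
      conv_lhs => rw [hyu]
      rw [map_smul, smul_comm (γ.pt θ), ← smul_sub, smul_comm (cexp _), inner_smul_left,
        inner_smul_right, inner_smul_right, inner_sub_right, inner_smul_right, huu,
        conj_ofReal, ConvexCurve.rel]
      push_cast
      ring
    rw [he, re_ofReal_mul]
    exact mul_nonneg (by positivity) h.le
  have hq : ∀ z ∈ γ.inner, q.eval z ≠ 0 := fun z hz h0 => by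
    have := hpq z hz
    rw [h0, norm_zero, mul_zero] at this
    exact absurd this (not_lt.2 (norm_nonneg _))
  have hmain := R.norm_eval_le hRin hTin (f := fun z => p.eval z / (S * q.eval z))
    (p.differentiable.differentiableOn.div ((q.differentiable.const_mul _).differentiableOn)
      fun z hz => mul_ne_zero (by exact_mod_cast hS.ne') (hq z hz)) fun z hz => by
        rw [norm_div, norm_mul, norm_real, Real.norm_of_nonneg hS.le]
        exact div_le_one_of_le₀ (hpq z hz).le (by positivity)
  have hp : Polynomial.aeval T p =
      (S : ℂ) • (R.eval (fun z => p.eval z / (S * q.eval z)) * Polynomial.aeval T q) := by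
    rw [← R.eval_polynomial, ← R.eval_polynomial, R.eval_mul, ← R.eval_const_mul]
    refine R.eval_congr fun μ hμ => ?_
    have h1 := hq μ (hRin μ hμ)
    have h2 : (S : ℂ) ≠ 0 := by exact_mod_cast hS.ne'
    field_simp
  rw [hp]
  change ‖(S : ℂ) • (R.eval (fun z => p.eval z / (S * q.eval z)) (Polynomial.aeval T q x))‖ ≤ _
  rw [norm_smul, norm_real, Real.norm_of_nonneg hS.le, mul_comm (1 + √2), mul_assoc]
  gcongr
  exact (ContinuousLinearMap.le_opNorm _ _).trans (by gcongr)

lemma isBounded_numericalRange (A : Matrix ι ι ℂ) :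
    Bornology.IsBounded (Care.numericalRange A) := by
  refine (Metric.isBounded_closedBall (x := (0 : ℂ))
    (r := ‖Matrix.toEuclideanCLM (n := ι) (𝕜 := ℂ) A‖)).subset ?_
  rintro z ⟨x, hx, rfl⟩
  rw [mem_closedBall_zero_iff, ← inner_toEuclideanCLM_eq]
  refine (norm_inner_le_norm _ _).trans ?_
  have := (Matrix.toEuclideanCLM (n := ι) (𝕜 := ℂ) A).le_opNorm x
  rw [hx, mul_one] at this
  rw [hx, one_mul]
  exact this

/-- **Crouzeix–Palencia theorem** for a rational function `p / q` and the closed numerical range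
of a matrix. -/
theorem norm_aeval_le_of_numericalRange (A : Matrix ι ι ℂ) {p q : Polynomial ℂ}
    (hcop : IsCoprime p q) {S : ℝ} (hS : 0 ≤ S)
    (hpq : ∀ z ∈ convexHull ℝ (Care.numericalRange A), ‖p.eval z‖ ≤ S * ‖q.eval z‖)
    (x : EuclideanSpace ℂ ι) :
    ‖Polynomial.aeval (Matrix.toEuclideanCLM (n := ι) (𝕜 := ℂ) A) p x‖ ≤
      (1 + √2) * S * ‖Polynomial.aeval (Matrix.toEuclideanCLM (n := ι) (𝕜 := ℂ) A) q x‖ := by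
  rcases isEmpty_or_nonempty ι with hι | hι
  · rw [Subsingleton.elim x 0]; simp
  set K := closure (convexHull ℝ (Care.numericalRange A)) with hK
  have hKc : IsCompact K :=
    (isBounded_convexHull.2 (isBounded_numericalRange A)).isCompact_closure
  have hKconv : Convex ℝ K := (convex_convexHull ℝ _).closure
  have hWK : Care.numericalRange A ⊆ K := (subset_convexHull ℝ _).trans subset_closure
  have hKne : K.Nonempty := by
    obtain ⟨y, hy⟩ := exists_norm_eq (EuclideanSpace ℂ ι) (zero_le_one (α := ℝ))
    exact ⟨_, hWK (inner_mem_numericalRange A hy)⟩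
  have hpqK : ∀ z ∈ K, ‖p.eval z‖ ≤ S * ‖q.eval z‖ := fun z hz =>
    closure_minimal hpq (isClosed_le p.continuous.norm (q.continuous.norm.const_mul S)) hz
  have hqK : ∀ z ∈ K, q.eval z ≠ 0 := by
    intro z hz h0
    have h1 := hpqK z hz
    rw [h0, norm_zero, mul_zero, norm_le_zero_iff] at h1
    obtain ⟨a, b, hab⟩ := hcop
    have := congrArg (Polynomial.eval z) hab
    simp [h0, h1] at this
  -- The slack η makes the inequality strict on the compact set K, hence valid on a neighbourhood
  -- containing a smooth convex domain.
  suffices ∀ η > 0, ‖Polynomial.aeval (Matrix.toEuclideanCLM (n := ι) (𝕜 := ℂ) A) p x‖ ≤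
      (1 + √2) * (S + η) *
        ‖Polynomial.aeval (Matrix.toEuclideanCLM (n := ι) (𝕜 := ℂ) A) q x‖ by
    have hlim : Tendsto (fun η : ℝ => (1 + √2) * (S + η) *
        ‖Polynomial.aeval (Matrix.toEuclideanCLM (n := ι) (𝕜 := ℂ) A) q x‖) (𝓝[>] 0)
        (𝓝 ((1 + √2) * (S + 0) *
          ‖Polynomial.aeval (Matrix.toEuclideanCLM (n := ι) (𝕜 := ℂ) A) q x‖)) :=
      Tendsto.mono_left (Continuous.tendsto (by fun_prop) 0) nhdsWithin_le_nhds
    rw [add_zero] at hlim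
    exact ge_of_tendsto hlim (by filter_upwards [self_mem_nhdsWithin] with η hη using this η hη)
  intro η hη
  have hO : IsOpen {z | ‖p.eval z‖ < (S + η) * ‖q.eval z‖} :=
    isOpen_lt p.continuous.norm (q.continuous.norm.const_mul _)
  obtain ⟨ε, hε, hεO⟩ := hKc.exists_cthickening_subset_open hO fun z hz => by
    have h1 := hpqK z hz
    have h2 := mul_pos hη (norm_pos_iff.2 (hqK z hz))
    change ‖p.eval z‖ < (S + η) * ‖q.eval z‖
    linarith
  obtain ⟨γ, hγ1, hγ2⟩ := exists_convexCurve hKc hKconv hKne hε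
  have hγO : ∀ z ∈ γ.inner, ‖p.eval z‖ < (S + η) * ‖q.eval z‖ := fun z hz => by
    obtain ⟨k, hk, hd⟩ := hKc.exists_infDist_eq_dist hKne z
    exact hεO (Metric.mem_cthickening_of_dist_le z k ε K hk (hd ▸ hγ2 z hz))
  -- The perturbation to simple eigenvalues moves values of the quadratic form by at most ε/4, the
  -- margin granted by `exists_convexCurve`.
  obtain ⟨D, hD⟩ := eventually_separable_charpoly A
  set L := Matrix.toEuclideanCLM (n := ι) (𝕜 := ℂ) with hL
  have hTlim : Tendsto (fun t : ℂ => L ((1 - t) • A + t • D)) (𝓝[≠] 0) (𝓝 (L A)) := by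
    have h1 : Continuous fun t : ℂ => (1 - t) • L A + t • L D := by fun_prop
    have h2 : Tendsto (fun t : ℂ => (1 - t) • L A + t • L D) (𝓝 0) (𝓝 (L A)) := by
      have h0 : (1 - (0 : ℂ)) • L A + (0 : ℂ) • L D = L A := by
        ext1 y
        rw [sub_zero, one_smul]
        change L A y + (0 : ℂ) • L D y = L A y
        rw [zero_smul, add_zero]
      have h2 := h1.tendsto 0
      rwa [h0] at h2
    refine (h2.mono_left nhdsWithin_le_nhds).congr fun t => ?_
    rw [map_add, map_smul, map_smul]
  have hnear : ∀ᶠ t in 𝓝[≠] (0 : ℂ), ‖L ((1 - t) • A + t • D) - L A‖ < ε / 4 := by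
    have := hTlim.eventually (Metric.ball_mem_nhds (L A) (by positivity : 0 < ε / 4))
    simpa only [Metric.mem_ball, dist_eq_norm] using this
  have hcont : ∀ r : Polynomial ℂ, Tendsto
      (fun t : ℂ => ‖Polynomial.aeval (L ((1 - t) • A + t • D)) r x‖) (𝓝[≠] 0)
      (𝓝 ‖Polynomial.aeval (L A) r x‖) := fun r => by
    have h1 := ((Polynomial.continuous_aeval r).tendsto (L A)).comp hTlim
    exact (((ContinuousLinearMap.apply ℂ (EuclideanSpace ℂ ι) x).continuous.tendsto _).comp h1).norm
  refine le_of_tendsto_of_tendsto (hcont p) ((hcont q).const_mul _) ?_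
  filter_upwards [hD, hnear] with t ht1 ht2
  refine norm_aeval_le_of_separable _ ht1 (γ := γ) ?_ (by positivity) hγO x
  rintro z ⟨y, hy, rfl⟩
  rw [← inner_toEuclideanCLM_eq]
  refine hγ1 _ fun θ => ?_
  have h1 := re_le_supportFun hKc (hWK (inner_mem_numericalRange A hy)) θ
  have h2 : (cexp (-(θ * I)) * inner ℂ y (L ((1 - t) • A + t • D) y)).re -
      (cexp (-(θ * I)) * inner ℂ y (L A y)).re ≤ ε / 4 := by
    rw [← sub_re, ← mul_sub, ← inner_sub_right]
    refine (Complex.re_le_norm _).trans ?_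
    rw [norm_mul, ConvexCurve.norm_exp_neg_mul_I, one_mul]
    refine (norm_inner_le_norm _ _).trans ?_
    rw [hy, one_mul]
    have := (L ((1 - t) • A + t • D) - L A).le_opNorm y
    rw [hy, mul_one] at this
    exact this.trans ht2.le
  linarith

end

/-! ### Low-rank approximation of solutions of Sylvester equations. -/

noncomputable section

open scoped Matrix.Norms.L2Operator

section rank

variable {ι κ : Type*} [Fintype κ]

lemma Matrix.rank_add_le_rank_add_rank {K : Type*} [Field K] (M N : Matrix ι κ K) :
    (M + N).rank ≤ M.rank + N.rank := by
  rw [Matrix.rank, Matrix.rank, Matrix.rank, Matrix.mulVecLin_add]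
  refine (Submodule.finrank_mono ?_).trans (Submodule.finrank_add_le_finrank_add_finrank _ _)
  rintro _ ⟨x, rfl⟩
  exact Submodule.add_mem_sup ⟨x, rfl⟩ ⟨x, rfl⟩

lemma Matrix.rank_neg_le {K : Type*} [Field K] (M : Matrix ι κ K) : (-M).rank ≤ M.rank := by
  rw [Matrix.rank, Matrix.rank]
  refine Submodule.finrank_mono ?_
  rintro _ ⟨x, rfl⟩
  exact ⟨-x, by simp [Matrix.mulVec_neg]⟩

lemma Matrix.rank_sum_le {K α : Type*} [Field K] (s : Finset α) (M : α → Matrix ι κ K) :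
    (∑ a ∈ s, M a).rank ≤ ∑ a ∈ s, (M a).rank := by
  classical
  induction s using Finset.induction_on with
  | empty => simp
  | insert a s ha ih =>
    rw [Finset.sum_insert ha, Finset.sum_insert ha]
    exact (Matrix.rank_add_le_rank_add_rank _ _).trans (by gcongr)

end rank

section sylvester

variable {ι κ : Type*} [Fintype ι] [Fintype κ] [DecidableEq ι] {K : Type*} [Field K]

/-- Sums of `h` terms `B ^ a * L * T a`. -/
def krylovMap (B : Matrix ι ι K) (L : Matrix ι κ K) (h : ℕ) :
    (ℕ → Matrix κ κ K) →ₗ[K] Matrix ι κ K where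
  toFun T := ∑ a ∈ Finset.range h, B ^ a * L * T a
  map_add' T T' := by simp [Matrix.mul_add, Finset.sum_add_distrib]
  map_smul' c T := by simp [Finset.smul_sum]

lemma rank_le_of_mem_range_krylovMap {B : Matrix ι ι K} {L M : Matrix ι κ K} {h : ℕ}
    (hM : M ∈ LinearMap.range (krylovMap B L h)) : M.rank ≤ h * L.rank := by
  obtain ⟨T, rfl⟩ := hM
  change (∑ a ∈ Finset.range h, B ^ a * L * T a).rank ≤ _
  refine (Matrix.rank_sum_le _ _).trans ?_
  refine (Finset.sum_le_card_nsmul _ _ L.rank fun a _ => ?_).trans (by simp)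
  exact (Matrix.rank_mul_le_left _ _).trans (Matrix.rank_mul_le_right _ _)

lemma mul_mem_range_krylovMap {B : Matrix ι ι K} {L M : Matrix ι κ K} {h : ℕ}
    (hM : M ∈ LinearMap.range (krylovMap B L h)) (D : Matrix κ κ K) :
    M * D ∈ LinearMap.range (krylovMap B L h) := by
  obtain ⟨T, rfl⟩ := hM
  refine ⟨fun a => T a * D, ?_⟩
  simp [krylovMap, Matrix.sum_mul, Matrix.mul_assoc]

lemma pow_mul_mul_mem_range_krylovMap {B : Matrix ι ι K} {L : Matrix ι κ K} {h a : ℕ} (ha : a < h)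
    (D : Matrix κ κ K) : B ^ a * L * D ∈ LinearMap.range (krylovMap B L h) := by
  refine ⟨fun b => if b = a then D else 0, ?_⟩
  simp only [krylovMap, LinearMap.coe_mk, AddHom.coe_mk]
  rw [Finset.sum_eq_single_of_mem a (Finset.mem_range.2 ha)]
  · simp
  · intro b _ hb
    simp [hb]

variable [DecidableEq κ]

/-- Telescoping moves factors from B to D, each move costing one term with BY - YD. Antisymmetry in
(i, j) means that only exponents of B below max(i, j) ≤ h occur: h terms rather than h + 1. -/
lemma pow_sub_mem_range_krylovMap (B : Matrix ι ι K) (Y : Matrix ι κ K) (D : Matrix κ κ K)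
    {h i j : ℕ} (hi : i ≤ h) (hj : j ≤ h) :
    B ^ i * Y * D ^ j - B ^ j * Y * D ^ i ∈ LinearMap.range (krylovMap B (B * Y - Y * D) h) := by
  wlog hij : j ≤ i generalizing i j
  · rw [← neg_sub (B ^ j * Y * D ^ i)]
    exact Submodule.neg_mem _ (this hj hi (le_of_not_ge hij))
  obtain ⟨m, rfl⟩ := Nat.exists_eq_add_of_le hij
  clear hij
  induction m with
  | zero => simp
  | succ m ih =>
    have h1 := ih (by omega)
    have h2 : B ^ (j + (m + 1)) * Y * D ^ j - B ^ j * Y * D ^ (j + (m + 1)) =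
        B ^ (j + m) * (B * Y - Y * D) * D ^ j +
          (B ^ (j + m) * Y * D ^ j - B ^ j * Y * D ^ (j + m)) * D := by
      have e1 : B ^ (j + (m + 1)) = B ^ (j + m) * B := by rw [← add_assoc, pow_succ]
      have e2 : D ^ (j + (m + 1)) = D ^ (j + m) * D := by rw [← add_assoc, pow_succ]
      have e3 : D ^ j * D = D * D ^ j := by rw [← pow_succ, pow_succ']
      rw [e1, e2]
      simp only [Matrix.mul_sub, Matrix.sub_mul, Matrix.mul_assoc, e3]
      abel
    rw [h2]
    exact Submodule.add_mem _ (pow_mul_mul_mem_range_krylovMap (by omega) _)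
      (mul_mem_range_krylovMap h1 D)

/-- For rational functions of degree `h`, the commutator of a Sylvester equation with right-hand
side of rank `r` has rank at most `h * r`. -/
lemma rank_aeval_sub_le (B : Matrix ι ι K) (Y : Matrix ι κ K) (D : Matrix κ κ K)
    {p q : Polynomial K} {h : ℕ} (hp : p.natDegree ≤ h) (hq : q.natDegree ≤ h) :
    (Polynomial.aeval B p * Y * Polynomial.aeval D q -
      Polynomial.aeval B q * Y * Polynomial.aeval D p).rank ≤ h * (B * Y - Y * D).rank := by
  refine rank_le_of_mem_range_krylovMap (B := B) ?_
  have he : Polynomial.aeval B p * Y * Polynomial.aeval D q -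
      Polynomial.aeval B q * Y * Polynomial.aeval D p =
      ∑ i ∈ Finset.range (h + 1), ∑ j ∈ Finset.range (h + 1),
        (p.coeff i * q.coeff j) • (B ^ i * Y * D ^ j - B ^ j * Y * D ^ i) := by
    simp only [smul_sub, Finset.sum_sub_distrib]
    congr 1
    · rw [Polynomial.aeval_eq_sum_range' (Nat.lt_succ_of_le hp),
        Polynomial.aeval_eq_sum_range' (Nat.lt_succ_of_le hq), Matrix.sum_mul, Matrix.sum_mul]
      refine Finset.sum_congr rfl fun i _ => ?_
      rw [Matrix.mul_sum]
      refine Finset.sum_congr rfl fun j _ => ?_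
      rw [Matrix.smul_mul, Matrix.smul_mul, Matrix.mul_smul, smul_smul, mul_comm]
    · rw [Finset.sum_comm, Polynomial.aeval_eq_sum_range' (Nat.lt_succ_of_le hp),
        Polynomial.aeval_eq_sum_range' (Nat.lt_succ_of_le hq), Matrix.sum_mul, Matrix.sum_mul]
      refine Finset.sum_congr rfl fun i _ => ?_
      rw [Matrix.mul_sum]
      refine Finset.sum_congr rfl fun j _ => ?_
      rw [Matrix.smul_mul, Matrix.smul_mul, Matrix.mul_smul, smul_smul, mul_comm (p.coeff j)]
  rw [he]
  refine Submodule.sum_mem _ fun i hi => Submodule.sum_mem _ fun j hj => Submodule.smul_mem _ _ ?_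
  exact pow_sub_mem_range_krylovMap B Y D (Nat.lt_succ_iff.1 (Finset.mem_range.1 hi))
    (Nat.lt_succ_iff.1 (Finset.mem_range.1 hj))

end sylvester

section lowRank

variable {ι κ : Type*} [Fintype ι] [Fintype κ] [DecidableEq ι] [DecidableEq κ]

lemma toEuclideanCLM_aeval (A : Matrix ι ι ℂ) (p : Polynomial ℂ) :
    Polynomial.aeval (Matrix.toEuclideanCLM (n := ι) (𝕜 := ℂ) A) p =
      Matrix.toEuclideanCLM (n := ι) (𝕜 := ℂ) (Polynomial.aeval A p) :=
  Polynomial.aeval_algHom_apply (Matrix.toEuclideanCLM (n := ι) (𝕜 := ℂ)).toStarAlgHom.toAlgHom A _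

/-- The Crouzeix–Palencia theorem in terms of the matrix `p(A) q(A)⁻¹`. -/
lemma norm_aeval_mul_inv_le (A : Matrix ι ι ℂ) {p q : Polynomial ℂ}
    (hcop : IsCoprime p q) {S : ℝ} (hS : 0 ≤ S)
    (hpq : ∀ z ∈ convexHull ℝ (Care.numericalRange A), ‖p.eval z‖ ≤ S * ‖q.eval z‖) :
    IsUnit (Polynomial.aeval A q) ∧
      ‖Polynomial.aeval A p * (Polynomial.aeval A q)⁻¹‖ ≤ (1 + √2) * S := by
  have hcp := norm_aeval_le_of_numericalRange A hcop hS hpq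
  simp only [toEuclideanCLM_aeval] at hcp
  -- By the norm bound a vector killed by q(A) is killed by p(A), hence is zero by a Bézout
  -- relation.
  have hdet : (Polynomial.aeval A q).det ≠ 0 := by
    intro h0
    obtain ⟨v, hv, hv'⟩ := Matrix.exists_mulVec_eq_zero_iff.2 h0
    have h1 := hcp (WithLp.toLp 2 v)
    rw [Matrix.toEuclideanCLM_toLp, Matrix.toEuclideanCLM_toLp, hv', WithLp.toLp_zero, norm_zero,
      mul_zero, norm_le_zero_iff, WithLp.toLp_eq_zero] at h1
    obtain ⟨a, b, hab⟩ := hcop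
    have h2 := congrArg (fun r => (Polynomial.aeval A r) *ᵥ v) hab
    simp only [map_add, map_mul, map_one, Matrix.add_mulVec, ← Matrix.mulVec_mulVec, h1, hv',
      Matrix.mulVec_zero, add_zero, Matrix.one_mulVec] at h2
    exact hv h2.symm
  have hunit : IsUnit (Polynomial.aeval A q) :=
    (Matrix.isUnit_iff_isUnit_det _).2 (isUnit_iff_ne_zero.2 hdet)
  refine ⟨hunit, ?_⟩
  rw [Matrix.cstar_norm_def]
  refine ContinuousLinearMap.opNorm_le_bound _ (by positivity) fun x => ?_
  have h1 := hcp (Matrix.toEuclideanCLM (n := ι) (𝕜 := ℂ) (Polynomial.aeval A q)⁻¹ x)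
  rw [← mul_apply_eq_comp, ← mul_apply_eq_comp, ← map_mul, ← map_mul,
    Matrix.mul_nonsing_inv _ (isUnit_iff_ne_zero.2 hdet), map_one] at h1
  exact h1

/-- A solution of a Sylvester equation with a right-hand side of low rank is close to a matrix of
low rank. -/
lemma exists_rank_le_norm_sub_le (B : Matrix ι ι ℂ) (Y : Matrix ι κ ℂ) (D : Matrix κ κ ℂ)
    {p q : Polynomial ℂ} (hcop : IsCoprime p q) {h : ℕ} (hp : p.natDegree ≤ h)
    (hq : q.natDegree ≤ h) {S₁ S₂ : ℝ} (hS₁ : 0 ≤ S₁) (hS₂ : 0 ≤ S₂)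
    (hB : ∀ z ∈ convexHull ℝ (Care.numericalRange B), ‖p.eval z‖ ≤ S₁ * ‖q.eval z‖)
    (hD : ∀ z ∈ convexHull ℝ (Care.numericalRange D), ‖q.eval z‖ ≤ S₂ * ‖p.eval z‖) :
    ∃ R : Matrix ι κ ℂ, R.rank ≤ h * (B * Y - Y * D).rank ∧
      ‖Y - R‖ ≤ (1 + √2) ^ 2 * (S₁ * S₂) * ‖Y‖ := by
  obtain ⟨uB, nB⟩ := norm_aeval_mul_inv_le B hcop hS₁ hB
  obtain ⟨uD, nD⟩ := norm_aeval_mul_inv_le D hcop.symm hS₂ hD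
  have dB := (Matrix.isUnit_iff_isUnit_det _).1 uB
  have dD := (Matrix.isUnit_iff_isUnit_det _).1 uD
  set pB := Polynomial.aeval B p
  set qB := Polynomial.aeval B q
  set pD := Polynomial.aeval D p
  set qD := Polynomial.aeval D q
  have hcomm : qB⁻¹ * pB = pB * qB⁻¹ := by
    have h1 : qB * pB = pB * qB := by
      rw [← map_mul, ← map_mul, mul_comm]
    calc qB⁻¹ * pB = qB⁻¹ * pB * (qB * qB⁻¹) := by
          rw [Matrix.mul_nonsing_inv _ dB, Matrix.mul_one]
      _ = qB⁻¹ * (pB * qB) * qB⁻¹ := by simp only [Matrix.mul_assoc]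
      _ = (qB⁻¹ * qB) * pB * qB⁻¹ := by rw [← h1]; simp only [Matrix.mul_assoc]
      _ = pB * qB⁻¹ := by rw [Matrix.nonsing_inv_mul _ dB, Matrix.one_mul]
  -- This is Y - r(B) Y r(D)⁻¹ with r = p/q, written so that the antisymmetric expression of
  -- `rank_aeval_sub_le` appears.
  refine ⟨-(qB⁻¹ * (pB * Y * qD - qB * Y * pD) * pD⁻¹), ?_, ?_⟩
  · refine (Matrix.rank_neg_le _).trans ?_
    refine ((Matrix.rank_mul_le_left _ _).trans (Matrix.rank_mul_le_right _ _)).trans ?_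
    exact rank_aeval_sub_le B Y D hp hq
  · have he : Y - -(qB⁻¹ * (pB * Y * qD - qB * Y * pD) * pD⁻¹) =
        (pB * qB⁻¹) * Y * (qD * pD⁻¹) := by
      have e1 : qB⁻¹ * (pB * Y * qD - qB * Y * pD) * pD⁻¹ =
          (qB⁻¹ * pB) * Y * (qD * pD⁻¹) - (qB⁻¹ * qB) * Y * (pD * pD⁻¹) := by
        simp only [Matrix.mul_sub, Matrix.sub_mul, Matrix.mul_assoc]
      rw [e1, Matrix.nonsing_inv_mul _ dB, Matrix.mul_nonsing_inv _ dD, hcomm, Matrix.one_mul,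
        Matrix.mul_one]
      abel
    rw [he]
    calc ‖pB * qB⁻¹ * Y * (qD * pD⁻¹)‖ ≤ ‖pB * qB⁻¹‖ * ‖Y‖ * ‖qD * pD⁻¹‖ :=
          (Matrix.l2_opNorm_mul _ _).trans (by gcongr; exact Matrix.l2_opNorm_mul _ _)
      _ ≤ ((1 + √2) * S₁) * ‖Y‖ * ((1 + √2) * S₂) := by gcongr
      _ = (1 + √2) ^ 2 * (S₁ * S₂) * ‖Y‖ := by ring

end lowRank

/-! ### Singular values of real matrices and complex low-rank approximants. -/

section complexification

variable {ι κ : Type*} [Fintype κ]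

/-- The real part of a complex vector. -/
def reVec (x : EuclideanSpace ℂ κ) : EuclideanSpace ℝ κ := WithLp.toLp 2 fun i => (x i).re

/-- The imaginary part of a complex vector. -/
def imVec (x : EuclideanSpace ℂ κ) : EuclideanSpace ℝ κ := WithLp.toLp 2 fun i => (x i).im

lemma norm_sq_eq_reVec_add_imVec (x : EuclideanSpace ℂ κ) :
    ‖x‖ ^ 2 = ‖reVec x‖ ^ 2 + ‖imVec x‖ ^ 2 := by
  simp only [EuclideanSpace.norm_sq_eq, reVec, imVec, ← Finset.sum_add_distrib]
  refine Finset.sum_congr rfl fun i _ => ?_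
  rw [← Complex.normSq_eq_norm_sq, Complex.normSq_apply, Real.norm_eq_abs, Real.norm_eq_abs,
    sq_abs, sq_abs]
  ring

variable [DecidableEq κ]

lemma reVec_toComplex_mulVec (Y : Matrix ι κ ℝ) (x : EuclideanSpace ℂ κ) :
    reVec (WithLp.toLp 2 (Care.toComplex Y *ᵥ x.ofLp)) = Matrix.toEuclideanLin Y (reVec x) := by
  ext i
  simp [reVec, Care.toComplex, Matrix.mulVec, dotProduct, Matrix.toLpLin_apply]

lemma imVec_toComplex_mulVec (Y : Matrix ι κ ℝ) (x : EuclideanSpace ℂ κ) :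
    imVec (WithLp.toLp 2 (Care.toComplex Y *ᵥ x.ofLp)) = Matrix.toEuclideanLin Y (imVec x) := by
  ext i
  simp [imVec, Care.toComplex, Matrix.mulVec, dotProduct, Matrix.toLpLin_apply]

lemma norm_sq_toComplex_mulVec [Fintype ι] (Y : Matrix ι κ ℝ) (x : EuclideanSpace ℂ κ) :
    ‖(WithLp.toLp 2 (Care.toComplex Y *ᵥ x.ofLp) : EuclideanSpace ℂ ι)‖ ^ 2 =
      ‖Matrix.toEuclideanLin Y (reVec x)‖ ^ 2 + ‖Matrix.toEuclideanLin Y (imVec x)‖ ^ 2 := by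
  rw [norm_sq_eq_reVec_add_imVec, reVec_toComplex_mulVec, imVec_toComplex_mulVec]

lemma norm_toComplex_le (X : Matrix κ κ ℝ) : ‖Care.toComplex X‖ ≤ Care.spectralNorm X := by
  rw [Matrix.cstar_norm_def]
  have h0 : 0 ≤ Care.spectralNorm X := norm_nonneg _
  refine ContinuousLinearMap.opNorm_le_bound _ h0 fun x => ?_
  refine le_of_sq_le_sq ?_ (by positivity)
  have h1 := norm_sq_toComplex_mulVec X x
  have h2 : ∀ y, ‖Matrix.toEuclideanLin X y‖ ^ 2 ≤ Care.spectralNorm X ^ 2 * ‖y‖ ^ 2 := fun y => by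
    rw [← mul_pow]
    gcongr
    exact (Matrix.toEuclideanCLM (n := κ) (𝕜 := ℝ) X).le_opNorm y
  have h3 : Matrix.toEuclideanCLM (n := κ) (𝕜 := ℂ) (Care.toComplex X) x =
    WithLp.toLp 2 (Care.toComplex X *ᵥ x.ofLp) := rfl
  rw [h3, h1, mul_pow, norm_sq_eq_reVec_add_imVec x, mul_add]
  exact add_le_add (h2 _) (h2 _)

end complexification

section singularValues

variable {E F : Type*} [NormedAddCommGroup E] [InnerProductSpace ℝ E] [FiniteDimensional ℝ E]
  [NormedAddCommGroup F] [InnerProductSpace ℝ F] [FiniteDimensional ℝ F]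

/-- On the span of the first right singular vectors a linear map expands by at least the
corresponding singular value. -/
lemma exists_orthonormal_singularValues_le (T : E →ₗ[ℝ] F) {k : ℕ} (hk : k < Module.finrank ℝ E) :
    ∃ b : Fin (k + 1) → E, Orthonormal ℝ b ∧ ∀ a : Fin (k + 1) → ℝ,
      T.singularValues k ^ 2 * ‖∑ i, a i • b i‖ ^ 2 ≤ ‖T (∑ i, a i • b i)‖ ^ 2 := by
  set n := Module.finrank ℝ E with hn
  have hsym := T.isSymmetric_adjoint_comp_self
  set B := hsym.eigenvectorBasis hn.symm with hB
  let c : Fin (k + 1) → Fin n := fun i => ⟨i, by omega⟩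
  have hc : Function.Injective c := fun i j h => Fin.ext (by simpa [c] using h)
  have hon : Orthonormal ℝ (fun i => B (c i)) := B.orthonormal.comp c hc
  refine ⟨fun i => B (c i), hon, fun a => ?_⟩
  have hev : ∀ i, (LinearMap.adjoint T ∘ₗ T) (B (c i)) = (T.singularValues i ^ 2) • B (c i) := by
    intro i
    rw [hB, hsym.apply_eigenvectorBasis hn.symm, ← T.sq_singularValues_fin hn.symm (c i)]
    rfl
  have h1 : ‖∑ i, a i • B (c i)‖ ^ 2 = ∑ i, a i * a i := by
    rw [← real_inner_self_eq_norm_sq, hon.inner_sum]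
    simp
  have h2 : ‖T (∑ i, a i • B (c i))‖ ^ 2 = ∑ i : Fin (k + 1), T.singularValues i ^ 2 * (a i * a i) := by
    rw [← real_inner_self_eq_norm_sq, ← LinearMap.adjoint_inner_left, ← LinearMap.comp_apply,
      map_sum]
    simp only [map_smul, hev, smul_smul]
    rw [hon.inner_sum]
    refine Finset.sum_congr rfl fun i _ => ?_
    simp only [conj_trivial]
    ring
  rw [h1, h2, Finset.mul_sum]
  refine Finset.sum_le_sum fun i _ => ?_
  have h3 := mul_self_nonneg (a i)
  have h4 : T.singularValues k ≤ T.singularValues i :=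
    T.singularValues_antitone (Nat.lt_succ_iff.1 i.2)
  have h5 := T.singularValues_nonneg k
  gcongr

end singularValues

section

variable {ι κ : Type*} [Fintype ι] [Fintype κ] [DecidableEq κ]

/-- The singular values of a real matrix are bounded by its distance to the complex matrices of
low rank. -/
lemma singularValue_le_norm_sub (Y : Matrix ι κ ℝ) (R : Matrix ι κ ℂ) {k : ℕ} (hR : R.rank ≤ k) :
    Care.singularValue Y (k + 1) ≤ ‖Care.toComplex Y - R‖ := by
  rw [Care.singularValue, Nat.add_sub_cancel]
  set T := Matrix.toEuclideanLin Y
  rcases le_or_gt (Module.finrank ℝ (EuclideanSpace ℝ κ)) k with hk | hk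
  · rw [T.singularValues_of_finrank_le hk]
    exact norm_nonneg _
  obtain ⟨b, hb, hle⟩ := exists_orthonormal_singularValues_le T hk
  -- The complex span of k + 1 real right singular vectors meets the kernel of R by dimension. A
  -- vector in it has real and imaginary parts in the real span, so Y expands both by at least the
  -- singular value.
  let Ψ : (Fin (k + 1) → ℂ) →ₗ[ℂ] (κ → ℂ) :=
    { toFun := fun a j => ∑ i, a i * (b i j : ℂ)
      map_add' := fun a a' => by
        ext j; simp [add_mul, Finset.sum_add_distrib]
      map_smul' := fun c a => by
        ext j; simp [Finset.mul_sum, mul_assoc] }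
  obtain ⟨a, ha, ha0⟩ : ∃ a, (R.mulVecLin ∘ₗ Ψ) a = 0 ∧ a ≠ 0 := by
    have h1 := LinearMap.finrank_range_add_finrank_ker (R.mulVecLin ∘ₗ Ψ)
    rw [Module.finrank_fin_fun] at h1
    have h2 : Module.finrank ℂ (LinearMap.range (R.mulVecLin ∘ₗ Ψ)) ≤ k :=
      (Submodule.finrank_mono (LinearMap.range_comp_le_range _ _)).trans hR
    have h3 : LinearMap.ker (R.mulVecLin ∘ₗ Ψ) ≠ ⊥ := fun h => by
      rw [h, finrank_bot] at h1
      omega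
    obtain ⟨a, ha, ha0⟩ := Submodule.exists_mem_ne_zero_of_ne_bot h3
    exact ⟨a, ha, ha0⟩
  set x : EuclideanSpace ℂ κ := WithLp.toLp 2 (Ψ a) with hx
  have hre : reVec x = ∑ i, (a i).re • b i := by
    ext j
    simp [reVec, hx, Ψ, WithLp.ofLp_sum]
  have him : imVec x = ∑ i, (a i).im • b i := by
    ext j
    simp [imVec, hx, Ψ, WithLp.ofLp_sum]
  have hnx : ‖x‖ ^ 2 = ∑ i, ‖a i‖ ^ 2 := by
    rw [norm_sq_eq_reVec_add_imVec, hre, him, ← real_inner_self_eq_norm_sq,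
      ← real_inner_self_eq_norm_sq, hb.inner_sum, hb.inner_sum, ← Finset.sum_add_distrib]
    refine Finset.sum_congr rfl fun i _ => ?_
    rw [← Complex.normSq_eq_norm_sq, Complex.normSq_apply]
    simp
  have hx0 : 0 < ‖x‖ := by
    obtain ⟨i, hi⟩ := Function.ne_iff.1 ha0
    have : 0 < ‖x‖ ^ 2 := by
      rw [hnx]
      exact Finset.sum_pos' (fun _ _ => by positivity) ⟨i, Finset.mem_univ _, by
        have := norm_pos_iff.2 hi; positivity⟩
    exact norm_pos_iff.2 fun h => by simp [h] at this
  have h1 : T.singularValues k ^ 2 * ‖x‖ ^ 2 ≤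
      ‖(WithLp.toLp 2 (Care.toComplex Y *ᵥ x.ofLp) : EuclideanSpace ℂ ι)‖ ^ 2 := by
    rw [norm_sq_toComplex_mulVec, norm_sq_eq_reVec_add_imVec x, mul_add, hre, him]
    exact add_le_add (hle _) (hle _)
  have h2 : Care.toComplex Y *ᵥ x.ofLp = (Care.toComplex Y - R) *ᵥ x.ofLp := by
    have : R *ᵥ x.ofLp = 0 := ha
    rw [Matrix.sub_mulVec, this, sub_zero]
  have h3 := Matrix.l2_opNorm_mulVec (Care.toComplex Y - R) x
  rw [h2, ← mul_pow] at h1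
  have h4 := (pow_le_pow_iff_left₀ (mul_nonneg (T.singularValues_nonneg k) (norm_nonneg _))
    (norm_nonneg _) two_ne_zero).1 h1
  exact le_of_mul_le_mul_right (h4.trans h3) hx0

section rank

variable {ι κ : Type*} [Fintype ι] [Fintype κ]

omit [Fintype ι] in
/-- A matrix over a field is a product through its rank. -/
lemma Matrix.exists_eq_mul_of_rank {K : Type*} [Field K] (M : Matrix ι κ K) :
    ∃ (U : Matrix ι (Fin M.rank) K) (V : Matrix (Fin M.rank) κ K), M = U * V := by
  classical
  let b : Module.Basis (Fin M.rank) K (LinearMap.range M.mulVecLin) := Module.finBasis K _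
  let v : κ → LinearMap.range M.mulVecLin := fun j => ⟨M *ᵥ Pi.single j 1, ⟨Pi.single j 1, rfl⟩⟩
  refine ⟨Matrix.of fun i k => (b k : ι → K) i, Matrix.of fun k j => b.repr (v j) k, ?_⟩
  ext i j
  have h1 := congrArg (fun w : LinearMap.range M.mulVecLin => (w : ι → K) i) (b.sum_repr (v j))
  have h2 : ((v j : LinearMap.range M.mulVecLin) : ι → K) i = M i j := by
    simp [v]
  simp only [h2] at h1
  rw [← h1, Matrix.mul_apply]
  simp only [AddSubmonoidClass.coe_finsetSum, Submodule.coe_smul, Finset.sum_apply, Pi.smul_apply,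
    smul_eq_mul, Matrix.of_apply]
  exact Finset.sum_congr rfl fun k _ => mul_comm _ _

omit [Fintype ι] in
lemma toComplex_mul {μ : Type*} (M : Matrix ι κ ℝ) (N : Matrix κ μ ℝ) :
    Care.toComplex (M * N) = Care.toComplex M * Care.toComplex N := by
  ext i j
  simp [Care.toComplex, Matrix.mul_apply]

omit [Fintype ι] in
lemma rank_toComplex_le (M : Matrix ι κ ℝ) : (Care.toComplex M).rank ≤ M.rank := by
  obtain ⟨U, V, h⟩ := M.exists_eq_mul_of_rank
  conv_lhs => rw [h, toComplex_mul]
  exact (Matrix.rank_mul_le_left _ _).trans ((Matrix.rank_le_card_width _).trans (by simp))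

end rank

/-! ### Compressions and numerical ranges. -/

section selection

variable {ι κ μ : Type*} [Fintype ι] [Fintype κ] [DecidableEq ι] [DecidableEq κ]

/-- The isometry that extends vectors by zero along an injection. -/
def selection (e : κ → ι) : Matrix ι κ ℂ := (1 : Matrix ι ι ℂ).submatrix id e

omit [Fintype κ] [DecidableEq κ] in
lemma conjTranspose_selection_mul_mul [Fintype μ] (M : Matrix ι ι ℂ) (e : κ → ι) (f : μ → ι) :
    (selection e)ᴴ * M * selection f = M.submatrix e f := by
  ext i j
  simp [selection, Matrix.mul_apply, Matrix.one_apply, Finset.sum_ite_eq]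

lemma conjTranspose_selection_mul_self {e : κ → ι} (he : Function.Injective e) :
    (selection e)ᴴ * selection e = 1 := by
  have h := conjTranspose_selection_mul_mul 1 e e
  rw [Matrix.mul_one, Matrix.submatrix_one _ he] at h
  exact h

lemma norm_selection_le {e : κ → ι} (he : Function.Injective e) : ‖selection e‖ ≤ 1 := by
  have h := Matrix.l2_opNorm_conjTranspose_mul_self (selection e)
  rw [conjTranspose_selection_mul_self he] at h
  have h1 : ‖(1 : Matrix κ κ ℂ)‖ ≤ 1 := by
    rw [← Matrix.diagonal_one, Matrix.l2_opNorm_diagonal]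
    exact (pi_norm_le_iff_of_nonneg zero_le_one).2 fun i => by simp
  nlinarith [norm_nonneg (selection e)]

lemma norm_submatrix_le [Fintype μ] [DecidableEq μ] (M : Matrix ι ι ℂ) {e : κ → ι} {f : μ → ι}
    (he : Function.Injective e) (hf : Function.Injective f) : ‖M.submatrix e f‖ ≤ ‖M‖ := by
  rw [← conjTranspose_selection_mul_mul]
  calc _ ≤ ‖(selection e)ᴴ‖ * ‖M‖ * ‖selection f‖ :=
        (Matrix.l2_opNorm_mul _ _).trans (by gcongr; exact Matrix.l2_opNorm_mul _ _)
    _ ≤ 1 * ‖M‖ * 1 := by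
        rw [Matrix.l2_opNorm_conjTranspose]
        gcongr
        · exact norm_selection_le he
        · exact norm_selection_le hf
    _ = ‖M‖ := by ring

omit [DecidableEq ι] in
lemma EuclideanSpace.norm_eq_one_iff_dotProduct (x : EuclideanSpace ℂ ι) :
    ‖x‖ = 1 ↔ star x.ofLp ⬝ᵥ x.ofLp = 1 := by
  have h : star x.ofLp ⬝ᵥ x.ofLp = ((‖x‖ ^ 2 : ℝ) : ℂ) := by
    rw [dotProduct_comm, ← EuclideanSpace.inner_eq_star_dotProduct, inner_self_eq_norm_sq_to_K]
    simp
  rw [h]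
  norm_cast
  constructor
  · intro h; simp [h]
  · intro h; exact (pow_eq_one_iff_of_nonneg (norm_nonneg _) two_ne_zero).1 h

/-- Extension by zero is an isometry that restricts the quadratic form to the chosen indices. -/
lemma numericalRange_submatrix_subset (M : Matrix ι ι ℂ) {e : κ → ι} (he : Function.Injective e) :
    Care.numericalRange (M.submatrix e e) ⊆ Care.numericalRange M := by
  rintro _ ⟨x, hx, rfl⟩
  have key : ∀ N : Matrix ι ι ℂ, star (selection e *ᵥ x.ofLp) ⬝ᵥ (N *ᵥ (selection e *ᵥ x.ofLp)) =
      star x.ofLp ⬝ᵥ (N.submatrix e e *ᵥ x.ofLp) := fun N => by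
    rw [← conjTranspose_selection_mul_mul, Matrix.star_mulVec, ← Matrix.dotProduct_mulVec,
      Matrix.mulVec_mulVec, Matrix.mulVec_mulVec]
  refine ⟨WithLp.toLp 2 (selection e *ᵥ x.ofLp), ?_, (key M).symm⟩
  rw [EuclideanSpace.norm_eq_one_iff_dotProduct] at hx ⊢
  have := key 1
  rw [Matrix.one_mulVec, Matrix.submatrix_one _ he, Matrix.one_mulVec] at this
  exact this.trans hx

-- A unit vector x for the transpose corresponds to its entrywise conjugate for M.
omit [DecidableEq ι] in
lemma numericalRange_transpose_subset (M : Matrix ι ι ℂ) :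
    Care.numericalRange Mᵀ ⊆ Care.numericalRange M := by
  rintro _ ⟨x, hx, rfl⟩
  refine ⟨WithLp.toLp 2 (star x.ofLp), ?_, ?_⟩
  · rw [EuclideanSpace.norm_eq_one_iff_dotProduct] at hx ⊢
    simpa [dotProduct_comm] using hx
  · simp only [star_star]
    rw [Matrix.mulVec_transpose, dotProduct_comm, ← Matrix.dotProduct_mulVec]

omit [DecidableEq ι] in
lemma numericalRange_neg_subset (M : Matrix ι ι ℂ) :
    Care.numericalRange (-M) ⊆ -Care.numericalRange M := by
  rintro _ ⟨x, hx, rfl⟩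
  exact ⟨x, hx, by simp [Matrix.neg_mulVec]⟩

end selection

/-! ### Uniqueness for the homogeneous Sylvester equation. -/

section uniqueness

variable {ι : Type*} [Fintype ι] [DecidableEq ι]

lemma re_neg_of_isRoot_charpoly {C : Matrix ι ι ℂ} (hC : Care.numericalRange C ⊆ Care.leftHalfPlane)
    {μ : ℂ} (hμ : C.charpoly.IsRoot μ) : μ.re < 0 := by
  obtain ⟨x, hx, hxC⟩ := exists_unit_eigenvector C hμ
  have h := hC (inner_mem_numericalRange C hx)
  rw [hxC, inner_smul_right, inner_self_eq_norm_sq_to_K, hx] at h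
  simpa [Care.leftHalfPlane] using h

/-- A homogeneous Sylvester equation with a semistable and a strictly dissipative coefficient has
only the zero solution. -/
lemma eq_zero_of_sylvester {G C D : Matrix ι ι ℂ} (hG : ∀ μ ∈ spectrum ℂ G, μ.re ≤ 0)
    (hC : Care.numericalRange C ⊆ Care.leftHalfPlane) (h : G * D + D * C = 0) : D = 0 := by
  rcases isEmpty_or_nonempty ι with hι | hι
  · exact Subsingleton.elim _ _
  have h0 : G * D - D * (-C) = 0 := by rw [← h]; noncomm_ring
  -- Since GD = D(-C), every polynomial intertwines in the same way; the characteristic polynomial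
  -- of G kills the left side by Cayley–Hamilton.
  have h1 := rank_aeval_sub_le G D (-C) (p := G.charpoly) (q := 1) le_rfl (by simp)
  rw [h0, Matrix.rank_zero, mul_zero, Nat.le_zero, Matrix.aeval_self_charpoly, Matrix.zero_mul,
    Matrix.zero_mul, zero_sub, map_one, Matrix.one_mul] at h1
  have h2 : -(D * Polynomial.aeval (-C) G.charpoly) = 0 := by
    obtain ⟨U, V, hUV⟩ := (-(D * Polynomial.aeval (-C) G.charpoly)).exists_eq_mul_of_rank
    have : IsEmpty (Fin (-(D * Polynomial.aeval (-C) G.charpoly)).rank) := by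
      rw [h1]; infer_instance
    rw [hUV]
    ext i j
    simp [Matrix.mul_apply]
  have hdeg : 0 < G.charpoly.degree := by
    rw [Matrix.charpoly_degree_eq_dim]
    exact_mod_cast Fintype.card_pos
  -- The eigenvalues of -C have positive real part, while the roots of this polynomial have
  -- nonpositive real part.
  have h3 : IsUnit (Polynomial.aeval (-C) G.charpoly) := by
    rw [← spectrum.zero_notMem_iff ℂ, spectrum.map_polynomial_aeval_of_degree_pos _ _ hdeg]
    rintro ⟨μ, hμ, hμ0⟩
    have hμG : μ.re ≤ 0 := hG μ (Matrix.mem_spectrum_iff_isRoot_charpoly.2 hμ0)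
    have hμC : -μ ∈ spectrum ℂ C := by
      rw [← spectrum.neg_eq] at hμ
      simpa using hμ
    have := re_neg_of_isRoot_charpoly hC (Matrix.mem_spectrum_iff_isRoot_charpoly.1 hμC)
    simp only [Complex.neg_re] at this
    linarith
  exact (h3.mul_left_eq_zero).1 (neg_eq_zero.1 h2)

end uniqueness

/-! ### From polynomial pairs to Zolotarev numbers. -/

section zolotarev

lemma ratAbs_one (z : ℂ) : Care.ratAbs 1 z = 1 := by
  simp [Care.ratAbs]

lemma one_mem_zolotarevAdmissible (h : ℕ) (E G : Set ℂ) : 1 ∈ Care.zolotarevAdmissible h E G := by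
  refine ⟨by simp, by simp, ?_, ?_⟩
  · simp only [ratAbs_one]
    exact ne_top_of_le_ne_top ENNReal.one_ne_top (iSup₂_le fun _ _ => le_rfl)
  · simp only [ratAbs_one]
    exact ne_of_gt (lt_of_lt_of_le one_pos (le_iInf₂ fun _ _ => le_rfl))

/-- A bound valid for every pair of coprime polynomials of degree at most `h` passes to the
Zolotarev number. -/
lemma le_mul_zolotarev {h : ℕ} {E G : Set ℂ} {c k : ℝ} (hk : 0 < k)
    (H : ∀ (p q : Polynomial ℂ) (S₁ S₂ : ℝ), IsCoprime p q → p.natDegree ≤ h → q.natDegree ≤ h →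
      0 ≤ S₁ → 0 ≤ S₂ → (∀ z ∈ E, ‖p.eval z‖ ≤ S₁ * ‖q.eval z‖) →
      (∀ z ∈ G, ‖q.eval z‖ ≤ S₂ * ‖p.eval z‖) → c ≤ k * (S₁ * S₂)) :
    c ≤ k * Care.zolotarev h E G := by
  have hdiv : ∀ g ∈ Care.zolotarevAdmissible h E G,
      (⨆ z ∈ E, Care.ratAbs g z) / (⨅ z ∈ G, Care.ratAbs g z) ≠ ⊤ :=
    fun g hg => ENNReal.div_ne_top hg.2.2.1 hg.2.2.2
  have hfin : (⨅ g ∈ Care.zolotarevAdmissible h E G,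
      (⨆ z ∈ E, Care.ratAbs g z) / (⨅ z ∈ G, Care.ratAbs g z)) ≠ ⊤ :=
    ne_top_of_le_ne_top (hdiv 1 (one_mem_zolotarevAdmissible h E G))
      (iInf₂_le _ (one_mem_zolotarevAdmissible h E G))
  rw [← div_le_iff₀' hk, Care.zolotarev, ← ENNReal.ofReal_le_iff_le_toReal hfin]
  refine le_iInf₂ fun g hg => ?_
  rw [ENNReal.ofReal_le_iff_le_toReal (hdiv g hg), div_eq_mul_inv _ (iInf _), ENNReal.toReal_mul,
    div_le_iff₀' hk]
  obtain ⟨hp, hq, hS, hI⟩ := hg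
  -- S₁ is the supremum and S₂ the inverse of the infimum. An infinite infimum gives S₂ = 0, which
  -- is consistent: every point of G is then a pole and q vanishes there.
  refine H g.num g.denom _ _ (RatFunc.isCoprime_num_denom g) hp hq ENNReal.toReal_nonneg
    ENNReal.toReal_nonneg (fun z hz => ?_) fun z hz => ?_
  · have h1 : Care.ratAbs g z ≤ ⨆ z ∈ E, Care.ratAbs g z := 
      le_iSup₂ (f := fun z (_ : z ∈ E) => Care.ratAbs g z) z hz
    rw [Care.ratAbs] at h1
    split_ifs at h1 with h0
    · exact absurd (top_le_iff.1 h1) hS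
    · rw [ENNReal.ofReal_le_iff_le_toReal hS, norm_div, div_le_iff₀ (norm_pos_iff.2 h0)] at h1
      exact h1
  · have h1 : (⨅ z ∈ G, Care.ratAbs g z) ≤ Care.ratAbs g z := 
      iInf₂_le (f := fun z (_ : z ∈ G) => Care.ratAbs g z) z hz
    rw [Care.ratAbs] at h1
    split_ifs at h1 with h0
    · rw [h0, norm_zero]
      positivity
    · have hp0 : g.num.eval z ≠ 0 := fun hp0 => hI (by simpa [hp0] using h1)
      have hpos : 0 < ‖g.num.eval z / g.denom.eval z‖ := norm_pos_iff.2 (div_ne_zero hp0 h0)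
      have h2 := ENNReal.inv_le_inv.2 h1
      rw [← ENNReal.ofReal_inv_of_pos hpos,
        ENNReal.ofReal_le_iff_le_toReal (ENNReal.inv_ne_top.2 hI), norm_div, inv_div,
        div_le_iff₀ (norm_pos_iff.2 hp0)] at h2
      exact h2

end zolotarev

/-! ### Off-diagonal blocks of the Riccati equation. -/

section riccati

variable {ι α β : Type*} [Fintype ι] [Fintype α] [Fintype β] {K : Type*}

lemma submatrix_mul_eq_add [CommRing K] {γ δ : Type*} (M N : Matrix ι ι K) {f : α → ι} {g : β → ι}
    (hfg : Function.Bijective (Sum.elim f g)) (a : γ → ι) (b : δ → ι) :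
    (M * N).submatrix a b =
      M.submatrix a f * N.submatrix f b + M.submatrix a g * N.submatrix g b := by
  ext i j
  simp only [Matrix.submatrix_apply, Matrix.mul_apply, Matrix.add_apply]
  rw [← Fintype.sum_bijective _ hfg (fun x => M (a i) (Sum.elim f g x) * N (Sum.elim f g x) (b j))
    _ fun x => rfl, Fintype.sum_sum_type]
  simp

/-- The off-diagonal block of a solution of a Riccati equation solves a Sylvester equation whose
right-hand side has small rank. -/
lemma rank_sylvester_block_le {A F Q X : Matrix ι ι ℝ} (hF : Fᵀ = F) (hXs : Xᵀ = X)
    (hX : Aᵀ * X + X * A - X * F * X + Q = 0) {f : α → ι} {g : β → ι}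
    (hfg : Function.Bijective (Sum.elim f g)) :
    (((Care.closedLoop A F X).submatrix f f)ᵀ * X.submatrix f g +
      X.submatrix f g * (Care.closedLoop A F X).submatrix g g).rank ≤
      (A.submatrix g f).rank + (A.submatrix f g).rank + (F.submatrix f g).rank +
        (F.submatrix g f).rank + (Q.submatrix f g).rank := by
  have h1 : ((Care.closedLoop A F X).submatrix f f)ᵀ =
      Aᵀ.submatrix f f - (X * F).submatrix f f := by
    rw [Matrix.transpose_submatrix, Care.closedLoop, Matrix.transpose_sub, Matrix.transpose_mul,
      hF, hXs, Matrix.submatrix_sub]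
    rfl
  have h2 : (Care.closedLoop A F X).submatrix g g = A.submatrix g g - (F.submatrix g f *
      X.submatrix f g + F.submatrix g g * X.submatrix g g) := by
    rw [← submatrix_mul_eq_add F X hfg]
    rfl
  have h3 : (Aᵀ.submatrix f f * X.submatrix f g + Aᵀ.submatrix f g * X.submatrix g g) +
      (X.submatrix f f * A.submatrix f g + X.submatrix f g * A.submatrix g g) -
      ((X * F).submatrix f f * X.submatrix f g +
        (X.submatrix f f * F.submatrix f g + X.submatrix f g * F.submatrix g g) *
          X.submatrix g g) + Q.submatrix f g = 0 := by
    rw [← submatrix_mul_eq_add X F hfg, ← submatrix_mul_eq_add X A hfg,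
      ← submatrix_mul_eq_add Aᵀ X hfg, ← submatrix_mul_eq_add (X * F) X hfg]
    exact congrArg (fun M : Matrix ι ι ℝ => M.submatrix f g) hX
  -- C_gg contains F_gf X_fg, which the (f,g) block of XFX does not produce; hence the quadratic
  -- term in X_fg on the right. Each term has one off-diagonal block of A, F or Q as a factor.
  have h4 : ((Care.closedLoop A F X).submatrix f f)ᵀ * X.submatrix f g +
      X.submatrix f g * (Care.closedLoop A F X).submatrix g g =
      -(Aᵀ.submatrix f g * X.submatrix g g) + -(X.submatrix f f * A.submatrix f g) +
        X.submatrix f f * F.submatrix f g * X.submatrix g g +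
        -(X.submatrix f g * F.submatrix g f * X.submatrix f g) + -Q.submatrix f g := by
    rw [← sub_eq_zero, ← h3, h1, h2]
    simp only [Matrix.add_mul, Matrix.sub_mul, Matrix.mul_sub, Matrix.mul_add, Matrix.mul_assoc]
    abel
  have hA : (Aᵀ.submatrix f g).rank = (A.submatrix g f).rank := by
    rw [← Matrix.transpose_submatrix, Matrix.rank_transpose]
  rw [h4]
  refine (Matrix.rank_add_le_rank_add_rank _ _).trans (add_le_add ?_ (Matrix.rank_neg_le _))
  refine (Matrix.rank_add_le_rank_add_rank _ _).trans (add_le_add ?_ ?_)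
  · refine (Matrix.rank_add_le_rank_add_rank _ _).trans (add_le_add ?_ ?_)
    · refine (Matrix.rank_add_le_rank_add_rank _ _).trans (add_le_add ?_ ?_)
      · exact (Matrix.rank_neg_le _).trans ((Matrix.rank_mul_le_left _ _).trans hA.le)
      · exact (Matrix.rank_neg_le _).trans (Matrix.rank_mul_le_right _ _)
    · exact (Matrix.rank_mul_le_left _ _).trans (Matrix.rank_mul_le_right _ _)
  · exact (Matrix.rank_neg_le _).trans
      ((Matrix.rank_mul_le_left _ _).trans (Matrix.rank_mul_le_right _ _))

/-- A solution whose closed-loop matrix is strictly dissipative is the stabilizing solution. -/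
lemma eq_of_isStabilizingSolution [DecidableEq ι] {A F Q X Y : Matrix ι ι ℝ} (hF : Fᵀ = F)
    (hX : Care.IsStabilizingSolution A F Q X) (hY : Aᵀ * Y + Y * A - Y * F * Y + Q = 0)
    (hW : Care.numericalRange (Care.toComplex (Care.closedLoop A F Y)) ⊆ Care.leftHalfPlane) :
    Y = X := by
  have hXs : Xᵀ = X := by simpa using hX.posSemidef.isHermitian.eq
  have hreal : (Care.closedLoop A F X)ᵀ * (X - Y) + (X - Y) * Care.closedLoop A F Y = 0 := by
    rw [← sub_self (0 : Matrix ι ι ℝ)]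
    nth_rw 1 [← hX.riccati]
    rw [← hY, Care.closedLoop, Care.closedLoop, Matrix.transpose_sub, Matrix.transpose_mul, hF, hXs]
    noncomm_ring
  have hcomplex : (Care.toComplex (Care.closedLoop A F X))ᵀ * Care.toComplex (X - Y) +
      Care.toComplex (X - Y) * Care.toComplex (Care.closedLoop A F Y) = 0 := by
    have h := congrArg (Care.toComplex) hreal
    have hadd : ∀ M N : Matrix ι ι ℝ, Care.toComplex (M + N) =
      Care.toComplex M + Care.toComplex N := fun M N => by ext; simp [Care.toComplex]
    rw [hadd, toComplex_mul, toComplex_mul] at h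
    refine Eq.trans h ?_
    ext
    simp [Care.toComplex]
  have hzero := eq_zero_of_sylvester (fun μ hμ => hX.stable μ ?_) hW hcomplex
  · ext i j
    have := congrFun (congrFun hzero i) j
    simp only [Care.toComplex, Matrix.map_apply, Matrix.sub_apply, Matrix.zero_apply,
      Complex.ofReal_eq_zero] at this
    linarith
  · rw [Matrix.mem_spectrum_iff_isRoot_charpoly] at hμ ⊢
    rwa [Matrix.charpoly_transpose] at hμ

/-- Decay of the singular values of an off-diagonal block of a solution of a Riccati equation. -/
lemma singularValue_block_le [DecidableEq ι] [DecidableEq α] [DecidableEq β]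
    {A F Q X : Matrix ι ι ℝ} (hF : Fᵀ = F) (hXs : Xᵀ = X)
    (hX : Aᵀ * X + X * A - X * F * X + Q = 0) {f : α → ι} {g : β → ι}
    (hfg : Function.Bijective (Sum.elim f g)) {E : Set ℂ}
    (hE : convexHull ℝ (Care.numericalRange (Care.toComplex (Care.closedLoop A F X))) ⊆ E)
    {t : ℕ} (ht : (A.submatrix g f).rank + (A.submatrix f g).rank + (F.submatrix f g).rank +
        (F.submatrix g f).rank + (Q.submatrix f g).rank ≤ t) (h : ℕ) :
    Care.singularValue (X.submatrix f g) (h * t + 1) / Care.spectralNorm X ≤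
      (1 + √2) ^ 2 * Care.zolotarev h E (-E) := by
  have hf : Function.Injective f := fun a b hab =>
    Sum.inl_injective (hfg.1 (a₁ := Sum.inl a) (a₂ := Sum.inl b) hab)
  have hg : Function.Injective g := fun a b hab =>
    Sum.inr_injective (hfg.1 (a₁ := Sum.inr a) (a₂ := Sum.inr b) hab)
  refine le_mul_zolotarev (by positivity) fun p q S₁ S₂ hcop hp hq hS₁ hS₂ hpE hqE => ?_
  set C := Care.closedLoop A F X with hC
  have hCf : convexHull ℝ (Care.numericalRange (Care.toComplex (C.submatrix f f)ᵀ)) ⊆ E :=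
    (convexHull_mono ((numericalRange_transpose_subset (Care.toComplex (C.submatrix f f))).trans
      (numericalRange_submatrix_subset (Care.toComplex C) hf))).trans hE
  have hCg : convexHull ℝ (Care.numericalRange (-Care.toComplex (C.submatrix g g))) ⊆ -E := by
    refine (convexHull_mono ((numericalRange_neg_subset _).trans (Set.neg_subset_neg.2
      (numericalRange_submatrix_subset (Care.toComplex C) hg)))).trans ?_
    rw [convexHull_neg]
    exact Set.neg_subset_neg.2 hE
  obtain ⟨R, hR, hYR⟩ := exists_rank_le_norm_sub_le (Care.toComplex (C.submatrix f f)ᵀ)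
    (Care.toComplex (X.submatrix f g)) (-Care.toComplex (C.submatrix g g)) hcop hp hq hS₁ hS₂
    (fun z hz => hpE z (hCf hz)) (fun z hz => hqE z (hCg hz))
  have hrank : R.rank ≤ h * t := by
    refine hR.trans (Nat.mul_le_mul_left _ (le_trans ?_
      ((rank_sylvester_block_le hF hXs hX hfg).trans ht)))
    refine le_trans (le_of_eq ?_) (rank_toComplex_le _)
    congr 1
    rw [Matrix.mul_neg, sub_neg_eq_add, ← toComplex_mul, ← toComplex_mul]
    ext
    simp [Care.toComplex, hC]
  have hnorm : ‖Care.toComplex (X.submatrix f g)‖ ≤ Care.spectralNorm X :=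
    (norm_submatrix_le (Care.toComplex X) hf hg).trans (norm_toComplex_le X)
  -- Nonnegativity of the denominator suffices: for X = 0 the quotient is 0 by convention.
  refine div_le_of_le_mul₀ (norm_nonneg _) (by positivity) ?_
  calc _ ≤ _ := singularValue_le_norm_sub _ R hrank
    _ ≤ _ := hYR
    _ ≤ _ := by gcongr

end riccati

/-! ### Consecutive index blocks and the theorem. -/

section blocks

variable {n : ℕ}

lemma rank_lowerBlock_le_qsrank (M : Matrix (Fin n) (Fin n) ℝ) {s : ℕ} (hs : s ∈ Finset.Ico 1 n) :
    (Care.lowerBlock M s).rank ≤ Care.qsrank M :=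
  (le_max_left _ _).trans (Finset.le_sup (f := fun s => max (Care.lowerBlock M s).rank
    (Care.upperBlock M s).rank) hs)

lemma rank_upperBlock_le_qsrank (M : Matrix (Fin n) (Fin n) ℝ) {s : ℕ} (hs : s ∈ Finset.Ico 1 n) :
    (Care.upperBlock M s).rank ≤ Care.qsrank M :=
  (le_max_right _ _).trans (Finset.le_sup (f := fun s => max (Care.lowerBlock M s).rank
    (Care.upperBlock M s).rank) hs)

lemma bijective_sumElim_val {ι : Type*} {p q : ι → Prop} (hpq : ∀ i, p i ↔ ¬ q i) :
    Function.Bijective (Sum.elim (Subtype.val : {i // p i} → ι) (Subtype.val : {i // q i} → ι)) := by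
  constructor
  · refine Function.Injective.sumElim Subtype.val_injective Subtype.val_injective ?_
    rintro ⟨a, ha⟩ ⟨b, hb⟩ rfl
    exact (hpq _).1 ha hb
  · intro i
    by_cases hi : q i
    · exact ⟨Sum.inr ⟨i, hi⟩, rfl⟩
    · exact ⟨Sum.inl ⟨i, (hpq i).2 hi⟩, rfl⟩

/-- The stabilizing solution for the full leading submatrices is the stabilizing solution itself. -/
lemma numericalRange_closedLoop_subset {A F Q X : Matrix (Fin n) (Fin n) ℝ} (hF : Fᵀ = F)
    (hX : Care.IsStabilizingSolution A F Q X) {Y : Matrix (Care.FirstIdx n n) (Care.FirstIdx n n) ℝ}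
    (hY : Care.IsStabilizingSolution (Care.leading A n) (Care.leading F n) (Care.leading Q n) Y)
    (hW : Care.numericalRange (Care.toComplex
      (Care.closedLoop (Care.leading A n) (Care.leading F n) Y)) ⊆ Care.leftHalfPlane) :
    Care.numericalRange (Care.toComplex (Care.closedLoop A F X)) ⊆ Care.numericalRange
      (Care.toComplex (Care.closedLoop (Care.leading A n) (Care.leading F n) Y)) := by
  let e : Fin n ≃ Care.FirstIdx n n := ⟨fun i => ⟨i, i.2⟩, fun i => i, fun _ => rfl, fun _ => rfl⟩
  have hsub : ∀ M : Matrix (Fin n) (Fin n) ℝ, (Care.leading M n).submatrix e e = M := fun M => rfl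
  have hclosed : (Care.closedLoop (Care.leading A n) (Care.leading F n) Y).submatrix e e =
      Care.closedLoop A F (Y.submatrix e e) := by
    rw [Care.closedLoop, Care.closedLoop, Matrix.submatrix_sub, Pi.sub_apply, Pi.sub_apply,
      ← Matrix.submatrix_mul_equiv _ _ e e e, hsub, hsub]
  have hrange : Care.numericalRange (Care.toComplex (Care.closedLoop A F (Y.submatrix e e))) ⊆
      Care.numericalRange (Care.toComplex
        (Care.closedLoop (Care.leading A n) (Care.leading F n) Y)) := by
    rw [← hclosed]
    exact numericalRange_submatrix_subset
      (Care.toComplex (Care.closedLoop (Care.leading A n) (Care.leading F n) Y)) e.injective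
  have hric : Aᵀ * Y.submatrix e e + Y.submatrix e e * A -
      Y.submatrix e e * F * Y.submatrix e e + Q = 0 := by
    have h := congrArg (fun M => M.submatrix e e) hY.riccati
    simp only [Matrix.submatrix_add, Matrix.submatrix_sub, Pi.add_apply, Pi.sub_apply,
      ← Matrix.submatrix_mul_equiv _ _ e e e] at h
    exact h
  rwa [eq_of_isStabilizingSolution hF hX hric (hrange.trans hW)] at hrange

end blocks

end

theorem theorem2p2 {n : ℕ} (A F Q X : Matrix (Fin n) (Fin n) ℝ) (ra rf rq : ℕ)
    (hA : Care.qsrank A = ra) (hF : Care.qsrank F = rf) (hQ : Care.qsrank Q = rq)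
    (hWA : Care.numericalRange (Care.toComplex A) ⊆ Care.leftHalfPlane)
    (hFpsd : F.PosSemidef) (hQpsd : Q.PosSemidef)
    (hX : Care.IsStabilizingSolution A F Q X)
    (Xlead : (j : ℕ) → Matrix (Care.FirstIdx n j) (Care.FirstIdx n j) ℝ)
    (Xtrail : (j : ℕ) → Matrix (Care.LastIdx n j) (Care.LastIdx n j) ℝ)
    (hXlead : ∀ j ∈ Finset.Icc 1 n, Care.IsStabilizingSolution
      (Care.leading A j) (Care.leading F j) (Care.leading Q j) (Xlead j))
    (hXtrail : ∀ j ∈ Finset.Icc 1 n, Care.IsStabilizingSolution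
      (Care.trailing A j) (Care.trailing F j) (Care.trailing Q j) (Xtrail j))
    (E : Set ℂ) (hE : E ⊆ Care.leftHalfPlane)
    (hEhull : convexHull ℝ
      ((⋃ j ∈ Finset.Icc 1 n, Care.numericalRange (Care.toComplex
          (Care.closedLoop (Care.leading A j) (Care.leading F j) (Xlead j)))) ∪
        (⋃ j ∈ Finset.Icc 1 n, Care.numericalRange (Care.toComplex
          (Care.closedLoop (Care.trailing A j) (Care.trailing F j) (Xtrail j))))) ⊆ E)
    (h : ℕ) (hh : 1 ≤ h) (s : ℕ) (hs : s ∈ Finset.Ico 1 n) :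
    Care.singularValue (Care.lowerBlock X s) (h * (4 * ra + 2 * rf + 2 * rq) + 1)
        / Care.spectralNorm X ≤ (1 + √2) ^ 2 * Care.zolotarev h E (-E) ∧
    Care.singularValue (Care.upperBlock X s) (h * (4 * ra + 2 * rf + 2 * rq) + 1)
        / Care.spectralNorm X ≤ (1 + √2) ^ 2 * Care.zolotarev h E (-E) := by
  have hFs : Fᵀ = F := by simpa using hFpsd.isHermitian.eq
  have hXs : Xᵀ = X := by simpa using hX.posSemidef.isHermitian.eq
  have hn : n ∈ Finset.Icc 1 n := by
    rw [Finset.mem_Ico] at hs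
    rw [Finset.mem_Icc]
    omega
  have hsub : Care.numericalRange (Care.toComplex
      (Care.closedLoop (Care.leading A n) (Care.leading F n) (Xlead n))) ⊆
      (⋃ j ∈ Finset.Icc 1 n, Care.numericalRange (Care.toComplex
          (Care.closedLoop (Care.leading A j) (Care.leading F j) (Xlead j)))) ∪
        (⋃ j ∈ Finset.Icc 1 n, Care.numericalRange (Care.toComplex
          (Care.closedLoop (Care.trailing A j) (Care.trailing F j) (Xtrail j)))) :=
    (Set.subset_biUnion_of_mem (u := fun j => Care.numericalRange (Care.toComplex
      (Care.closedLoop (Care.leading A j) (Care.leading F j) (Xlead j)))) hn).trans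
      Set.subset_union_left
  -- E lies in the open left half-plane, so the leading solution of size n has a strictly
  -- dissipative closed loop; this identifies it with X, although X is only assumed semistable.
  have hrange := numericalRange_closedLoop_subset hFs hX (hXlead n hn)
    (((hsub.trans (subset_convexHull ℝ _)).trans hEhull).trans hE)
  have hCE := (convexHull_mono (𝕜 := ℝ) (hrange.trans hsub)).trans hEhull
  have hAl := rank_lowerBlock_le_qsrank A hs
  have hAu := rank_upperBlock_le_qsrank A hs
  have hFl := rank_lowerBlock_le_qsrank F hs
  have hFu := rank_upperBlock_le_qsrank F hs
  have hQl := rank_lowerBlock_le_qsrank Q hs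
  have hQu := rank_upperBlock_le_qsrank Q hs
  rw [Care.lowerBlock] at hAl hFl hQl
  rw [Care.upperBlock] at hAu hFu hQu
  constructor
  · refine singularValue_block_le hFs hXs hX.riccati
      (bijective_sumElim_val fun i => not_lt.symm) hCE ?_ h
    -- The five block ranks add up to at most 2ra + 2rf + rq, which is below 4ra + 2rf + 2rq.
    omega
  · refine singularValue_block_le hFs hXs hX.riccati
      (bijective_sumElim_val fun i => not_le.symm) hCE ?_ h
    omega
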